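/- **Model.** Let $K$ be the number of customer classes. For $k=1,\dots,K$ let $P_k=(P_{k,i,j})$ be an irreducible stochastic matrix on $\{0,1,\dots,M_k\}$, $M_k\ge 1$, with stationary distribution $\pi_k$; for all $i,j$ let $a_{k,i,j}$ be a probability law on $\{0,1,2,\dots\}$ with $a_{k,i,0}$ concentrated at $0$ and $a_{k,i,j}(\{0\})=0$ for $j\ge1$; and let $H_k$ be a positive integer random variable. The underlying chain $(S_{k,n})_{n\ge0}$ of class $k$ is a Markov chain with transition matrix $P_k$; given the chains, the number $A_{k,n}$ ($n\ge1$) of class-$k$ customers arriving in slot $n$ has law $a_{k,S_{k,n-1},S_{k,n}}$, independently over $n$; thus $A_{k,n}=0$ iff $S_{k,n}=0$. Service times $H_{k,n,l}$ are independent copies of $H_k$, independent of the arrivals; given the initial state $(X_0,S_{1,0},\dots,S_{K,0})$, the classes are independent of each other. The unfinished work satisfies $$X_n=\max(X_{n-1}-1,0)+\sum_{k=1}^K\sum_{l=1}^{A_{k,n}}H_{k,n,l},\qquad n\ge 1 .$$ Put $\lambda_k=\sum_{i,j}\pi_{k,i}P_{k,i,j}\sum_m m\,a_{k,i,j}(m)$,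 $\rho_k=\lambda_k E[H_k]$, and assume $\rho=\sum_k\rho_k<1$. Assume that the system is in steady state (the law of $(X_n,S_{1,n},\dots,S_{K,n})$ does not depend on $n$) or, more generally, that it has any initial law giving positive probability to $\{X_0=0,\ S_{k,0}=0 \text{ for all } k\}$. Let $F=\inf\{n\ge1: X_n=0\}$ and $f_0(z)=E[z^F\mid X_0=0,\ S_{k,0}=0\text{ for all }k]$, the probability generating function of the busy-cycle length. **Notation.** $f^{(n)}=\lim_{z\to1-}\frac{d^n}{dz^n}f(z)$. For a nonnegative integer random variable $Y$, $\tilde Y$ is its equilibrium variable, $\Pr(\tilde Y=n)=\Pr(Y>n)/E[Y]$. $C_k$ is the length of a randomly chosen active period of class $k$ (a maximal run of slots with $S_{k,n}\neq0$, begun by a transition out of state $0$), $\Lambda_k$ is the number of class-$k$ customers arriving in it, and $\pi_k^{[\mathrm{on}]}=1-\pi_{k,0}$. $\delta_k(z)$ is the Perron–Frobenius eigenvalue of the matrix $\big(P_{k,i,j}\sum_m a_{k,i,j}(m)z^m\big)_{i,j}$. **Theorem.** (i) The first factorial moment of the busy-cycle length is finite and $$f_0^{(1)}=E[F\mid X_0=0,\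 S_{k,0}=0\ \forall k]=\frac1{1-\rho}.$$ (ii) Suppose that all $H_k$, and all $a_{k,i,j}$ with $P_{k,i,j}>0$, have finite second moments. Then for every $k$ $$\delta_k^{(2)}=2\lambda_kE[\tilde\Lambda_k]-2\lambda_k\pi_k^{[\mathrm{on}]}\frac{E[C_k\Lambda_k]}{E[C_k]}+2\lambda_k^2\pi_k^{[\mathrm{on}]}\big(1+E[\tilde C_k]\big),$$ and the second factorial moment of the busy-cycle length is finite and $$f_0^{(2)}=E[F(F-1)\mid X_0=0,\ S_{k,0}=0\ \forall k]=\frac{2\rho}{(1-\rho)^2}+\frac1{(1-\rho)^3}\sum_{k=1}^K\Big(2\rho_kE[\tilde H_k]+\rho_k(\rho-\rho_k)+E[H_k]^2\,\delta_k^{(2)}\Big).$$ -/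

import Mathlib

open MeasureTheory ProbabilityTheory Filter Topology
open scoped ENNReal

noncomputable section

namespace BusyCycle

/-! ### Expectations attached to mass functions on the nonnegative integers -/

/-- The mean `E[F]` of a nonnegative integer random variable with mass function `p`. -/
def mean (p : ℕ → ℝ≥0∞) : ℝ≥0∞ := ∑' n : ℕ, (n : ℝ≥0∞) * p n

/-- The second moment `E[F ^ 2]`. -/
def secondMoment (p : ℕ → ℝ≥0∞) : ℝ≥0∞ := ∑' n : ℕ, (n : ℝ≥0∞) ^ 2 * p n

/-- The equilibrium distribution: `Pr(F̃ = n) = Pr(F > n) / E[F]`. -/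
def equilibrium (p : ℕ → ℝ≥0∞) (n : ℕ) : ℝ≥0∞ := (∑' m : ℕ, if n < m then p m else 0) / mean p

/-- The mean `E[F̃]` of the equilibrium random variable. -/
def equilibriumMean (p : ℕ → ℝ≥0∞) : ℝ≥0∞ := mean (equilibrium p)

/-- `f^{(n)} = L`, where `f^{(n)}` is the limit of the `n`-th derivative of `f` at `1-`. -/
def HasLeftDerivAtOne (n : ℕ) (f : ℝ → ℝ) (L : ℝ) : Prop :=
  (∀ᶠ z in 𝓝[<] (1 : ℝ), ContDiffAt ℝ n f z) ∧ Tendsto (iteratedDeriv n f) (𝓝[<] 1) (𝓝 L)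

/-- The Perron-Frobenius eigenvalue of a square matrix with nonnegative entries: its spectral
radius. -/
def perronRoot {n : ℕ} (A : Matrix (Fin n) (Fin n) ℝ) : ℝ :=
  (spectralRadius ℂ (A.map (fun x : ℝ => (x : ℂ)))).toReal

/-! ### One class of customers -/

/-- The data of one class: the underlying Markov chain on `{0, 1, ..., M}`, the numbers of
customers brought by its transitions, and the service times. -/
structure ArrivalStream where
  /-- The number of active states. -/
  M : ℕ
  M_pos : 1 ≤ M
  /-- The transition probabilities: `P i j` is the probability of a step from `i` to `j`. -/
  P : Fin (M + 1) → PMF (Fin (M + 1))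
  irreducible : (Matrix.of fun i j => (P i j).toReal).IsIrreducible
  /-- `a i j` is the conditional law of the number of customers arriving in a slot, given that
  the chain moves from `i` to `j`. -/
  a : Fin (M + 1) → Fin (M + 1) → PMF ℕ
  /-- No customers arrive in the idle state `0`. -/
  a_idle : ∀ i, a i 0 0 = 1
  /-- At least one customer arrives in an active state. -/
  a_active : ∀ i j, j ≠ 0 → a i j 0 = 0
  /-- The law of a service time. -/
  h : PMF ℕ
  /-- Service times are positive. -/
  h_pos : h 0 = 0

namespace ArrivalStream

/-- The matrix `A_k(z)` with entries `P_{ij} E[z ^ A | i, j]`. -/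
def genMatrix (s : ArrivalStream) (z : ℝ) : Matrix (Fin (s.M + 1)) (Fin (s.M + 1)) ℝ :=
  Matrix.of fun i j => (s.P i j).toReal * ∑' m : ℕ, (s.a i j m).toReal * z ^ m

/-- `δ_k(z)`, the Perron-Frobenius eigenvalue of `A_k(z)`. -/
def delta (s : ArrivalStream) (z : ℝ) : ℝ := perronRoot (s.genMatrix z)

/-- The arrival rate `λ_k`, where `π` is the stationary distribution of the chain. -/
def rate (s : ArrivalStream) (π : PMF (Fin (s.M + 1))) : ℝ≥0∞ :=
  ∑ i, ∑ j, π i * s.P i j * mean (s.a i j)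

/-- The traffic intensity `ρ_k = λ_k E[H_k]`. -/
def load (s : ArrivalStream) (π : PMF (Fin (s.M + 1))) : ℝ≥0∞ := s.rate π * mean s.h

/-- The stationary probability `π_k^{[on]}` of being active. -/
def probOn (s : ArrivalStream) (π : PMF (Fin (s.M + 1))) : ℝ≥0∞ := ∑ j : Fin s.M, π j.succ

/-- `s.activePrefix c m j` is the probability that a randomly chosen active period (one that
begins with a transition out of state `0`) has at least `c + 1` slots, that the chain is in the
active state `j + 1` at its `(c + 1)`-st slot, and that `m` customers arrive in its first `c + 1`
slots. -/
def activePrefix (s : ArrivalStream) : ℕ → ℕ → Fin s.M → ℝ≥0∞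
  | 0, m, j => s.P 0 j.succ / (1 - s.P 0 0) * s.a 0 j.succ m
  | c + 1, m, j => ∑ i : Fin s.M, ∑ x ∈ Finset.HasAntidiagonal.antidiagonal m,
      s.activePrefix c x.1 i * (s.P i.succ j.succ * s.a i.succ j.succ x.2)

/-- The joint law `Pr(C_k = c, Λ_k = m)` of the length `C_k` of a randomly chosen active period
and the number `Λ_k` of customers arriving in it. -/
def activeLaw (s : ArrivalStream) : ℕ → ℕ → ℝ≥0∞
  | 0, _ => 0
  | c + 1, m => ∑ j : Fin s.M, s.activePrefix c m j * s.P j.succ 0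

/-- The law of `C_k`. -/
def lengthLaw (s : ArrivalStream) (c : ℕ) : ℝ≥0∞ := ∑' m : ℕ, s.activeLaw c m

/-- The law of `Λ_k`. -/
def batchLaw (s : ArrivalStream) (m : ℕ) : ℝ≥0∞ := ∑' c : ℕ, s.activeLaw c m

/-- `E[C_k Λ_k]`. -/
def meanLengthBatch (s : ArrivalStream) : ℝ≥0∞ :=
  ∑' c : ℕ, ∑' m : ℕ, (c : ℝ≥0∞) * (m : ℝ≥0∞) * s.activeLaw c m

/-- The explicit expression
`2 λ E[Λ̃] - 2 λ π^{[on]} E[C Λ] / E[C] + 2 λ ^ 2 π^{[on]} (1 + E[C̃])` for `δ_k^{(2)}`. -/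
def delta2 (s : ArrivalStream) (π : PMF (Fin (s.M + 1))) : ℝ :=
  2 * (s.rate π).toReal * (equilibriumMean s.batchLaw).toReal
    - 2 * (s.rate π).toReal * (s.probOn π).toReal
        * (s.meanLengthBatch.toReal / (mean s.lengthLaw).toReal)
    + 2 * (s.rate π).toReal ^ 2 * (s.probOn π).toReal
        * (1 + (equilibriumMean s.lengthLaw).toReal)

/-- The service times and the numbers of customers arriving in a slot have finite second
moments. -/
def FiniteSecondMoments (s : ArrivalStream) : Prop :=
  secondMoment s.h ≠ ∞ ∧ ∀ i j, s.P i j ≠ 0 → secondMoment (s.a i j) ≠ ∞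

end ArrivalStream

/-! ### The queue -/

section Queue

variable {K : ℕ} {Ω : Type*}

/-- The work `B_n = ∑_k ∑_{l = 1}^{A_{k,n}} H_{k,n,l}` arriving in slot `n`. -/
def arrivingWork (A : Fin K → ℕ → Ω → ℕ) (H : Fin K → ℕ → ℕ → Ω → ℕ) (n : ℕ) (ω : Ω) : ℕ :=
  ∑ k, ∑ l ∈ Finset.Icc 1 (A k n ω), H k n l ω

/-- The unfinished work: `X_n = max(X_{n-1} - 1, 0) + B_n` (the subtraction is truncated). -/
def workload (X₀ : Ω → ℕ) (A : Fin K → ℕ → Ω → ℕ) (H : Fin K → ℕ → ℕ → Ω → ℕ) : ℕ → Ω → ℕ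
  | 0, ω => X₀ ω
  | n + 1, ω => (workload X₀ A H n ω - 1) + arrivingWork A H (n + 1) ω

/-- The first passage time `F = inf {n ≥ 1 : X_n = 0}`, equal to `⊤` if there is no such `n`. -/
def busyCycle (X : ℕ → Ω → ℕ) (ω : Ω) : ℕ∞ := ⨅ (n : ℕ) (_ : 1 ≤ n ∧ X n ω = 0), (n : ℕ∞)

variable [MeasurableSpace Ω]

/-- The `r`-th factorial moment `E[F (F - 1) ⋯ (F - r + 1)]`. -/
def factorialMoment (ν : Measure Ω) (F : Ω → ℕ∞) (r : ℕ) : ℝ≥0∞ :=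
  ∫⁻ ω, ∏ i ∈ Finset.range r, ((F ω : ℝ≥0∞) - (i : ℝ≥0∞)) ∂ν

/-- The probability generating function `E[z ^ F]`, with `z ^ ∞ = 0`. -/
def genFun (ν : Measure Ω) (F : Ω → ℕ∞) (z : ℝ) : ℝ :=
  ∫ ω, (if F ω = ⊤ then 0 else z ^ (F ω).toNat) ∂ν

/-- `X₀` is the initial work, `S k n` the state of the chain of class `k` in slot `n`, `A k n` the
number of customers of class `k` arriving in slot `n ≥ 1`, and `H k n l` the service time of the
`l`-th of them (`l ≥ 1`).  Given the initial data `X₀` and `(S k 0)_k`, which may have any joint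
law, the classes are independent of each other; the chain of class `k` is Markov with transition
probabilities `P`; given the chains, the numbers of arrivals are independent, and `A k n` has law
`a (S k (n - 1)) (S k n)`; and all service times are independent, and independent of everything
else, those of class `k` having law `h`.  This is expressed by the finite-dimensional
distributions. -/
structure IsQueue (stream : Fin K → ArrivalStream) (μ : Measure Ω) (X₀ : Ω → ℕ)
    (S : (k : Fin K) → ℕ → Ω → Fin ((stream k).M + 1)) (A : Fin K → ℕ → Ω → ℕ)
    (H : Fin K → ℕ → ℕ → Ω → ℕ) : Prop where
  measurable_X₀ : Measurable X₀
  measurable_S : ∀ k n, Measurable (S k n)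
  measurable_A : ∀ k n, Measurable (A k n)
  measurable_H : ∀ k n l, Measurable (H k n l)
  law : ∀ (n L x : ℕ) (s : (k : Fin K) → ℕ → Fin ((stream k).M + 1)) (a : Fin K → ℕ → ℕ)
    (h : Fin K → ℕ → ℕ → ℕ),
    μ {ω | X₀ ω = x ∧ (∀ k, ∀ t ∈ Finset.range (n + 1), S k t ω = s k t) ∧
        (∀ k, ∀ t ∈ Finset.Icc 1 n, A k t ω = a k t) ∧
        (∀ k, ∀ t ∈ Finset.Icc 1 n, ∀ l ∈ Finset.Icc 1 L, H k t l ω = h k t l)} =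
      μ {ω | X₀ ω = x ∧ ∀ k, S k 0 ω = s k 0} *
        ∏ k, ∏ t ∈ Finset.Icc 1 n,
          ((stream k).P (s k (t - 1)) (s k t) * (stream k).a (s k (t - 1)) (s k t) (a k t) *
            ∏ l ∈ Finset.Icc 1 L, (stream k).h (h k t l))

/-- The system is in steady state: the law of `(X_n, S_n)` does not depend on `n`. -/
def IsSteady {stream : Fin K → ArrivalStream} (μ : Measure Ω) (X : ℕ → Ω → ℕ)
    (S : (k : Fin K) → ℕ → Ω → Fin ((stream k).M + 1)) : Prop :=
  ∀ n, μ.map (fun ω => (X n ω, fun k => S k n ω)) = μ.map (fun ω => (X 0 ω, fun k => S k 0 ω))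

/-- The event `(X_0, S_0) = (0, 0)`, at which a busy cycle starts. -/
def cycleStart {stream : Fin K → ArrivalStream} (X : ℕ → Ω → ℕ)
    (S : (k : Fin K) → ℕ → Ω → Fin ((stream k).M + 1)) : Set Ω :=
  {ω | X 0 ω = 0 ∧ ∀ k, S k 0 ω = 0}

end Queue

end BusyCycle

end

/-!
The generating function of the busy cycle is found by optional stopping, and its moments by
inverting a change of variable.

For `y` slightly below `1` let `w_k = H_k(y)` be the generating function of the service time of
class `k`, and let `u_k` be the positive right eigenvector, normalized at the idle state `0`, of
the matrix `A_k(w_k)` for its Perron-Frobenius eigenvalue `δ_k(w_k)`. One slot multiplies the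
conditional expectation of `y ^ X_n ∏ u_k(S_{k,n})` by `∏ δ_k(w_k) / y` as long as the server is
busy (`IsQueue.lintegral_step`). The work can vanish at the end of a slot only if no customer
arrived in it, that is, if all chains are then in state `0` (`IsQueue.ae_idle`). Starting from
`(X_0, S_0) = (0, 0)` and stopping at the first passage time `F`, one obtains
`f₀(y / ∏ δ_k(H_k(y))) = y` for all `y` below and near `1` (`IsQueue.tsum_passage`). The same martingale
shows that a steady state charges `(0, 0)` (`IsQueue.measure_cycleStart_ne_zero`), so that the
conditioning is meaningful.

Hence `f₀` is, to the left of `1`, the inverse function of `y ↦ y / ∏ δ_k(H_k(y))`, whose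
derivative at `1` is `1 - ρ > 0`. No generating function is assumed to converge beyond `1`: a
power series with a finite `r`-th moment is extended to a `C ^ r` function on the line
(`exists_contDiff_extension`), the eigenvalue is continued across `1` by the implicit function
theorem (`ArrivalStream.exists_delta_curve`) and identified on the left with the spectral radius
through its positive eigenvector (`perronRoot_eq_of_pos_eigenvector`). The inverse function
theorem then gives a `C ^ r` function that agrees with `f₀` to the left of `1`, and its
derivatives are the factorial moments (`hasSum_descFactorial_of_eq_left`).

For the second derivative of `δ_k`, the derivatives of the eigenvector are eliminated by summing
the differentiated eigenvalue equation over the slots of an active period. This yields the moments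
of the length `C_k` and of the number `Λ_k` of customers of such a period
(`ArrivalStream.iteratedDeriv_two_eq_delta2`).
-/

namespace BusyCycle

/-! ### Power series with nonnegative coefficients at the boundary point `1` -/

/-- The power series `∑ p n z ^ n`, as a function of a real variable. -/
noncomputable def genSeries (p : ℕ → ℝ) (z : ℝ) : ℝ := ∑' n, p n * z ^ n

/-- The coefficients of the derivative of `genSeries p`. -/
def derivCoeff (p : ℕ → ℝ) (n : ℕ) : ℝ := (n + 1) * p (n + 1)

lemma derivCoeff_nonneg {p : ℕ → ℝ} (hp : ∀ n, 0 ≤ p n) (n : ℕ) : 0 ≤ derivCoeff p n :=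
  mul_nonneg (by positivity) (hp _)

lemma continuousOn_genSeries {p : ℕ → ℝ} (hp : ∀ n, 0 ≤ p n) (hs : Summable p) :
    ContinuousOn (genSeries p) (Set.Icc 0 1) := by
  refine continuousOn_tsum (u := p) (fun n => by fun_prop) hs fun n z hz => ?_
  rw [Real.norm_of_nonneg (mul_nonneg (hp n) (pow_nonneg hz.1 n))]
  exact mul_le_of_le_one_right (hp n) (pow_le_one₀ hz.1 hz.2)

lemma hasDerivAt_genSeries {p : ℕ → ℝ} (hp : ∀ n, 0 ≤ p n) (hs : Summable p) {z : ℝ}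
    (hz : |z| < 1) : HasDerivAt (genSeries p) (genSeries (derivCoeff p) z) z := by
  obtain ⟨ρ, hzρ, hρ⟩ := exists_between hz
  have hρ0 : 0 ≤ ρ := (abs_nonneg z).trans hzρ.le
  have hbd : Summable fun n : ℕ => p n * (n * ρ ^ (n - 1)) := by
    have h1 : Summable fun n : ℕ => (∑' m, p m) * ((n : ℝ) * ρ ^ (n - 1)) := by
      refine Summable.mul_left _ ?_
      have h2 := summable_pow_mul_geometric_of_norm_lt_one 1 (r := ρ)
        (by rwa [Real.norm_of_nonneg hρ0])
      have h3 := summable_geometric_of_lt_one hρ0 hρ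
      rw [← summable_nat_add_iff 1]
      refine (h2.add h3).congr fun n => ?_
      simp only [pow_one, Nat.add_sub_cancel]
      push_cast
      ring
    refine h1.of_nonneg_of_le (fun n => mul_nonneg (hp n) (by positivity)) fun n => ?_
    exact mul_le_mul_of_nonneg_right (hs.le_tsum n fun m _ => hp m) (by positivity)
  have h := hasDerivAt_tsum_of_isPreconnected (g := fun n z => p n * z ^ n)
    (g' := fun n z => p n * (n * z ^ (n - 1))) (t := Set.Ioo (-ρ) ρ) (y₀ := 0) (y := z) hbd
    isOpen_Ioo isPreconnected_Ioo (fun n y _ => (hasDerivAt_pow n y).const_mul (p n))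
    (fun n y hy => ?_) ⟨by linarith [abs_nonneg z], by linarith [abs_nonneg z]⟩ ?_ (abs_lt.mp hzρ)
  · have hsum : Summable fun n : ℕ => p n * (n * z ^ (n - 1)) := by
      refine hbd.of_norm_bounded fun n => ?_
      rw [norm_mul, norm_mul, norm_pow, Real.norm_of_nonneg (hp n), Real.norm_natCast]
      have := hp n
      gcongr
      exact hzρ.le
    have heq : ∑' n : ℕ, p n * (n * z ^ (n - 1)) = genSeries (derivCoeff p) z := by
      rw [hsum.tsum_eq_zero_add]
      simp only [genSeries, derivCoeff]
      push_cast
      simp only [zero_mul, mul_zero, zero_add]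
      exact tsum_congr fun n => by ring
    rwa [heq] at h
  · rw [norm_mul, norm_mul, norm_pow, Real.norm_of_nonneg (hp n), Real.norm_natCast]
    have := hp n
    have : ‖y‖ ≤ ρ := (abs_lt.mpr hy).le
    gcongr
  · refine summable_of_ne_finset_zero (s := {0}) fun n hn => ?_
    simp only [Finset.mem_singleton] at hn
    simp [hn]

/-- If the `r`-th moment of the coefficients is finite, then the power series extends to a
`C ^ r` function on the line whose derivatives at `1` are the factorial moments. The extension is
obtained by integrating the extension of the derivative. -/
theorem exists_contDiff_extension (r : ℕ) : ∀ (p : ℕ → ℝ), (∀ n, 0 ≤ p n) → Summable p →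
    (Summable fun n : ℕ => (n : ℝ) ^ r * p n) →
    ∃ f : ℝ → ℝ, ContDiff ℝ r f ∧ (∀ z ∈ Set.Icc (0 : ℝ) 1, f z = genSeries p z) ∧
      ∀ i ≤ r, iteratedDeriv i f 1 = ∑' n, (n.descFactorial i : ℝ) * p n := by
  induction r with
  | zero =>
    intro p hp hs _
    refine ⟨fun z => genSeries p (Set.projIcc 0 1 zero_le_one z), ?_, fun z hz => ?_, ?_⟩
    · rw [Nat.cast_zero, contDiff_zero]
      exact (continuousOn_genSeries hp hs).comp_continuous
        (continuous_subtype_val.comp continuous_projIcc) fun z => (Set.projIcc 0 1 _ z).2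
    · simp only [Set.projIcc_of_mem zero_le_one hz]
    · intro i hi
      obtain rfl : i = 0 := by omega
      simp [genSeries]
  | succ r ih =>
    intro p hp hs hr
    have hr' := (summable_nat_add_iff 1).mpr hr
    have hq : Summable (derivCoeff p) := by
      refine hr'.of_nonneg_of_le (derivCoeff_nonneg hp) fun n => ?_
      refine mul_le_mul_of_nonneg_right ?_ (hp _)
      push_cast
      exact le_self_pow₀ (by linarith [(n.cast_nonneg : (0 : ℝ) ≤ n)]) (Nat.succ_ne_zero r)
    have hqr : Summable fun n : ℕ => (n : ℝ) ^ r * derivCoeff p n := by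
      refine hr'.of_nonneg_of_le (fun n => mul_nonneg (by positivity) (derivCoeff_nonneg hp n))
        fun n => ?_
      rw [derivCoeff, ← mul_assoc, pow_succ]
      push_cast
      have := hp (n + 1)
      gcongr
      linarith
    obtain ⟨g, hg, hgq, hgi⟩ := ih _ (derivCoeff_nonneg hp) hq hqr
    set f : ℝ → ℝ := fun z => genSeries p 1 + ∫ t in (1 : ℝ)..z, g t with hf
    have hgc : Continuous g := hg.continuous
    have hfd : ∀ z, HasDerivAt f (g z) z := fun z =>
      (intervalIntegral.integral_hasDerivAt_right (hgc.intervalIntegrable _ _)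
        hgc.stronglyMeasurable.stronglyMeasurableAtFilter hgc.continuousAt).const_add _
    have hdf : deriv f = g := funext fun z => (hfd z).deriv
    refine ⟨f, ?_, ?_, ?_⟩
    · rw [Nat.cast_succ, contDiff_succ_iff_deriv]
      refine ⟨fun z => (hfd z).differentiableAt, fun h => by simp at h, ?_⟩
      rwa [hdf]
    · have hconst := constant_of_has_deriv_right_zero (f := fun z => f z - genSeries p z)
        (a := 0) (b := 1)
        ((continuous_iff_continuousAt.mpr fun z => (hfd z).continuousAt).continuousOn.sub
          (continuousOn_genSeries hp hs)) fun z hz => by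
          have h1 := (hfd z).sub (hasDerivAt_genSeries hp hs
            (abs_lt.mpr ⟨by linarith [hz.1], hz.2⟩))
          rw [hgq z ⟨hz.1, hz.2.le⟩, sub_self] at h1
          exact h1.hasDerivWithinAt
      have h1 := hconst 1 ⟨zero_le_one, le_rfl⟩
      intro z hz
      have h2 := hconst z hz
      have h3 : f 1 = genSeries p 1 := by simp [hf]
      linarith
    · intro i hi
      rcases i with _ | i
      · simp [hf, genSeries]
      · rw [iteratedDeriv_succ', hdf, hgi i (by omega)]
        have hsum : Summable fun n : ℕ => (n.descFactorial (i + 1) : ℝ) * p n := by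
          refine ((hr.add hs).of_nonneg_of_le (fun n => mul_nonneg (by positivity) (hp n))
            fun n => ?_)
          rw [← add_one_mul]
          refine mul_le_mul_of_nonneg_right ?_ (hp n)
          rcases Nat.eq_zero_or_pos n with rfl | hn
          · simp
          · have h1 : (n.descFactorial (i + 1) : ℝ) ≤ (n : ℝ) ^ (i + 1) := by
              exact_mod_cast Nat.descFactorial_le_pow n (i + 1)
            have h2 : (n : ℝ) ^ (i + 1) ≤ (n : ℝ) ^ (r + 1) :=
              pow_le_pow_right₀ (by exact_mod_cast hn) hi
            linarith
        rw [hsum.tsum_eq_zero_add]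
        simp only [Nat.zero_descFactorial_succ, Nat.cast_zero, zero_mul, zero_add]
        refine tsum_congr fun n => ?_
        rw [Nat.succ_descFactorial_succ, derivCoeff]
        push_cast
        ring

lemma contDiffAt_deriv {f : ℝ → ℝ} {x : ℝ} {r : ℕ} (hf : ContDiffAt ℝ (r + 1 : ℕ) f x) :
    ContDiffAt ℝ r (deriv f) x :=
  (hf.fderiv_right (m := r) (by norm_cast)).clm_apply contDiffAt_const

lemma continuousAt_iteratedDeriv {r : ℕ} : ∀ {f : ℝ → ℝ} {x : ℝ}, ContDiffAt ℝ r f x →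
    ContinuousAt (iteratedDeriv r f) x := by
  induction r with
  | zero => intro f x hf; simpa using hf.continuousAt
  | succ r ih => intro f x hf; rw [iteratedDeriv_succ']; exact ih (contDiffAt_deriv hf)

lemma eventually_eventuallyEq_of_left {f g : ℝ → ℝ} (h : f =ᶠ[𝓝[<] 1] g) :
    ∀ᶠ z in 𝓝[<] (1 : ℝ), f =ᶠ[𝓝 z] g := by
  filter_upwards [eventually_eventually_nhdsWithin.mpr h, self_mem_nhdsWithin] with z hz hz1
  rwa [IsOpen.nhdsWithin_eq isOpen_Iio hz1] at hz

lemma iteratedDeriv_eventuallyEq_of_left {f g : ℝ → ℝ} (h : f =ᶠ[𝓝[<] 1] g) (r : ℕ) :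
    iteratedDeriv r f =ᶠ[𝓝[<] 1] iteratedDeriv r g :=
  (eventually_eventuallyEq_of_left h).mono fun _ hz => hz.iteratedDeriv_eq r

lemma hasLeftDerivAtOne_of_eq_left {f g : ℝ → ℝ} {r : ℕ} (hg : ContDiffAt ℝ r g 1)
    (h : f =ᶠ[𝓝[<] 1] g) : HasLeftDerivAtOne r f (iteratedDeriv r g 1) := by
  refine ⟨?_, ?_⟩
  · filter_upwards [eventually_eventuallyEq_of_left h,
      (hg.eventually (by simp)).filter_mono nhdsWithin_le_nhds] with z hz hgz
    exact hgz.congr_of_eventuallyEq hz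
  · exact ((continuousAt_iteratedDeriv hg).tendsto.mono_left nhdsWithin_le_nhds).congr'
      (iteratedDeriv_eventuallyEq_of_left h r).symm

lemma iteratedDeriv_eq_of_eq_left {f g : ℝ → ℝ} {r : ℕ} (hf : ContDiffAt ℝ r f 1)
    (hg : ContDiffAt ℝ r g 1) (h : f =ᶠ[𝓝[<] 1] g) : iteratedDeriv r f 1 = iteratedDeriv r g 1 :=
  tendsto_nhds_unique (((continuousAt_iteratedDeriv hf).tendsto.mono_left nhdsWithin_le_nhds))
    (hasLeftDerivAtOne_of_eq_left hg h).2

lemma eventually_left_mem_Ioo : ∀ᶠ z in 𝓝[<] (1 : ℝ), z ∈ Set.Ioo (0 : ℝ) 1 :=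
  Ioo_mem_nhdsLT zero_lt_one

/-- A power series with nonnegative coefficients that is bounded near `1` is summable at `1`. -/
lemma summable_of_tendsto_genSeries {p : ℕ → ℝ} (hp : ∀ n, 0 ≤ p n)
    (hs : ∀ z ∈ Set.Ioo (0 : ℝ) 1, Summable fun n => p n * z ^ n) {L : ℝ}
    (hL : Tendsto (genSeries p) (𝓝[<] 1) (𝓝 L)) : Summable p := by
  refine summable_of_sum_range_le (c := L) hp fun N => ?_
  have h1 : Tendsto (fun z : ℝ => ∑ n ∈ Finset.range N, p n * z ^ n) (𝓝[<] 1)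
      (𝓝 (∑ n ∈ Finset.range N, p n * 1 ^ n)) :=
    ((continuous_finsetSum _ fun n _ => by fun_prop).tendsto 1).mono_left nhdsWithin_le_nhds
  simp only [one_pow, mul_one] at h1
  refine le_of_tendsto_of_tendsto h1 hL ?_
  filter_upwards [eventually_left_mem_Ioo] with z hz
  exact (hs z hz).sum_le_tsum _ fun n _ => mul_nonneg (hp n) (pow_nonneg hz.1.le n)

/-- Conversely, if the power series agrees to the left of `1` with a function that is `C ^ r` at
`1`, then the `r`-th moment of the coefficients is finite. -/
theorem summable_of_eq_left (r : ℕ) : ∀ (p : ℕ → ℝ) (f : ℝ → ℝ), (∀ n, 0 ≤ p n) → Summable p →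
    ContDiffAt ℝ r f 1 → genSeries p =ᶠ[𝓝[<] 1] f → Summable fun n : ℕ => (n : ℝ) ^ r * p n := by
  induction r with
  | zero => intro p f _ hs _ _; simpa using hs
  | succ r ih =>
    intro p f hp hs hf h
    have hd : genSeries (derivCoeff p) =ᶠ[𝓝[<] 1] deriv f := by
      filter_upwards [eventually_eventuallyEq_of_left h, eventually_left_mem_Ioo] with z hz hz1
      rw [← hz.deriv_eq]
      exact (hasDerivAt_genSeries hp hs (abs_lt.mpr ⟨by linarith [hz1.1], hz1.2⟩)).deriv.symm
    have hdf := contDiffAt_deriv hf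
    have hq : Summable (derivCoeff p) := by
      refine summable_of_tendsto_genSeries (derivCoeff_nonneg hp) (fun z hz => ?_)
        ((hdf.continuousAt.tendsto.mono_left nhdsWithin_le_nhds).congr' hd.symm)
      have h2 := summable_pow_mul_geometric_of_norm_lt_one 1 (r := z)
        (by rw [Real.norm_of_nonneg hz.1.le]; exact hz.2)
      have h3 := summable_geometric_of_lt_one hz.1.le hz.2
      refine ((h2.add h3).mul_left (∑' m, p m)).of_nonneg_of_le
        (fun n => mul_nonneg (derivCoeff_nonneg hp n) (pow_nonneg hz.1.le n)) fun n => ?_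
      have h4 : p (n + 1) ≤ ∑' m, p m := hs.le_tsum _ fun m _ => hp m
      have h5 : 0 ≤ z := hz.1.le
      rw [derivCoeff, pow_one, ← add_one_mul, mul_comm (_ + 1 : ℝ), mul_assoc]
      gcongr
    have h6 := ih _ _ (derivCoeff_nonneg hp) hq hdf hd
    rw [← summable_nat_add_iff 1]
    refine ((h6.add hq).mul_left (2 ^ r : ℝ)).of_nonneg_of_le
      (fun n => mul_nonneg (by positivity) (hp _)) fun n => ?_
    rw [← add_one_mul, pow_succ, mul_assoc]
    have h7 := derivCoeff_nonneg hp n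
    have h8 : ((n + 1 : ℕ) : ℝ) * p (n + 1) = derivCoeff p n := by rw [derivCoeff]; push_cast; ring
    rw [h8, ← mul_assoc]
    refine mul_le_mul_of_nonneg_right ?_ h7
    rcases Nat.eq_zero_or_pos n with rfl | hn
    · have : (1 : ℝ) ≤ 2 ^ r := one_le_pow₀ (by norm_num)
      simpa using this.trans (le_mul_of_one_le_right (by positivity) (by simp))
    · have h9 : (1 : ℝ) ≤ n := by exact_mod_cast hn
      calc ((n + 1 : ℕ) : ℝ) ^ r ≤ (2 * n : ℝ) ^ r := by push_cast; gcongr; linarith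
        _ = 2 ^ r * (n : ℝ) ^ r := mul_pow _ _ _
        _ ≤ _ := by gcongr; linarith

/-- The factorial moments of a power series which continues smoothly past `1` are the derivatives
of the continuation. -/
theorem hasSum_descFactorial_of_eq_left {r : ℕ} {p : ℕ → ℝ} {f : ℝ → ℝ} (hp : ∀ n, 0 ≤ p n)
    (hs : Summable p) (hf : ContDiffAt ℝ r f 1) (h : genSeries p =ᶠ[𝓝[<] 1] f) :
    HasSum (fun n => (n.descFactorial r : ℝ) * p n) (iteratedDeriv r f 1) := by
  have hr := summable_of_eq_left r p f hp hs hf h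
  obtain ⟨g, hg, hgp, hgi⟩ := exists_contDiff_extension r p hp hs hr
  have hgf : f =ᶠ[𝓝[<] 1] g := by
    filter_upwards [h, eventually_left_mem_Ioo] with z hz hz1
    rw [← hz, hgp z ⟨hz1.1.le, hz1.2.le⟩]
  rw [iteratedDeriv_eq_of_eq_left hf hg.contDiffAt hgf, hgi r le_rfl]
  refine (hr.of_nonneg_of_le (fun n => mul_nonneg (by positivity) (hp n)) fun n => ?_).hasSum
  refine mul_le_mul_of_nonneg_right ?_ (hp n)
  exact_mod_cast Nat.descFactorial_le_pow n r

/-! ### Positive eigenvectors and the Perron-Frobenius eigenvalue -/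

/-- An eigenvalue with a positive eigenvector dominates every other one: compare an eigenvector
with the positive one at an index where the quotient of their entries is largest. -/
theorem perronRoot_eq_of_pos_eigenvector {n : ℕ} [NeZero n] {A : Matrix (Fin n) (Fin n) ℝ}
    (hA : ∀ i j, 0 ≤ A i j) {u : Fin n → ℝ} (hu : ∀ i, 0 < u i) {x : ℝ}
    (h : A.mulVec u = x • u) : perronRoot A = x := by
  have hx : 0 ≤ x := by
    have h0 : ∑ j, A 0 j * u j = x * u 0 := congrFun h 0
    by_contra hneg
    have := Finset.sum_nonneg fun j (_ : j ∈ Finset.univ) => mul_nonneg (hA 0 j) (hu j).le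
    nlinarith [hu 0]
  set B : Matrix (Fin n) (Fin n) ℂ := A.map (fun x : ℝ => (x : ℂ)) with hB
  have hspec : ∀ k : ℂ, k ∈ spectrum ℂ B ↔ ∃ v : Fin n → ℂ, v ≠ 0 ∧ B.mulVec v = k • v := by
    intro k
    rw [← Matrix.spectrum_toLin', ← Module.End.hasEigenvalue_iff_mem_spectrum]
    constructor
    · intro hk
      obtain ⟨v, hv⟩ := hk.exists_hasEigenvector
      exact ⟨v, hv.2, by simpa using hv.apply_eq_smul⟩
    · rintro ⟨v, hv0, hv⟩
      exact Module.End.hasEigenvalue_of_hasEigenvector (x := v)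
        ⟨Module.End.mem_eigenspace_iff.mpr (by simpa using hv), hv0⟩
  have hrad : spectralRadius ℂ B = (x.toNNReal : ℝ≥0∞) := by
    refine le_antisymm (iSup₂_le fun k hk => ?_) ?_
    · obtain ⟨v, hv0, hv⟩ := (hspec k).mp hk
      obtain ⟨i, -, hi⟩ := Finset.exists_max_image Finset.univ (fun i => ‖v i‖ / u i)
        ⟨0, Finset.mem_univ _⟩
      set t := ‖v i‖ / u i with ht
      have hle : ∀ j, ‖v j‖ ≤ t * u j := fun j => (div_le_iff₀ (hu j)).mp (hi j (Finset.mem_univ j))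
      have htpos : 0 < t := by
        by_contra hneg
        refine hv0 (funext fun j => ?_)
        have := hle j
        have h2 : t * u j ≤ 0 := mul_nonpos_of_nonpos_of_nonneg (not_lt.mp hneg) (hu j).le
        exact norm_le_zero_iff.mp (this.trans h2)
      have hvi : ‖v i‖ = t * u i := by rw [ht, div_mul_cancel₀ _ (hu i).ne']
      have hrow : ∑ j, B i j * v j = k * v i := congrFun hv i
      have hrow' : ∑ j, A i j * u j = x * u i := congrFun h i
      have hkx : ‖k‖ * (t * u i) ≤ x * (t * u i) := by
        calc ‖k‖ * (t * u i) = ‖∑ j, B i j * v j‖ := by rw [hrow, norm_mul, hvi]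
          _ ≤ ∑ j, ‖B i j * v j‖ := norm_sum_le _ _
          _ ≤ ∑ j, A i j * (t * u j) := by
            refine Finset.sum_le_sum fun j _ => ?_
            rw [norm_mul, hB, Matrix.map_apply, Complex.norm_real, Real.norm_of_nonneg (hA i j)]
            exact mul_le_mul_of_nonneg_left (hle j) (hA i j)
          _ = t * ∑ j, A i j * u j := by
            rw [Finset.mul_sum]; exact Finset.sum_congr rfl fun j _ => by ring
          _ = x * (t * u i) := by rw [hrow']; ring
      have hk2 : ‖k‖ ≤ x := le_of_mul_le_mul_right hkx (mul_pos htpos (hu i))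
      rw [ENNReal.coe_le_coe, ← NNReal.coe_le_coe, coe_nnnorm, Real.coe_toNNReal x hx]
      exact hk2
    · have hxs : (x : ℂ) ∈ spectrum ℂ B := by
        refine (hspec _).mpr ⟨fun i => (u i : ℂ), fun h0 => ?_, funext fun i => ?_⟩
        · exact (hu 0).ne' (by simpa using congrFun h0 0)
        · have h1 : ∑ j, A i j * u j = x * u i := congrFun h i
          have h2 := congrArg (fun r : ℝ => (r : ℂ)) h1
          simpa [Matrix.mulVec, dotProduct, hB] using h2
      refine le_trans (le_of_eq ?_) (le_iSup₂ (f := fun k (_ : k ∈ spectrum ℂ B) =>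
        (‖k‖₊ : ℝ≥0∞)) (x : ℂ) hxs)
      rw [Complex.nnnorm_real, ← Real.toNNReal_eq_nnnorm_of_nonneg hx]
  rw [perronRoot, hrad, ENNReal.coe_toReal, Real.coe_toNNReal x hx]

/-! ### Perturbation of the eigenvalue `1` of a stochastic matrix -/

section Perturbation

variable {n : ℕ} {P : Matrix (Fin (n + 1)) (Fin (n + 1)) ℝ} {π : Fin (n + 1) → ℝ}

/-- Near a stochastic matrix, the Perron-Frobenius eigenvalue and the eigenvector normalized by
`u 0 = 1` are as smooth as the matrix. This is the implicit function theorem, applied to the vector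
`y` which holds the eigenvalue in its entry `0` and the eigenvector in the others; the derivative of
the eigenvalue equation is injective because a harmonic function vanishing at `0` is zero. -/
theorem exists_eigen_curve (hrow : ∀ i, ∑ j, P i j = 1) (hπ : ∀ j, ∑ i, π i * P i j = π j)
    (hπ1 : ∑ i, π i = 1)
    (hharm : ∀ f : Fin (n + 1) → ℝ, f 0 = 0 → (∀ i, ∑ j, P i j * f j = f i) → f = 0)
    {G : ℝ → Matrix (Fin (n + 1)) (Fin (n + 1)) ℝ} {r : ℕ} (hr : r ≠ 0)
    (hG : ∀ i j, ContDiffAt ℝ r (fun w => G w i j) 1) (hG1 : G 1 = P) :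
    ∃ (x : ℝ → ℝ) (u : ℝ → Fin (n + 1) → ℝ), ContDiffAt ℝ r x 1 ∧
      (∀ i, ContDiffAt ℝ r (fun w => u w i) 1) ∧ x 1 = 1 ∧ u 1 = 1 ∧ (∀ w, u w 0 = 1) ∧
      ∀ᶠ w in 𝓝 (1 : ℝ), ∀ i, ∑ j, G w i j * u w j = x w * u w i := by
  classical
  set upd : (Fin (n + 1) → ℝ) → Fin (n + 1) → ℝ := fun y i => if i = 0 then 1 else y i with hupd
  set Φ : ℝ × (Fin (n + 1) → ℝ) → (Fin (n + 1) → ℝ) :=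
    fun q i => q.2 0 * upd q.2 i - ∑ j, G q.1 i j * upd q.2 j with hΦ
  have hupdC : ∀ i, ContDiff ℝ r (fun q : ℝ × (Fin (n + 1) → ℝ) => upd q.2 i) := by
    intro i
    by_cases hi : i = 0
    · simp only [hupd, hi, if_true]; fun_prop
    · simp only [hupd, hi, if_false]; fun_prop
  have hΦC : ContDiffAt ℝ r Φ (1, 1) := by
    refine contDiffAt_pi.mpr fun i => ?_
    refine ContDiffAt.sub ?_ (ContDiffAt.sum fun j _ => ?_)
    · exact ContDiffAt.mul (by fun_prop) (hupdC i).contDiffAt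
    · exact ((hG i j).comp (f := Prod.fst) ((1 : ℝ), (1 : (Fin (n + 1) → ℝ))) contDiffAt_fst).mul
        (hupdC j).contDiffAt
  have hr' : (r : WithTop ℕ∞) ≠ 0 := by exact_mod_cast hr
  have hupd1 : upd 1 = 1 := funext fun i => by simp [hupd]
  have hΦ1 : Φ (1, 1) = 0 := by
    funext i
    simp [hΦ, hupd1, hG1, hrow]
  have hder : ∀ (y : (Fin (n + 1) → ℝ)) (i : Fin (n + 1)),
      (fderiv ℝ Φ (1, 1) ∘L .inr ℝ ℝ (Fin (n + 1) → ℝ)) y i =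
        y 0 + (if i = 0 then 0 else y i) - ∑ j, P i j * (if j = 0 then 0 else y j) := by
    intro y i
    have h1 : HasDerivAt (fun t : ℝ => ((1 : ℝ), (1 : (Fin (n + 1) → ℝ)) + t • y))
        ((0 : ℝ), y) 0 := by
      refine (hasDerivAt_const _ _).prodMk ?_
      simpa using ((hasDerivAt_id (0 : ℝ)).smul_const y).const_add (1 : (Fin (n + 1) → ℝ))
    have h2 : HasFDerivAt Φ (fderiv ℝ Φ (1, 1))
        ((1 : ℝ), (1 : (Fin (n + 1) → ℝ)) + (0 : ℝ) • y) := by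
      rw [zero_smul, add_zero]
      exact (hΦC.differentiableAt hr').hasFDerivAt
    have h3 := hasDerivAt_pi.mp (h2.comp_hasDerivAt 0 h1) i
    have hlin : ∀ (t : ℝ) j,
        upd ((1 : (Fin (n + 1) → ℝ)) + t • y) j = 1 + t * (if j = 0 then 0 else y j) := by
      intro t j
      by_cases hj : j = 0 <;> simp [hupd, hj]
    have hD : ∀ a b : ℝ, HasDerivAt (fun t : ℝ => a * (1 + t * b)) (a * b) 0 := fun a b => by
      simpa using (((hasDerivAt_id (0 : ℝ)).mul_const b).const_add 1).const_mul a
    have h4 : HasDerivAt (fun t : ℝ => Φ ((1 : ℝ), (1 : (Fin (n + 1) → ℝ)) + t • y) i)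
        (y 0 + (if i = 0 then 0 else y i) - ∑ j, P i j * (if j = 0 then 0 else y j)) 0 := by
      have h5 : HasDerivAt (fun t : ℝ => 1 + t * y 0) (y 0) 0 := by simpa using hD 1 (y 0)
      have h6 : HasDerivAt (fun t : ℝ => 1 + t * (if i = 0 then 0 else y i))
        (if i = 0 then 0 else y i) 0 := by simpa using hD 1 (if i = 0 then 0 else y i)
      have h7 := (h5.mul h6).sub (HasDerivAt.fun_sum (u := Finset.univ) fun j _ =>
        hD (P i j) (if j = 0 then 0 else y j))
      refine (h7.congr_deriv (by simp)).congr_of_eventuallyEq (Eventually.of_forall fun t => ?_)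
      simp [hΦ, hlin, hG1]
    exact h3.unique h4
  have hinj : Function.Injective (fderiv ℝ Φ (1, 1) ∘L .inr ℝ ℝ (Fin (n + 1) → ℝ)) := by
    refine (injective_iff_map_eq_zero _).mpr fun y hy => ?_
    set d : (Fin (n + 1) → ℝ) := fun i => if i = 0 then 0 else y i with hd
    have h1 : ∀ i, y 0 + d i - ∑ j, P i j * d j = 0 := fun i => by
      rw [← hder y i, hy]; rfl
    have h2 : y 0 = 0 := by
      have h3 : ∑ i, π i * (y 0 + d i - ∑ j, P i j * d j) = 0 :=
        Finset.sum_eq_zero fun i _ => by rw [h1 i, mul_zero]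
      have h4 : ∑ i, π i * ∑ j, P i j * d j = ∑ j, π j * d j := by
        simp_rw [Finset.mul_sum]
        rw [Finset.sum_comm]
        refine Finset.sum_congr rfl fun j _ => ?_
        rw [← hπ j, Finset.sum_mul]
        exact Finset.sum_congr rfl fun i _ => by ring
      simp_rw [mul_sub, mul_add, Finset.sum_sub_distrib, Finset.sum_add_distrib, h4,
        ← Finset.sum_mul, hπ1] at h3
      linarith
    have h3 : d = 0 := hharm d (by simp [hd]) fun i => by have := h1 i; rw [h2] at this; linarith
    funext i
    by_cases hi : i = 0
    · rw [hi]; exact h2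
    · have := congrFun h3 i
      simpa [hd, hi] using this
  have hinv : (fderiv ℝ Φ (1, 1) ∘L .inr ℝ ℝ (Fin (n + 1) → ℝ)).IsInvertible :=
    ⟨(LinearEquiv.ofInjectiveEndo (fderiv ℝ Φ (1, 1) ∘L .inr ℝ ℝ (Fin (n + 1) → ℝ)).toLinearMap
      hinj).toContinuousLinearEquiv, by ext; rfl⟩
  set ψ := hΦC.implicitFunction hr' hinv with hψ
  have hψC : ContDiffAt ℝ r ψ 1 := hΦC.contDiffAt_implicitFunction hr' hinv
  have hψ1 : ψ 1 = 1 := hΦC.implicitFunction_apply_self hr' hinv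
  have hψE := hΦC.eventually_apply_implicitFunction hr' hinv
  have hψi : ∀ i, ContDiffAt ℝ r (fun w => ψ w i) 1 := fun i => contDiffAt_pi.mp hψC i
  refine ⟨fun w => ψ w 0, fun w => upd (ψ w), hψi 0, fun i => ?_, by simp [hψ1],
    by simp only [hψ1, hupd1], fun w => by simp [hupd], ?_⟩
  · by_cases hi : i = 0
    · simp only [hupd, hi, if_true]; exact contDiffAt_const
    · simp only [hupd, hi, if_false]; exact hψi i
  · filter_upwards [hψE] with w hw i
    have := congrFun (hw.trans hΦ1) i
    simp only [hΦ, Pi.zero_apply] at this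
    linarith

variable {G : ℝ → Matrix (Fin (n + 1)) (Fin (n + 1)) ℝ} {x : ℝ → ℝ} {u : ℝ → Fin (n + 1) → ℝ}

lemma eigen_curve_deriv (hG : ∀ i j, ContDiffAt ℝ 1 (fun w => G w i j) 1) (hG1 : G 1 = P)
    (hx : ContDiffAt ℝ 1 x 1) (hu : ∀ i, ContDiffAt ℝ 1 (fun w => u w i) 1) (hx1 : x 1 = 1)
    (hu1 : u 1 = 1)
    (h : ∀ᶠ w in 𝓝 (1 : ℝ), ∀ i, ∑ j, G w i j * u w j = x w * u w i) (i : Fin (n + 1)) :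
    deriv x 1 + deriv (fun w => u w i) 1 =
      ∑ j, (deriv (fun w => G w i j) 1 + P i j * deriv (fun w => u w j) 1) := by
  have heq : (fun w => ∑ j, G w i j * u w j) =ᶠ[𝓝 1] fun w => x w * u w i :=
    h.mono fun w hw => hw i
  have hd : ∀ {f : ℝ → ℝ}, ContDiffAt ℝ 1 f 1 → HasDerivAt f (deriv f 1) 1 := fun hf =>
    (hf.differentiableAt one_ne_zero).hasDerivAt
  have h1 := (hd hx).fun_mul (hd (hu i))
  have h2 := HasDerivAt.fun_sum (u := Finset.univ) fun j _ => (hd (hG i j)).fun_mul (hd (hu j))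
  have h3 := (h2.congr_of_eventuallyEq heq.symm).unique h1
  simp only [hG1, hu1, hx1, Pi.one_apply, mul_one, one_mul] at h3
  exact h3.symm

lemma eigen_curve_deriv_two (hG : ∀ i j, ContDiffAt ℝ 2 (fun w => G w i j) 1) (hG1 : G 1 = P)
    (hx : ContDiffAt ℝ 2 x 1) (hu : ∀ i, ContDiffAt ℝ 2 (fun w => u w i) 1) (hx1 : x 1 = 1)
    (hu1 : u 1 = 1)
    (h : ∀ᶠ w in 𝓝 (1 : ℝ), ∀ i, ∑ j, G w i j * u w j = x w * u w i) (i : Fin (n + 1)) :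
    iteratedDeriv 2 x 1 + 2 * deriv x 1 * deriv (fun w => u w i) 1
        + iteratedDeriv 2 (fun w => u w i) 1 =
      ∑ j, (iteratedDeriv 2 (fun w => G w i j) 1
        + 2 * deriv (fun w => G w i j) 1 * deriv (fun w => u w j) 1
        + P i j * iteratedDeriv 2 (fun w => u w j) 1) := by
  have heq : (fun w => ∑ j, G w i j * u w j) =ᶠ[𝓝 1] fun w => x w * u w i :=
    h.mono fun w hw => hw i
  have hmul : ∀ {f g : ℝ → ℝ}, ContDiffAt ℝ 2 f 1 → ContDiffAt ℝ 2 g 1 →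
      iteratedDeriv 2 (fun w => f w * g w) 1 =
        iteratedDeriv 2 f 1 * g 1 + 2 * deriv f 1 * deriv g 1 + f 1 * iteratedDeriv 2 g 1 := by
    intro f g hf hg
    rw [iteratedDeriv_fun_mul (n := 2) hf hg]
    simp [Finset.sum_range_succ, iteratedDeriv_one]
    ring
  have h1 := heq.iteratedDeriv_eq 2
  rw [hmul hx (hu i), iteratedDeriv_fun_sum (fun j _ => (hG i j).mul (hu j))] at h1
  simp only [hmul (hG i _) (hu _), hG1, hu1, hx1, Pi.one_apply, mul_one, one_mul] at h1
  exact h1.symm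

/-- The first derivative of the eigenvalue, by averaging the differentiated eigenvalue equation
over the stationary distribution. -/
lemma eigen_curve_deriv_eq (hπ : ∀ j, ∑ i, π i * P i j = π j) (hπ1 : ∑ i, π i = 1)
    (hG : ∀ i j, ContDiffAt ℝ 1 (fun w => G w i j) 1) (hG1 : G 1 = P)
    (hx : ContDiffAt ℝ 1 x 1) (hu : ∀ i, ContDiffAt ℝ 1 (fun w => u w i) 1) (hx1 : x 1 = 1)
    (hu1 : u 1 = 1)
    (h : ∀ᶠ w in 𝓝 (1 : ℝ), ∀ i, ∑ j, G w i j * u w j = x w * u w i) :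
    deriv x 1 = ∑ i, ∑ j, π i * deriv (fun w => G w i j) 1 := by
  have h1 := Finset.sum_congr rfl fun i (_ : i ∈ Finset.univ) =>
    congrArg (π i * ·) (eigen_curve_deriv hG hG1 hx hu hx1 hu1 h i)
  simp only [mul_add, Finset.sum_add_distrib, ← Finset.sum_mul, hπ1, one_mul] at h1
  have h4 : ∑ i, π i * ∑ j, P i j * deriv (fun w => u w j) 1 =
      ∑ j, π j * deriv (fun w => u w j) 1 := by
    simp_rw [Finset.mul_sum]
    rw [Finset.sum_comm]
    refine Finset.sum_congr rfl fun j _ => ?_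
    rw [← hπ j, Finset.sum_mul]
    exact Finset.sum_congr rfl fun i _ => by ring
  rw [h4] at h1
  simp_rw [← Finset.mul_sum]
  linarith

end Perturbation

namespace ArrivalStream

/-! ### The underlying chain of one class -/

variable (s : ArrivalStream)

/-- The transition matrix of the underlying chain, with real entries. -/
noncomputable def transMatrix : Matrix (Fin (s.M + 1)) (Fin (s.M + 1)) ℝ :=
  Matrix.of fun i j => (s.P i j).toReal

lemma transMatrix_apply (i j) : s.transMatrix i j = (s.P i j).toReal := rfl

lemma transMatrix_nonneg (i j) : 0 ≤ s.transMatrix i j := ENNReal.toReal_nonneg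

lemma sum_toReal_eq_one {α : Type*} [Fintype α] (p : PMF α) : ∑ i, (p i).toReal = 1 := by
  rw [← ENNReal.toReal_sum fun i _ => p.apply_ne_top i, ← tsum_fintype (L := .unconditional _),
    p.tsum_coe, ENNReal.toReal_one]

lemma sum_transMatrix (i) : ∑ j, s.transMatrix i j = 1 := sum_toReal_eq_one (s.P i)

lemma exists_pow_transMatrix_pos (i j) : ∃ k, 0 < (s.transMatrix ^ k) i j := by
  obtain ⟨k, -, hk⟩ :=
    (Matrix.isIrreducible_iff_exists_pow_pos s.transMatrix_nonneg).mp s.irreducible i j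
  exact ⟨k, hk⟩

lemma pow_transMatrix_nonneg (k : ℕ) (i j) : 0 ≤ (s.transMatrix ^ k) i j := by
  induction k generalizing i j with
  | zero => rw [pow_zero, Matrix.one_apply]; positivity
  | succ k ih =>
    rw [pow_succ, Matrix.mul_apply]
    exact Finset.sum_nonneg fun l _ => mul_nonneg (ih i l) (s.transMatrix_nonneg l j)

lemma sum_pow_transMatrix (k : ℕ) (i) : ∑ j, (s.transMatrix ^ k) i j = 1 := by
  induction k with
  | zero => simp [Matrix.one_apply]
  | succ k ih =>
    simp_rw [pow_succ, Matrix.mul_apply]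
    rw [Finset.sum_comm]
    simp_rw [← Finset.mul_sum, s.sum_transMatrix, mul_one, ih]

/-- A function that vanishes at `0` and is harmonic elsewhere is zero: its absolute value is
subharmonic, and the state `0` can be reached from the point where it is largest. -/
lemma eq_zero_of_harmonic {f : Fin (s.M + 1) → ℝ} (h0 : f 0 = 0)
    (h : ∀ i, i ≠ 0 → ∑ j, s.transMatrix i j * f j = f i) : f = 0 := by
  have hsub : ∀ (k : ℕ) i, |f i| ≤ ∑ j, (s.transMatrix ^ k) i j * |f j| := by
    intro k
    induction k with
    | zero => intro i; simp [Matrix.one_apply]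
    | succ k ih =>
      intro i
      have h1 : ∀ i, |f i| ≤ ∑ j, s.transMatrix i j * |f j| := by
        intro i
        by_cases hi : i = 0
        · rw [hi, h0, abs_zero]
          exact Finset.sum_nonneg fun j _ => mul_nonneg (s.transMatrix_nonneg _ _) (abs_nonneg _)
        · rw [← h i hi]
          refine (Finset.abs_sum_le_sum_abs _ _).trans (le_of_eq ?_)
          exact Finset.sum_congr rfl fun j _ => by
            rw [abs_mul, abs_of_nonneg (s.transMatrix_nonneg i j)]
      calc |f i| ≤ ∑ l, (s.transMatrix ^ k) i l * |f l| := ih i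
        _ ≤ ∑ l, (s.transMatrix ^ k) i l * ∑ j, s.transMatrix l j * |f j| :=
          Finset.sum_le_sum fun l _ =>
            mul_le_mul_of_nonneg_left (h1 l) (s.pow_transMatrix_nonneg k i l)
        _ = ∑ j, (s.transMatrix ^ (k + 1)) i j * |f j| := by
          simp_rw [pow_succ, Matrix.mul_apply, Finset.mul_sum, Finset.sum_mul]
          rw [Finset.sum_comm]
          exact Finset.sum_congr rfl fun j _ => Finset.sum_congr rfl fun l _ => by ring
  obtain ⟨i, -, hi⟩ := Finset.exists_max_image Finset.univ (fun i => |f i|)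
    ⟨0, Finset.mem_univ _⟩
  obtain ⟨k, hk⟩ := s.exists_pow_transMatrix_pos i 0
  have h2 : ∑ j, (s.transMatrix ^ k) i j * |f j| ≤ ∑ j, (s.transMatrix ^ k) i j * |f i| -
      (s.transMatrix ^ k) i 0 * |f i| := by
    rw [← Finset.sum_erase_add _ _ (Finset.mem_univ 0),
      ← Finset.sum_erase_add _ (fun j => (s.transMatrix ^ k) i j * |f i|) (Finset.mem_univ 0),
      h0, abs_zero, mul_zero, add_zero, add_sub_cancel_right]
    exact Finset.sum_le_sum fun j _ =>
      mul_le_mul_of_nonneg_left (hi j (Finset.mem_univ j)) (s.pow_transMatrix_nonneg k i j)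
  rw [← Finset.sum_mul, s.sum_pow_transMatrix, one_mul] at h2
  have h3 := (hsub k i).trans h2
  have h4 : |f i| = 0 := by
    have := abs_nonneg (f i)
    nlinarith
  funext j
  have := hi j (Finset.mem_univ j)
  rw [h4] at this
  exact abs_nonpos_iff.mp this

variable {s} {π : PMF (Fin (s.M + 1))}

lemma sum_stationary (hπ : π.bind s.P = π) (j) :
    ∑ i, (π i).toReal * s.transMatrix i j = (π j).toReal := by
  have h := congrArg (fun p : PMF _ => (p j).toReal) hπ
  simp only [PMF.bind_apply, tsum_fintype] at h
  rw [← h, ENNReal.toReal_sum fun i _ => ENNReal.mul_ne_top (π.apply_ne_top i)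
    ((s.P i).apply_ne_top j)]
  exact Finset.sum_congr rfl fun i _ => ENNReal.toReal_mul.symm

lemma stationary_pos (hπ : π.bind s.P = π) (j) : 0 < (π j).toReal := by
  have hpow : ∀ (k : ℕ) j, ∑ i, (π i).toReal * (s.transMatrix ^ k) i j = (π j).toReal := by
    intro k
    induction k with
    | zero => intro j; simp [Matrix.one_apply]
    | succ k ih =>
      intro j
      simp_rw [pow_succ, Matrix.mul_apply, Finset.mul_sum]
      rw [Finset.sum_comm, ← sum_stationary hπ j]
      refine Finset.sum_congr rfl fun l _ => ?_
      rw [← ih l, Finset.sum_mul]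
      exact Finset.sum_congr rfl fun i _ => by ring
  have hex : ∃ i, 0 < (π i).toReal := by
    by_contra hneg
    push Not at hneg
    have := Finset.sum_nonpos fun i (_ : i ∈ Finset.univ) => hneg i
    rw [sum_toReal_eq_one π] at this
    linarith
  obtain ⟨i, hi⟩ := hex
  obtain ⟨k, hk⟩ := s.exists_pow_transMatrix_pos i j
  rw [← hpow k j]
  exact (mul_pos hi hk).trans_le (Finset.single_le_sum (f := fun i =>
    (π i).toReal * (s.transMatrix ^ k) i j)
    (fun i _ => mul_nonneg ENNReal.toReal_nonneg (s.pow_transMatrix_nonneg k i j))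
    (Finset.mem_univ i))

/-! ### Factorial moments of the numbers of arrivals -/

variable (s)

/-- `s.arr r i j` is `P i j` times the `r`-th factorial moment of the number of customers brought
by a step from `i` to `j`. -/
noncomputable def arr (r : ℕ) (i j : Fin (s.M + 1)) : ℝ≥0∞ :=
  ∑' n : ℕ, (n.descFactorial r : ℝ≥0∞) * (s.P i j * s.a i j n)

lemma arr_zero (i j) : s.arr 0 i j = s.P i j := by
  simp [arr, ENNReal.tsum_mul_left, (s.a i j).tsum_coe]

lemma arr_idle {r : ℕ} (hr : r ≠ 0) (i) : s.arr r i 0 = 0 := by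
  refine ENNReal.tsum_eq_zero.mpr fun n => ?_
  rcases Nat.eq_zero_or_pos n with rfl | hn
  · obtain ⟨r, rfl⟩ := Nat.exists_eq_succ_of_ne_zero hr
    simp
  · have h := (PMF.apply_eq_one_iff (s.a i 0) 0).mp (s.a_idle i)
    have : s.a i 0 n = 0 := by
      rw [PMF.apply_eq_zero_iff, h]
      simpa using hn.ne'
    simp [this]

lemma arr_one (i j) : s.arr 1 i j = s.P i j * mean (s.a i j) := by
  simp only [arr, mean, Nat.descFactorial_one, ← ENNReal.tsum_mul_left]
  exact tsum_congr fun n => by ring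

/-- The coefficients of the entries of the matrix `A(z)`. -/
noncomputable def coef (i j : Fin (s.M + 1)) (n : ℕ) : ℝ := (s.P i j * s.a i j n).toReal

lemma coef_nonneg (i j n) : 0 ≤ s.coef i j n := ENNReal.toReal_nonneg

lemma genMatrix_apply (z : ℝ) (i j) : s.genMatrix z i j = genSeries (s.coef i j) z := by
  simp only [genMatrix, Matrix.of_apply, genSeries, coef, ENNReal.toReal_mul, ← tsum_mul_left]
  exact tsum_congr fun n => by ring

lemma mul_ne_top (i j n) : s.P i j * s.a i j n ≠ ∞ :=
  ENNReal.mul_ne_top ((s.P i).apply_ne_top j) ((s.a i j).apply_ne_top n)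

lemma summable_descFactorial_coef {r : ℕ} {i j} (h : s.arr r i j ≠ ∞) :
    Summable fun n : ℕ => (n.descFactorial r : ℝ) * s.coef i j n := by
  refine (ENNReal.summable_toReal h).congr fun n => ?_
  rw [ENNReal.toReal_mul, ENNReal.toReal_natCast, coef]

lemma tsum_descFactorial_coef (r : ℕ) (i j) :
    ∑' n : ℕ, (n.descFactorial r : ℝ) * s.coef i j n = (s.arr r i j).toReal := by
  rw [arr, ENNReal.tsum_toReal_eq fun n => ENNReal.mul_ne_top (by simp) (s.mul_ne_top i j n)]
  exact tsum_congr fun n => by rw [ENNReal.toReal_mul, ENNReal.toReal_natCast, coef]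

lemma summable_coef (i j) : Summable (s.coef i j) := by
  simpa using s.summable_descFactorial_coef (r := 0) (i := i) (j := j)
    (by rw [s.arr_zero]; exact (s.P i).apply_ne_top j)

end ArrivalStream

lemma summable_pow_mul_of_descFactorial {p : ℕ → ℝ} (hp : ∀ n, 0 ≤ p n) (hs : Summable p)
    {r : ℕ} (hr : Summable fun n : ℕ => (n.descFactorial r : ℝ) * p n) :
    Summable fun n : ℕ => (n : ℝ) ^ r * p n := by
  refine ((hs.mul_left ((2 * r : ℝ) ^ r)).add (hr.mul_left (2 ^ r))).of_nonneg_of_le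
    (fun n => mul_nonneg (by positivity) (hp n)) fun n => ?_
  rw [← mul_assoc, ← add_mul]
  refine mul_le_mul_of_nonneg_right ?_ (hp n)
  -- for `n ≥ 2 r` each factor of the descending factorial is at least `n / 2`
  rcases le_total n (2 * r) with hn | hn
  · have h1 : (n : ℝ) ≤ 2 * r := by exact_mod_cast hn
    have h2 : (n : ℝ) ^ r ≤ (2 * r : ℝ) ^ r := by gcongr
    have h3 : (0 : ℝ) ≤ 2 ^ r * (n.descFactorial r : ℝ) := by positivity
    linarith
  · have h1 : (n + 1 - r) ^ r ≤ n.descFactorial r := Nat.pow_sub_le_descFactorial n r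
    have h2 : n ≤ 2 * (n + 1 - r) := by omega
    have h3 : n ^ r ≤ 2 ^ r * n.descFactorial r :=
      calc n ^ r ≤ (2 * (n + 1 - r)) ^ r := Nat.pow_le_pow_left h2 r
        _ = 2 ^ r * (n + 1 - r) ^ r := mul_pow _ _ _
        _ ≤ _ := Nat.mul_le_mul_left _ h1
    have h4 : (n : ℝ) ^ r ≤ 2 ^ r * (n.descFactorial r : ℝ) := by exact_mod_cast h3
    have h5 : (0 : ℝ) ≤ (2 * r : ℝ) ^ r := by positivity
    linarith

namespace ArrivalStream

variable {s : ArrivalStream} {π : PMF (Fin (s.M + 1))}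

/-- Near `1`, the Perron-Frobenius eigenvalue of `A(z)` and a positive eigenvector extend smoothly
beyond `1`, to the order of smoothness given by the moments of the numbers of arrivals. -/
theorem exists_delta_curve (hπ : π.bind s.P = π) {r : ℕ} (hr : r ≠ 0)
    (hmom : ∀ i j, s.arr r i j ≠ ∞) :
    ∃ (x : ℝ → ℝ) (u : ℝ → Fin (s.M + 1) → ℝ) (G : ℝ → Matrix (Fin (s.M + 1)) (Fin (s.M + 1)) ℝ),
      ContDiffAt ℝ r x 1 ∧ (∀ i, ContDiffAt ℝ r (fun w => u w i) 1) ∧ x 1 = 1 ∧ u 1 = 1 ∧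
      (∀ w, u w 0 = 1) ∧ (∀ i j, ContDiffAt ℝ r (fun w => G w i j) 1) ∧ G 1 = s.transMatrix ∧
      (∀ᶠ w in 𝓝 (1 : ℝ), ∀ i, ∑ j, G w i j * u w j = x w * u w i) ∧
      (∀ k ≤ r, ∀ i j, iteratedDeriv k (fun w => G w i j) 1 = (s.arr k i j).toReal) ∧
      (∀ᶠ w in 𝓝 (1 : ℝ), 0 < x w ∧ ∀ i, 0 < u w i) ∧
      (∀ᶠ w in 𝓝 (1 : ℝ), w ∈ Set.Icc (0 : ℝ) 1 →
        s.delta w = x w ∧ ∀ i, ∑ j, s.genMatrix w i j * u w j = x w * u w i) := by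
  have hext := fun i j => exists_contDiff_extension r (s.coef i j) (s.coef_nonneg i j)
    (s.summable_coef i j) (summable_pow_mul_of_descFactorial (s.coef_nonneg i j)
      (s.summable_coef i j) (s.summable_descFactorial_coef (hmom i j)))
  choose g hg hgs hgd using hext
  set G : ℝ → Matrix (Fin (s.M + 1)) (Fin (s.M + 1)) ℝ := fun w => Matrix.of fun i j => g i j w
    with hG
  have hGd : ∀ k ≤ r, ∀ i j, iteratedDeriv k (fun w => G w i j) 1 = (s.arr k i j).toReal := by
    intro k hk i j
    rw [← s.tsum_descFactorial_coef, ← hgd i j k hk]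
    rfl
  have hG1 : G 1 = s.transMatrix := by
    ext i j
    have := hGd 0 (Nat.zero_le r) i j
    rw [iteratedDeriv_zero, s.arr_zero] at this
    exact this
  obtain ⟨x, u, hx, hu, hx1, hu1, hu0, hE⟩ := exists_eigen_curve (P := s.transMatrix)
    (π := fun i => (π i).toReal) s.sum_transMatrix (sum_stationary hπ) (sum_toReal_eq_one π)
    (fun f h0 h => s.eq_zero_of_harmonic h0 fun i _ => h i) hr (G := G)
    (fun i j => (hg i j).contDiffAt) hG1
  have hpos : ∀ᶠ w in 𝓝 (1 : ℝ), 0 < x w ∧ ∀ i, 0 < u w i := by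
    refine (hx.continuousAt.eventually (lt_mem_nhds (by rw [hx1]; exact one_pos))).and ?_
    exact eventually_all.mpr fun i => (hu i).continuousAt.eventually
      (lt_mem_nhds (by simp [hu1]))
  refine ⟨x, u, G, hx, hu, hx1, hu1, hu0, fun i j => (hg i j).contDiffAt, hG1, hE, hGd, hpos, ?_⟩
  filter_upwards [hE, hpos] with w hw hwp hw01
  have hGw : ∀ i j, G w i j = s.genMatrix w i j := fun i j => by
    rw [s.genMatrix_apply, ← hgs i j w hw01]
    rfl
  have heig : ∀ i, ∑ j, s.genMatrix w i j * u w j = x w * u w i := fun i => by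
    simp_rw [← hGw, hw i]
  refine ⟨perronRoot_eq_of_pos_eigenvector (fun i j => ?_) hwp.2 (funext heig), heig⟩
  rw [s.genMatrix_apply]
  exact tsum_nonneg fun n => mul_nonneg (s.coef_nonneg i j n) (pow_nonneg hw01.1 n)

end ArrivalStream

/-! ### Moments of mass functions -/

/-- Since `Pr(Y > n) = ∑_{m > n} Pr(Y = m)`, the mean of the equilibrium variable is
`E[Y (Y - 1)] / (2 E[Y])`. -/
lemma equilibriumMean_toReal (p : ℕ → ℝ≥0∞) :
    (equilibriumMean p).toReal =
      (∑' n : ℕ, (n.descFactorial 2 : ℝ≥0∞) * p n).toReal / 2 / (mean p).toReal := by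
  have h1 : equilibriumMean p = (∑' n : ℕ, (n.choose 2 : ℝ≥0∞) * p n) / mean p := by
    change ∑' n : ℕ, (n : ℝ≥0∞) * ((∑' m : ℕ, if n < m then p m else 0) / mean p) = _
    simp_rw [div_eq_mul_inv, ← mul_assoc, ENNReal.tsum_mul_right, ← ENNReal.tsum_mul_left]
    rw [ENNReal.tsum_comm]
    congr 1
    refine tsum_congr fun m => ?_
    rw [tsum_eq_sum (s := Finset.range m) fun n hn => by
      rw [Finset.mem_range] at hn; rw [if_neg hn, mul_zero]]
    rw [Nat.choose_two_right, ← Finset.sum_range_id, Nat.cast_sum, Finset.sum_mul]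
    exact Finset.sum_congr rfl fun n hn => by rw [if_pos (Finset.mem_range.mp hn)]
  have h2 : ∑' n : ℕ, (n.descFactorial 2 : ℝ≥0∞) * p n =
      2 * ∑' n : ℕ, (n.choose 2 : ℝ≥0∞) * p n := by
    rw [← ENNReal.tsum_mul_left]
    refine tsum_congr fun n => ?_
    rw [Nat.descFactorial_eq_factorial_mul_choose, ← mul_assoc]
    norm_num
  rw [h1, h2, ENNReal.toReal_div, ENNReal.toReal_mul]
  simp

lemma tsum_mul_antidiagonal (φ f g : ℕ → ℝ≥0∞) :
    ∑' m, φ m * ∑ x ∈ Finset.HasAntidiagonal.antidiagonal m, f x.1 * g x.2 =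
      ∑' a, ∑' b, φ (a + b) * (f a * g b) := by
  rw [← ENNReal.tsum_prod, ← Finset.HasAntidiagonal.sigmaAntidiagonalEquivProd.tsum_eq,
    ENNReal.tsum_sigma']
  refine tsum_congr fun m => ?_
  rw [tsum_fintype, Finset.mul_sum, ← Finset.sum_coe_sort]
  refine Finset.sum_congr rfl fun x _ => ?_
  have hx := Finset.HasAntidiagonal.mem_antidiagonal.mp x.2
  simp [Finset.HasAntidiagonal.sigmaAntidiagonalEquivProd_apply, hx]

lemma add_descFactorial_two (a b : ℕ) :
    (a + b).descFactorial 2 = a.descFactorial 2 + 2 * (a * b) + b.descFactorial 2 := by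
  rcases a with _ | a <;> rcases b with _ | b <;> simp [Nat.descFactorial_succ]
  ring

namespace ArrivalStream

/-! ### Moments of an active period -/

variable (s : ArrivalStream)

/-- The `r`-th factorial moment of the number of customers in the first `c + 1` slots of an active
period, on the event that the chain is in state `j + 1` in the last of them. -/
noncomputable def prefixMoment (r c : ℕ) (j : Fin s.M) : ℝ≥0∞ :=
  ∑' m : ℕ, (m.descFactorial r : ℝ≥0∞) * s.activePrefix c m j

lemma prefixMoment_zero (r : ℕ) (j : Fin s.M) :
    s.prefixMoment r 0 j = s.arr r 0 j.succ / (1 - s.P 0 0) := by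
  simp only [prefixMoment, activePrefix, arr, div_eq_mul_inv, ← ENNReal.tsum_mul_right]
  exact tsum_congr fun m => by ring

lemma prefixMoment_succ (r c : ℕ) (j : Fin s.M) : s.prefixMoment r (c + 1) j =
    ∑ i : Fin s.M, ∑' a : ℕ, ∑' b : ℕ, ((a + b).descFactorial r : ℝ≥0∞) *
      (s.activePrefix c a i * (s.P i.succ j.succ * s.a i.succ j.succ b)) := by
  simp only [prefixMoment, activePrefix, Finset.mul_sum]
  rw [Summable.tsum_finsetSum fun _ _ => ENNReal.summable]
  refine Finset.sum_congr rfl fun i _ => ?_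
  rw [← tsum_mul_antidiagonal (fun m => (m.descFactorial r : ℝ≥0∞)) (fun a => s.activePrefix c a i)
    (fun b => s.P i.succ j.succ * s.a i.succ j.succ b)]
  simp only [Finset.mul_sum]

lemma tsum_tsum_mul (φ ψ f g : ℕ → ℝ≥0∞) :
    ∑' a, ∑' b, φ a * ψ b * (f a * g b) = (∑' a, φ a * f a) * ∑' b, ψ b * g b := by
  rw [← ENNReal.tsum_mul_right]
  refine tsum_congr fun a => ?_
  rw [← ENNReal.tsum_mul_left]
  exact tsum_congr fun b => by ring

lemma prefixMoment_zero_succ (c : ℕ) (j : Fin s.M) : s.prefixMoment 0 (c + 1) j =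
    ∑ i, s.prefixMoment 0 c i * s.arr 0 i.succ j.succ := by
  rw [prefixMoment_succ]
  refine Finset.sum_congr rfl fun i _ => ?_
  rw [prefixMoment, arr, ← tsum_tsum_mul]
  simp

lemma prefixMoment_one_succ (c : ℕ) (j : Fin s.M) : s.prefixMoment 1 (c + 1) j =
    ∑ i, s.prefixMoment 1 c i * s.arr 0 i.succ j.succ +
      ∑ i, s.prefixMoment 0 c i * s.arr 1 i.succ j.succ := by
  rw [prefixMoment_succ, ← Finset.sum_add_distrib]
  refine Finset.sum_congr rfl fun i _ => ?_
  simp only [prefixMoment, arr]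
  rw [← tsum_tsum_mul, ← tsum_tsum_mul, ← ENNReal.tsum_add]
  refine tsum_congr fun a => ?_
  rw [← ENNReal.tsum_add]
  refine tsum_congr fun b => ?_
  simp only [Nat.descFactorial_one, Nat.descFactorial_zero]
  push_cast
  ring

lemma prefixMoment_two_succ (c : ℕ) (j : Fin s.M) : s.prefixMoment 2 (c + 1) j =
    ∑ i, s.prefixMoment 2 c i * s.arr 0 i.succ j.succ +
      ∑ i, (2 * s.prefixMoment 1 c i * s.arr 1 i.succ j.succ +
        s.prefixMoment 0 c i * s.arr 2 i.succ j.succ) := by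
  rw [prefixMoment_succ, ← Finset.sum_add_distrib]
  refine Finset.sum_congr rfl fun i _ => ?_
  rw [mul_assoc]
  simp only [prefixMoment, arr]
  rw [← tsum_tsum_mul, ← tsum_tsum_mul, ← tsum_tsum_mul, ← ENNReal.tsum_mul_left,
    ← ENNReal.tsum_add, ← ENNReal.tsum_add]
  refine tsum_congr fun a => ?_
  rw [← ENNReal.tsum_mul_left, ← ENNReal.tsum_add, ← ENNReal.tsum_add]
  refine tsum_congr fun b => ?_
  simp only [add_descFactorial_two, Nat.descFactorial_one, Nat.descFactorial_zero]
  push_cast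
  ring

/-- The equation `h = k + Q h`, where `Q` is the transition matrix restricted to the active states,
has a solution. -/
lemma exists_resolvent (k : Fin s.M → ℝ) :
    ∃ h : Fin s.M → ℝ, ∀ i, h i = k i + ∑ j, s.transMatrix i.succ j.succ * h j := by
  let T : (Fin s.M → ℝ) →ₗ[ℝ] (Fin s.M → ℝ) :=
    { toFun := fun h i => h i - ∑ j, s.transMatrix i.succ j.succ * h j
      map_add' := fun f g => by
        funext i; simp only [Pi.add_apply, mul_add, Finset.sum_add_distrib]; ring
      map_smul' := fun c f => by
        funext i
        simp only [Pi.smul_apply, smul_eq_mul, RingHom.id_apply, mul_sub, Finset.mul_sum]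
        congr 1
        exact Finset.sum_congr rfl fun j _ => by ring }
  have hinj : Function.Injective T := by
    refine (injective_iff_map_eq_zero T).mpr fun h hh => ?_
    have h1 : (Fin.cons 0 h : Fin (s.M + 1) → ℝ) = 0 := by
      refine s.eq_zero_of_harmonic (Fin.cons_zero _ _) fun i hi => ?_
      obtain ⟨i, rfl⟩ := Fin.exists_succ_eq.mpr hi
      have h2 : h i - ∑ j, s.transMatrix i.succ j.succ * h j = 0 := congrFun hh i
      rw [Fin.sum_univ_succ]
      simp only [Fin.cons_zero, Fin.cons_succ]
      linarith
    funext i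
    simpa using congrFun h1 i.succ
  obtain ⟨h, hh⟩ := LinearMap.injective_iff_surjective.mp hinj k
  refine ⟨h, fun i => ?_⟩
  have h2 : h i - ∑ j, s.transMatrix i.succ j.succ * h j = k i := congrFun hh i
  linarith

/-- The mean time spent in the active states before the first visit to `0`. -/
lemma exists_meanActiveTime : ∃ h : Fin s.M → ℝ≥0∞, (∀ i, h i ≠ ∞) ∧
    ∀ i, h i = 1 + ∑ j, s.arr 0 i.succ j.succ * h j := by
  obtain ⟨h, hh⟩ := s.exists_resolvent fun _ => 1
  have hnn : ∀ i, 0 ≤ h i := by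
    have : Nonempty (Fin s.M) := ⟨⟨0, s.M_pos⟩⟩
    obtain ⟨i, -, hi⟩ := Finset.exists_min_image Finset.univ h Finset.univ_nonempty
    have hsum : ∑ j : Fin s.M, s.transMatrix i.succ j.succ ≤ 1 := by
      have h1 := s.sum_transMatrix i.succ
      rw [Fin.sum_univ_succ] at h1
      linarith [s.transMatrix_nonneg i.succ 0]
    have h2 : (∑ j : Fin s.M, s.transMatrix i.succ j.succ) * h i ≤
        ∑ j, s.transMatrix i.succ j.succ * h j := by
      rw [Finset.sum_mul]
      exact Finset.sum_le_sum fun j _ =>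
        mul_le_mul_of_nonneg_left (hi j (Finset.mem_univ j)) (s.transMatrix_nonneg _ _)
    have h3 : 0 ≤ h i := by
      by_contra hneg
      have := hh i
      nlinarith
    exact fun j => h3.trans (hi j (Finset.mem_univ j))
  refine ⟨fun i => ENNReal.ofReal (h i), fun i => ENNReal.ofReal_ne_top, fun i => ?_⟩
  have h4 : ∀ j : Fin s.M, 0 ≤ s.transMatrix i.succ j.succ * h j := fun j =>
    mul_nonneg (s.transMatrix_nonneg _ _) (hnn j)
  beta_reduce
  rw [hh i, ENNReal.ofReal_add zero_le_one (Finset.sum_nonneg fun j _ => h4 j),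
    ENNReal.ofReal_one, ENNReal.ofReal_sum_of_nonneg fun j _ => h4 j]
  congr 1
  refine Finset.sum_congr rfl fun j _ => ?_
  rw [ENNReal.ofReal_mul (s.transMatrix_nonneg _ _), s.arr_zero, transMatrix_apply,
    ENNReal.ofReal_toReal ((s.P _).apply_ne_top _)]

variable {s} in
lemma tsum_recursion {T F : ℕ → Fin s.M → ℝ≥0∞}
    (hT : ∀ c j, T (c + 1) j = ∑ i, T c i * s.arr 0 i.succ j.succ + F c j) (j : Fin s.M) :
    ∑' c, T c j = T 0 j + ∑' c, F c j + ∑ i, (∑' c, T c i) * s.arr 0 i.succ j.succ := by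
  rw [tsum_eq_zero_add' ENNReal.summable]
  simp_rw [hT]
  rw [ENNReal.tsum_add, Summable.tsum_finsetSum fun _ _ => ENNReal.summable]
  simp_rw [ENNReal.tsum_mul_right]
  ring

variable {s} in
/-- A row vector that is multiplied by the transition matrix of the active states in each step,
with a summable input, is summable: its sum is controlled by pairing it with the mean time which
the chain stays active. -/
lemma tsum_recursion_ne_top {T F : ℕ → Fin s.M → ℝ≥0∞}
    (hT : ∀ c j, T (c + 1) j = ∑ i, T c i * s.arr 0 i.succ j.succ + F c j)
    (h0 : ∀ j, T 0 j ≠ ∞) (hF : ∀ j, ∑' c, F c j ≠ ∞) (j : Fin s.M) : ∑' c, T c j ≠ ∞ := by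
  obtain ⟨h, hfin, hh⟩ := s.exists_meanActiveTime
  have hstep : ∀ c, ∑ j, T c j * h j + ∑ j, F c j * h j =
      ∑ j, T c j + ∑ j, T (c + 1) j * h j := by
    intro c
    have h1 : ∑ j, T c j * h j = ∑ j, T c j + ∑ j, (∑ i, T c i * s.arr 0 i.succ j.succ) * h j := by
      conv_lhs => enter [2, j]; rw [hh j, mul_add, mul_one, Finset.mul_sum]
      rw [Finset.sum_add_distrib, Finset.sum_comm]
      congr 1
      refine Finset.sum_congr rfl fun j _ => ?_
      rw [Finset.sum_mul]
      exact Finset.sum_congr rfl fun i _ => by ring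
    simp_rw [hT, add_mul, Finset.sum_add_distrib]
    rw [h1, add_assoc]
  have hpart : ∀ n, ∑ c ∈ Finset.range n, ∑ j, T c j + ∑ j, T n j * h j =
      ∑ j, T 0 j * h j + ∑ c ∈ Finset.range n, ∑ j, F c j * h j := by
    intro n
    induction n with
    | zero => simp
    | succ n ih =>
      rw [Finset.sum_range_succ, Finset.sum_range_succ, ← add_assoc, ← ih, add_assoc, ← hstep,
        add_assoc]
  have hbound : ∑' c, ∑ j, T c j ≤ ∑ j, T 0 j * h j + ∑' c, ∑ j, F c j * h j := by
    refine ENNReal.tsum_le_of_sum_range_le fun n => ?_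
    calc _ ≤ ∑ c ∈ Finset.range n, ∑ j, T c j + ∑ j, T n j * h j := le_self_add
      _ = _ := hpart n
      _ ≤ _ := by gcongr; exact ENNReal.sum_le_tsum _
  have hfinite : ∑ j, T 0 j * h j + ∑' c, ∑ j, F c j * h j ≠ ∞ := by
    rw [Summable.tsum_finsetSum fun _ _ => ENNReal.summable]
    simp_rw [ENNReal.tsum_mul_right]
    exact ENNReal.add_ne_top.mpr
      ⟨ENNReal.sum_ne_top.mpr fun j _ => ENNReal.mul_ne_top (h0 j) (hfin j),
        ENNReal.sum_ne_top.mpr fun j _ => ENNReal.mul_ne_top (hF j) (hfin j)⟩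
  refine ne_top_of_le_ne_top hfinite (le_trans ?_ hbound)
  exact ENNReal.tsum_le_tsum fun c => Finset.single_le_sum (fun _ _ => zero_le) (Finset.mem_univ j)

/-- `s.total α r j` is the sum of the moments `s.prefixMoment r c j` over `c`, with weights
`α c`. -/
noncomputable def total (α : ℕ → ℝ≥0∞) (r : ℕ) (j : Fin s.M) : ℝ≥0∞ :=
  ∑' c, α c * s.prefixMoment r c j

/-- Moments of the joint law of `C` and `Λ`, obtained by closing the active period with a step into
the state `0`. -/
lemma tsum_activeLaw (β : ℕ → ℝ≥0∞) (r : ℕ) :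
    ∑' c, ∑' m : ℕ, β c * ((m.descFactorial r : ℝ≥0∞) * s.activeLaw c m) =
      ∑ j, s.total (fun c => β (c + 1)) r j * s.P j.succ 0 := by
  rw [tsum_eq_zero_add' ENNReal.summable]
  simp only [activeLaw, mul_zero, tsum_zero, zero_add, total, ← ENNReal.tsum_mul_right]
  rw [← Summable.tsum_finsetSum fun _ _ => ENNReal.summable]
  refine tsum_congr fun c => ?_
  simp only [prefixMoment, Finset.mul_sum]
  rw [Summable.tsum_finsetSum fun _ _ => ENNReal.summable]
  refine Finset.sum_congr rfl fun j _ => ?_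
  rw [ENNReal.tsum_mul_left, mul_assoc, ← ENNReal.tsum_mul_right]
  congr 1
  exact tsum_congr fun m => by ring

lemma tsum_lengthLaw (β : ℕ → ℝ≥0∞) :
    ∑' c, β c * s.lengthLaw c = ∑ j, s.total (fun c => β (c + 1)) 0 j * s.P j.succ 0 := by
  rw [← tsum_activeLaw]
  simp [lengthLaw, ENNReal.tsum_mul_left]

lemma tsum_batchLaw (r : ℕ) : ∑' m : ℕ, (m.descFactorial r : ℝ≥0∞) * s.batchLaw m =
    ∑ j, s.total 1 r j * s.P j.succ 0 := by
  have h := s.tsum_activeLaw 1 r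
  simp only [Pi.one_apply, one_mul] at h
  rw [show (1 : ℕ → ℝ≥0∞) = fun _ => 1 from rfl, ← h, ENNReal.tsum_comm]
  simp only [batchLaw, ENNReal.tsum_mul_left]

end ArrivalStream

lemma one_le_mean {p : PMF ℕ} (h0 : p 0 = 0) : 1 ≤ mean p := by
  rw [← p.tsum_coe, mean]
  refine ENNReal.tsum_le_tsum fun n => ?_
  rcases Nat.eq_zero_or_pos n with rfl | hn
  · simp [h0]
  · exact le_mul_of_one_le_left zero_le (by exact_mod_cast hn)

namespace ArrivalStream

variable (s : ArrivalStream)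

lemma prob_zero_zero_lt_one : s.transMatrix 0 0 < 1 := by
  by_contra hneg
  have hsum := s.sum_transMatrix 0
  rw [Fin.sum_univ_succ] at hsum
  have hz : ∀ j : Fin s.M, s.transMatrix 0 j.succ = 0 := by
    have h1 : ∑ j : Fin s.M, s.transMatrix 0 j.succ ≤ 0 := by linarith
    have h2 := (Finset.sum_eq_zero_iff_of_nonneg fun j _ => s.transMatrix_nonneg 0 _).mp
      (le_antisymm h1 (Finset.sum_nonneg fun j _ => s.transMatrix_nonneg 0 _))
    exact fun j => h2 j (Finset.mem_univ j)
  -- the state `0` would be absorbing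
  have hpow : ∀ (k : ℕ) (j : Fin s.M), (s.transMatrix ^ k) 0 j.succ = 0 := by
    intro k
    induction k with
    | zero => intro j; simp [(Fin.succ_ne_zero j).symm]
    | succ k ih =>
      intro j
      rw [pow_succ, Matrix.mul_apply, Fin.sum_univ_succ]
      simp [hz, ih]
  obtain ⟨k, hk⟩ := s.exists_pow_transMatrix_pos 0 (Fin.succ ⟨0, s.M_pos⟩)
  exact hk.ne' (hpow k _)

lemma one_sub_ne_zero : 1 - s.P 0 0 ≠ 0 := by
  refine (tsub_pos_of_lt ?_).ne'
  have := s.prob_zero_zero_lt_one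
  rwa [transMatrix_apply, ← ENNReal.toReal_one,
    ENNReal.toReal_lt_toReal ((s.P 0).apply_ne_top 0) ENNReal.one_ne_top] at this

lemma one_sub_toReal : (1 - s.P 0 0).toReal = 1 - s.transMatrix 0 0 := by
  rw [ENNReal.toReal_sub_of_le ((s.P 0).coe_le_one 0) ENNReal.one_ne_top, ENNReal.toReal_one,
    transMatrix_apply]

variable {s} {π : PMF (Fin (s.M + 1))}

lemma probOn_toReal : (s.probOn π).toReal = 1 - (π 0).toReal := by
  have h := sum_toReal_eq_one π
  rw [Fin.sum_univ_succ] at h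
  rw [probOn, ENNReal.toReal_sum fun j _ => π.apply_ne_top _]
  linarith

lemma probOn_pos (hπ : π.bind s.P = π) : 0 < (s.probOn π).toReal := by
  rw [probOn, ENNReal.toReal_sum fun j _ => π.apply_ne_top _]
  exact Finset.sum_pos (fun j _ => stationary_pos hπ _) ⟨⟨0, s.M_pos⟩, Finset.mem_univ _⟩

/-- At least one customer arrives in every active slot. -/
lemma probOn_le_rate (hπ : π.bind s.P = π) : s.probOn π ≤ s.rate π := by
  have h1 : ∀ j : Fin s.M, π j.succ = ∑ i, π i * s.P i j.succ := fun j => by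
    conv_lhs => rw [← hπ]
    rw [PMF.bind_apply, tsum_fintype]
  rw [probOn, rate, Finset.sum_comm, Fin.sum_univ_succ]
  refine le_add_left (Finset.sum_le_sum fun j _ => ?_)
  rw [h1]
  exact Finset.sum_le_sum fun i _ =>
    le_mul_of_one_le_right zero_le (one_le_mean (s.a_active i _ (Fin.succ_ne_zero j)))

lemma rate_ne_zero (hπ : π.bind s.P = π) : s.rate π ≠ 0 := by
  refine (lt_of_lt_of_le ?_ (probOn_le_rate hπ)).ne'
  exact (ENNReal.toReal_pos_iff.mp (probOn_pos hπ)).1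

lemma rate_eq : s.rate π = ∑ i, ∑ j, π i * s.arr 1 i j := by
  simp only [rate, arr_one, mul_assoc]

lemma rate_toReal (hmom : ∀ i j, s.arr 1 i j ≠ ∞) :
    (s.rate π).toReal = ∑ i, ∑ j, (π i).toReal * (s.arr 1 i j).toReal := by
  have h : ∀ i j, π i * s.arr 1 i j ≠ ∞ := fun i j =>
    ENNReal.mul_ne_top (π.apply_ne_top i) (hmom i j)
  rw [rate_eq, ENNReal.toReal_sum fun i _ => ENNReal.sum_ne_top.mpr fun j _ => h i j]
  refine Finset.sum_congr rfl fun i _ => ?_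
  rw [ENNReal.toReal_sum fun j _ => h i j]
  exact Finset.sum_congr rfl fun j _ => ENNReal.toReal_mul

lemma arr_one_ne_top (hπ : π.bind s.P = π) (h : s.rate π ≠ ∞) (i j) : s.arr 1 i j ≠ ∞ := by
  rw [rate_eq] at h
  have h1 := ENNReal.sum_ne_top.mp (ENNReal.sum_ne_top.mp h i (Finset.mem_univ i)) j
    (Finset.mem_univ j)
  intro h2
  have h3 : π i ≠ 0 := (ENNReal.toReal_pos_iff.mp (stationary_pos hπ i)).1.ne'
  exact h1 (by rw [h2, ENNReal.mul_top h3])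

/-- A row vector with `S = f + S Q` and a column vector with `h = k + Q h` satisfy
`S k = f h`. -/
lemma pairing {S f h k : Fin s.M → ℝ}
    (hS : ∀ j, S j = f j + ∑ i, S i * s.transMatrix i.succ j.succ)
    (hh : ∀ i, h i = k i + ∑ j, s.transMatrix i.succ j.succ * h j) :
    ∑ i, S i * k i = ∑ j, f j * h j := by
  have h1 : ∑ i, S i * h i = ∑ i, S i * k i +
      ∑ i, ∑ j, S i * s.transMatrix i.succ j.succ * h j := by
    rw [← Finset.sum_add_distrib]
    refine Finset.sum_congr rfl fun i _ => ?_
    conv_lhs => rw [hh i]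
    rw [mul_add, Finset.mul_sum]
    congr 1
    exact Finset.sum_congr rfl fun j _ => by ring
  have h2 : ∑ j, S j * h j = ∑ j, f j * h j +
      ∑ i, ∑ j, S i * s.transMatrix i.succ j.succ * h j := by
    rw [Finset.sum_comm, ← Finset.sum_add_distrib]
    refine Finset.sum_congr rfl fun j _ => ?_
    conv_lhs => rw [hS j]
    rw [add_mul, Finset.sum_mul]
  linarith

section Totals

variable (s)

/-- The total numbers of visits, weighted by moments, solve linear equations whose inhomogeneous
parts are made of moments of lower order. -/
lemma total_equations (h1 : ∀ i j, s.arr 1 i j ≠ ∞) (h2 : ∀ i j, s.arr 2 i j ≠ ∞) :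
    (∀ j, s.total 1 0 j ≠ ∞ ∧ s.total 1 1 j ≠ ∞ ∧ s.total 1 2 j ≠ ∞ ∧
      s.total (fun c => c + 1) 0 j ≠ ∞ ∧ s.total (fun c => c + 1) 1 j ≠ ∞ ∧
      s.total (fun c => (c + 1) * (c + 2)) 0 j ≠ ∞) ∧
    ∀ j, s.total 1 0 j = s.prefixMoment 0 0 j + ∑ i, s.total 1 0 i * s.arr 0 i.succ j.succ ∧
      s.total 1 1 j = (s.prefixMoment 1 0 j + ∑ i, s.total 1 0 i * s.arr 1 i.succ j.succ) +
        ∑ i, s.total 1 1 i * s.arr 0 i.succ j.succ ∧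
      s.total 1 2 j = (s.prefixMoment 2 0 j + ∑ i, (2 * s.total 1 1 i * s.arr 1 i.succ j.succ +
        s.total 1 0 i * s.arr 2 i.succ j.succ)) + ∑ i, s.total 1 2 i * s.arr 0 i.succ j.succ ∧
      s.total (fun c => c + 1) 0 j = s.total 1 0 j +
        ∑ i, s.total (fun c => c + 1) 0 i * s.arr 0 i.succ j.succ ∧
      s.total (fun c => c + 1) 1 j =
        (s.total 1 1 j + ∑ i, s.total (fun c => c + 1) 0 i * s.arr 1 i.succ j.succ) +
        ∑ i, s.total (fun c => c + 1) 1 i * s.arr 0 i.succ j.succ ∧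
      s.total (fun c => (c + 1) * (c + 2)) 0 j = 2 * s.total (fun c => c + 1) 0 j +
        ∑ i, s.total (fun c => (c + 1) * (c + 2)) 0 i * s.arr 0 i.succ j.succ := by
  have hP : ∀ i j, s.arr 0 i j ≠ ∞ := fun i j => by
    rw [s.arr_zero]; exact (s.P i).apply_ne_top j
  have hinit : ∀ r j, s.arr r 0 (Fin.succ j) ≠ ∞ → s.prefixMoment r 0 j ≠ ∞ := fun r j h => by
    rw [s.prefixMoment_zero]
    exact ENNReal.div_ne_top h s.one_sub_ne_zero
  have hsum : ∀ (T : ℕ → Fin s.M → ℝ≥0∞) (D : Fin (s.M + 1) → Fin (s.M + 1) → ℝ≥0∞) (j : Fin s.M),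
      ∑' c, ∑ i, T c i * D i.succ j.succ = ∑ i, (∑' c, T c i) * D i.succ j.succ := fun T D j => by
    rw [Summable.tsum_finsetSum fun _ _ => ENNReal.summable]
    simp_rw [ENNReal.tsum_mul_right]
  have hfin : ∀ (X : Fin s.M → ℝ≥0∞) (D : Fin (s.M + 1) → Fin (s.M + 1) → ℝ≥0∞) (j : Fin s.M),
      (∀ i, X i ≠ ∞) → (∀ i j, D i j ≠ ∞) → ∑ i, X i * D i.succ j.succ ≠ ∞ := fun X D j hX hD =>
    ENNReal.sum_ne_top.mpr fun i _ => ENNReal.mul_ne_top (hX i) (hD _ _)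
  have tot1 : ∀ r j, s.total 1 r j = ∑' c, s.prefixMoment r c j := fun r j => by simp [total]
  -- visits
  have r0 : ∀ c j, s.prefixMoment 0 (c + 1) j =
      ∑ i, s.prefixMoment 0 c i * s.arr 0 i.succ j.succ + 0 := fun c j => by
    rw [s.prefixMoment_zero_succ, add_zero]
  have e0 : ∀ j, s.total 1 0 j = s.prefixMoment 0 0 j +
      ∑ i, s.total 1 0 i * s.arr 0 i.succ j.succ := fun j => by
    simp only [tot1]
    rw [tsum_recursion (F := fun _ _ => 0) r0]
    simp
  have f0 : ∀ j, s.total 1 0 j ≠ ∞ := fun j => by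
    rw [tot1]
    exact tsum_recursion_ne_top (F := fun _ _ => 0) r0 (fun j => hinit 0 j (hP _ _)) (by simp) j
  -- visits weighted by the number of arrivals
  have F1 : ∀ j : Fin s.M, ∑' c, ∑ i, s.prefixMoment 0 c i * s.arr 1 i.succ j.succ =
      ∑ i, s.total 1 0 i * s.arr 1 i.succ j.succ := fun j => by
    simp only [hsum, tot1]
  have e1 : ∀ j, s.total 1 1 j = (s.prefixMoment 1 0 j +
      ∑ i, s.total 1 0 i * s.arr 1 i.succ j.succ) +
        ∑ i, s.total 1 1 i * s.arr 0 i.succ j.succ := fun j => by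
    rw [← F1]
    simp only [tot1]
    exact tsum_recursion s.prefixMoment_one_succ j
  have f1 : ∀ j, s.total 1 1 j ≠ ∞ := fun j => by
    rw [tot1]
    refine tsum_recursion_ne_top s.prefixMoment_one_succ (fun j => hinit 1 j (h1 _ _))
      (fun j => ?_) j
    rw [F1]
    exact hfin _ _ j f0 h1
  -- visits weighted by the second factorial moment of the number of arrivals
  have F2 : ∀ j : Fin s.M, ∑' c, ∑ i, (2 * s.prefixMoment 1 c i * s.arr 1 i.succ j.succ +
      s.prefixMoment 0 c i * s.arr 2 i.succ j.succ) =
      ∑ i, (2 * s.total 1 1 i * s.arr 1 i.succ j.succ +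
        s.total 1 0 i * s.arr 2 i.succ j.succ) := fun j => by
    simp only [Finset.sum_add_distrib]
    rw [ENNReal.tsum_add, hsum (fun c i => 2 * s.prefixMoment 1 c i), hsum]
    simp only [tot1, ENNReal.tsum_mul_left]
  have e2 : ∀ j, s.total 1 2 j = (s.prefixMoment 2 0 j +
      ∑ i, (2 * s.total 1 1 i * s.arr 1 i.succ j.succ +
        s.total 1 0 i * s.arr 2 i.succ j.succ)) +
        ∑ i, s.total 1 2 i * s.arr 0 i.succ j.succ := fun j => by
    rw [← F2, tot1]
    simp only [tot1 2]
    exact tsum_recursion s.prefixMoment_two_succ j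
  have f2 : ∀ j, s.total 1 2 j ≠ ∞ := fun j => by
    rw [tot1]
    refine tsum_recursion_ne_top s.prefixMoment_two_succ (fun j => hinit 2 j (h2 _ _))
      (fun j => ?_) j
    rw [F2]
    simp only [Finset.sum_add_distrib]
    exact ENNReal.add_ne_top.mpr ⟨hfin (fun i => 2 * s.total 1 1 i) _ j
      (fun i => ENNReal.mul_ne_top (by simp) (f1 i)) h1, hfin _ _ j f0 h2⟩
  -- visits weighted by the elapsed time
  have rC : ∀ c j, ((c + 1 : ℕ) + 1 : ℝ≥0∞) * s.prefixMoment 0 (c + 1) j =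
      ∑ i, (((c : ℕ) + 1 : ℝ≥0∞) * s.prefixMoment 0 c i) * s.arr 0 i.succ j.succ +
        s.prefixMoment 0 (c + 1) j := fun c j => by
    simp only [mul_assoc, ← Finset.mul_sum]
    rw [← s.prefixMoment_zero_succ]
    push_cast
    ring
  have FC : ∀ j, s.prefixMoment 0 0 j + ∑' c, s.prefixMoment 0 (c + 1) j = s.total 1 0 j :=
    fun j => by rw [tot1, tsum_eq_zero_add' (f := fun c => s.prefixMoment 0 c j) ENNReal.summable]
  have eC : ∀ j, s.total (fun c => c + 1) 0 j = s.total 1 0 j +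
      ∑ i, s.total (fun c => c + 1) 0 i * s.arr 0 i.succ j.succ := fun j => by
    rw [← FC]
    simpa [total] using tsum_recursion (T := fun c j => ((c : ℕ) + 1 : ℝ≥0∞) * s.prefixMoment 0 c j)
      rC j
  have fC : ∀ j, s.total (fun c => c + 1) 0 j ≠ ∞ := fun j => by
    refine tsum_recursion_ne_top (T := fun c j => ((c : ℕ) + 1 : ℝ≥0∞) * s.prefixMoment 0 c j)
      rC (fun j => by simpa using hinit 0 j (hP _ _)) (fun j => ?_) j
    exact ne_top_of_le_ne_top (f0 j) (by rw [← FC]; exact le_add_self)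
  -- visits weighted by the elapsed time and the number of arrivals
  have rCL : ∀ c j, ((c + 1 : ℕ) + 1 : ℝ≥0∞) * s.prefixMoment 1 (c + 1) j =
      ∑ i, (((c : ℕ) + 1 : ℝ≥0∞) * s.prefixMoment 1 c i) * s.arr 0 i.succ j.succ +
        (s.prefixMoment 1 (c + 1) j +
          ∑ i, (((c : ℕ) + 1 : ℝ≥0∞) * s.prefixMoment 0 c i) * s.arr 1 i.succ j.succ) :=
    fun c j => by
      simp only [mul_assoc, ← Finset.mul_sum]
      rw [s.prefixMoment_one_succ]
      push_cast
      ring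
  have FCL : ∀ j, s.prefixMoment 1 0 j + ∑' c : ℕ, (s.prefixMoment 1 (c + 1) j +
      ∑ i, (((c : ℕ) + 1 : ℝ≥0∞) * s.prefixMoment 0 c i) * s.arr 1 i.succ j.succ) =
      s.total 1 1 j + ∑ i, s.total (fun c => c + 1) 0 i * s.arr 1 i.succ j.succ := fun j => by
    rw [ENNReal.tsum_add, hsum (fun c i => ((c : ℕ) + 1 : ℝ≥0∞) * s.prefixMoment 0 c i),
      ← add_assoc, tot1, tsum_eq_zero_add' (f := fun c => s.prefixMoment 1 c j) ENNReal.summable]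
    rfl
  have eCL : ∀ j, s.total (fun c => c + 1) 1 j =
      (s.total 1 1 j + ∑ i, s.total (fun c => c + 1) 0 i * s.arr 1 i.succ j.succ) +
        ∑ i, s.total (fun c => c + 1) 1 i * s.arr 0 i.succ j.succ := fun j => by
    rw [← FCL]
    have := tsum_recursion (T := fun c j => ((c : ℕ) + 1 : ℝ≥0∞) * s.prefixMoment 1 c j) rCL j
    simp only [Nat.cast_zero, zero_add, one_mul] at this
    exact this
  have fCL : ∀ j, s.total (fun c => c + 1) 1 j ≠ ∞ := fun j => by
    refine tsum_recursion_ne_top (T := fun c j => ((c : ℕ) + 1 : ℝ≥0∞) * s.prefixMoment 1 c j)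
      rCL (fun j => by simpa using hinit 1 j (h1 _ _)) (fun j => ?_) j
    refine ne_top_of_le_ne_top (ENNReal.add_ne_top.mpr ⟨f1 j, hfin _ _ j fC h1⟩)
      (le_trans le_add_self (FCL j).le)
  -- visits weighted by the second moment of the elapsed time
  have rCC : ∀ c j, (((c + 1 : ℕ) + 1) * ((c + 1 : ℕ) + 2) : ℝ≥0∞) * s.prefixMoment 0 (c + 1) j =
      ∑ i, ((((c : ℕ) + 1) * ((c : ℕ) + 2) : ℝ≥0∞) * s.prefixMoment 0 c i) *
        s.arr 0 i.succ j.succ + 2 * (((c + 1 : ℕ) + 1 : ℝ≥0∞) * s.prefixMoment 0 (c + 1) j) :=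
    fun c j => by
      simp only [mul_assoc, ← Finset.mul_sum]
      rw [← s.prefixMoment_zero_succ]
      push_cast
      ring
  have FCC : ∀ j, 2 * s.prefixMoment 0 0 j +
      ∑' c : ℕ, 2 * (((c + 1 : ℕ) + 1 : ℝ≥0∞) * s.prefixMoment 0 (c + 1) j) =
      2 * s.total (fun c => c + 1) 0 j := fun j => by
    rw [ENNReal.tsum_mul_left, ← mul_add, total, tsum_eq_zero_add'
      (f := fun c : ℕ => ((c : ℕ) + 1 : ℝ≥0∞) * s.prefixMoment 0 c j) ENNReal.summable]
    simp
  have eCC : ∀ j, s.total (fun c => (c + 1) * (c + 2)) 0 j = 2 * s.total (fun c => c + 1) 0 j +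
      ∑ i, s.total (fun c => (c + 1) * (c + 2)) 0 i * s.arr 0 i.succ j.succ := fun j => by
    rw [← FCC]
    have := tsum_recursion (T := fun c j => (((c : ℕ) + 1) * ((c : ℕ) + 2) : ℝ≥0∞) *
      s.prefixMoment 0 c j) rCC j
    simp only [Nat.cast_zero, zero_add, one_mul] at this
    exact this
  have fCC : ∀ j, s.total (fun c => (c + 1) * (c + 2)) 0 j ≠ ∞ := fun j => by
    refine tsum_recursion_ne_top (T := fun c j => (((c : ℕ) + 1) * ((c : ℕ) + 2) : ℝ≥0∞) *
      s.prefixMoment 0 c j) rCC (fun j => ?_) (fun j => ?_) j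
    · simpa using ENNReal.mul_ne_top ENNReal.ofNat_ne_top (hinit 0 j (hP _ _))
    · exact ne_top_of_le_ne_top (ENNReal.mul_ne_top ENNReal.ofNat_ne_top (fC j))
        (le_trans le_add_self (FCC j).le)
  exact ⟨fun j => ⟨f0 j, f1 j, f2 j, fC j, fCL j, fCC j⟩,
    fun j => ⟨e0 j, e1 j, e2 j, eC j, eCL j, eCC j⟩⟩

end Totals

/-! ### The second derivative of the eigenvalue -/

variable {s : ArrivalStream} {π : PMF (Fin (s.M + 1))}

/-- The second derivative of a smooth continuation of the eigenvalue. Pairing the equations for the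
totals over an active period with the once and twice differentiated eigenvalue equation eliminates
the derivatives of the eigenvector. -/
theorem iteratedDeriv_two_eq_delta2 (hπ : π.bind s.P = π) (h1 : ∀ i j, s.arr 1 i j ≠ ∞)
    (h2 : ∀ i j, s.arr 2 i j ≠ ∞) {x : ℝ → ℝ} {u : ℝ → Fin (s.M + 1) → ℝ}
    {G : ℝ → Matrix (Fin (s.M + 1)) (Fin (s.M + 1)) ℝ} (hx : ContDiffAt ℝ 2 x 1)
    (hu : ∀ i, ContDiffAt ℝ 2 (fun w => u w i) 1) (hx1 : x 1 = 1) (hu1 : u 1 = 1)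
    (hu0 : ∀ w, u w 0 = 1) (hG : ∀ i j, ContDiffAt ℝ 2 (fun w => G w i j) 1)
    (hG1 : G 1 = s.transMatrix)
    (hE : ∀ᶠ w in 𝓝 (1 : ℝ), ∀ i, ∑ j, G w i j * u w j = x w * u w i)
    (hGd : ∀ k ≤ 2, ∀ i j, iteratedDeriv k (fun w => G w i j) 1 = (s.arr k i j).toReal)
    (hlam : deriv x 1 = (s.rate π).toReal) :
    iteratedDeriv 2 x 1 = s.delta2 π := by
  have hP : ∀ i j, (s.arr 0 i j).toReal = s.transMatrix i j := fun i j => by rw [s.arr_zero]; rfl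
  have hP' : ∀ i j, s.arr 0 i j ≠ ∞ := fun i j => by
    rw [s.arr_zero]; exact (s.P i).apply_ne_top j
  obtain ⟨hfin, heqs⟩ := s.total_equations h1 h2
  -- passage to real numbers
  set n0 : Fin s.M → ℝ := fun j => (s.total 1 0 j).toReal with hn0
  set nL : Fin s.M → ℝ := fun j => (s.total 1 1 j).toReal with hnL
  set nLL : Fin s.M → ℝ := fun j => (s.total 1 2 j).toReal with hnLL
  set nC : Fin s.M → ℝ := fun j => (s.total (fun c => c + 1) 0 j).toReal with hnC
  set nCL : Fin s.M → ℝ := fun j => (s.total (fun c => c + 1) 1 j).toReal with hnCL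
  set nCC : Fin s.M → ℝ := fun j => (s.total (fun c => (c + 1) * (c + 2)) 0 j).toReal with hnCC
  set q : ℝ := 1 - s.transMatrix 0 0 with hq
  have hq0 : 0 < q := sub_pos.mpr s.prob_zero_zero_lt_one
  have hinit : ∀ k j, (s.prefixMoment k 0 j).toReal = (s.arr k 0 (Fin.succ j)).toReal / q :=
    fun k j => by rw [s.prefixMoment_zero, ENNReal.toReal_div, s.one_sub_toReal]
  have hinitfin : ∀ k j, s.arr k 0 (Fin.succ j) ≠ ∞ → s.prefixMoment k 0 j ≠ ∞ := fun k j h => by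
    rw [s.prefixMoment_zero]
    exact ENNReal.div_ne_top h s.one_sub_ne_zero
  have hsumR : ∀ (X : Fin s.M → ℝ≥0∞) (D : Fin (s.M + 1) → Fin (s.M + 1) → ℝ≥0∞) (j : Fin s.M),
      (∀ i, X i ≠ ∞) → (∀ i j, D i j ≠ ∞) → ∑ i, X i * D i.succ j.succ ≠ ∞ ∧
      (∑ i, X i * D i.succ j.succ).toReal = ∑ i, (X i).toReal * (D i.succ j.succ).toReal :=
    fun X D j hX hD => by
      have h : ∀ i ∈ Finset.univ, X i * D i.succ j.succ ≠ ∞ := fun i _ =>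
        ENNReal.mul_ne_top (hX i) (hD _ _)
      refine ⟨ENNReal.sum_ne_top.mpr h, ?_⟩
      rw [ENNReal.toReal_sum h]
      exact Finset.sum_congr rfl fun i _ => ENNReal.toReal_mul
  have f0 := fun j => (hfin j).1
  have f1 := fun j => (hfin j).2.1
  have f2 := fun j => (hfin j).2.2.1
  have fC := fun j => (hfin j).2.2.2.1
  have fCL := fun j => (hfin j).2.2.2.2.1
  have fCC := fun j => (hfin j).2.2.2.2.2
  set d1 : Fin (s.M + 1) → Fin (s.M + 1) → ℝ := fun i j => (s.arr 1 i j).toReal with hd1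
  set d2 : Fin (s.M + 1) → Fin (s.M + 1) → ℝ := fun i j => (s.arr 2 i j).toReal with hd2
  have E0 : ∀ j, n0 j = s.transMatrix 0 j.succ / q + ∑ i, n0 i * s.transMatrix i.succ j.succ := by
    intro j
    have h := hsumR _ _ j f0 hP'
    simp only [hn0]
    rw [(heqs j).1, ENNReal.toReal_add (hinitfin 0 j (hP' _ _)) h.1, h.2, hinit, hP]
    simp only [hP]
  have EL : ∀ j, nL j = (d1 0 j.succ / q + ∑ i, n0 i * d1 i.succ j.succ) +
      ∑ i, nL i * s.transMatrix i.succ j.succ := by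
    intro j
    have h := hsumR _ _ j f1 hP'
    have h' := hsumR _ _ j f0 h1
    have h'' := hinitfin 1 j (h1 _ _)
    simp only [hnL]
    rw [(heqs j).2.1, ENNReal.toReal_add (ENNReal.add_ne_top.mpr ⟨h'', h'.1⟩) h.1,
      ENNReal.toReal_add h'' h'.1, h.2, h'.2, hinit]
    simp only [hP, hd1, hn0]
  have ELL : ∀ j, nLL j = (d2 0 j.succ / q + (2 * ∑ i, nL i * d1 i.succ j.succ +
      ∑ i, n0 i * d2 i.succ j.succ)) + ∑ i, nLL i * s.transMatrix i.succ j.succ := by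
    intro j
    have h := hsumR _ _ j f2 hP'
    have h' := hsumR (fun i => 2 * s.total 1 1 i) _ j
      (fun i => ENNReal.mul_ne_top ENNReal.ofNat_ne_top (f1 i)) h1
    have h3 := hsumR _ _ j f0 h2
    have h'' := hinitfin 2 j (h2 _ _)
    simp only [hnLL]
    rw [(heqs j).2.2.1, Finset.sum_add_distrib, ENNReal.toReal_add (ENNReal.add_ne_top.mpr
      ⟨h'', ENNReal.add_ne_top.mpr ⟨h'.1, h3.1⟩⟩) h.1,
      ENNReal.toReal_add h'' (ENNReal.add_ne_top.mpr ⟨h'.1, h3.1⟩),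
      ENNReal.toReal_add h'.1 h3.1, h.2, h'.2, h3.2, hinit]
    simp only [hP, hd1, hd2, hn0, hnL, ENNReal.toReal_mul, ENNReal.toReal_ofNat, Finset.mul_sum,
      mul_assoc]
  have EC : ∀ j, nC j = n0 j + ∑ i, nC i * s.transMatrix i.succ j.succ := by
    intro j
    have h := hsumR _ _ j fC hP'
    simp only [hnC]
    rw [(heqs j).2.2.2.1, ENNReal.toReal_add (f0 j) h.1, h.2]
    simp only [hP, hn0]
  have ECL : ∀ j, nCL j = (nL j + ∑ i, nC i * d1 i.succ j.succ) +
      ∑ i, nCL i * s.transMatrix i.succ j.succ := by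
    intro j
    have h := hsumR _ _ j fCL hP'
    have h' := hsumR _ _ j fC h1
    simp only [hnCL]
    rw [(heqs j).2.2.2.2.1, ENNReal.toReal_add (ENNReal.add_ne_top.mpr ⟨f1 j, h'.1⟩) h.1,
      ENNReal.toReal_add (f1 j) h'.1, h.2, h'.2]
    simp only [hP, hd1, hnL, hnC]
  have ECC : ∀ j, nCC j = 2 * nC j + ∑ i, nCC i * s.transMatrix i.succ j.succ := by
    intro j
    have h := hsumR _ _ j fCC hP'
    simp only [hnCC]
    rw [(heqs j).2.2.2.2.2, ENNReal.toReal_add (ENNReal.mul_ne_top ENNReal.ofNat_ne_top (fC j)) h.1,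
      h.2, ENNReal.toReal_mul, ENNReal.toReal_ofNat]
    simp only [hP, hnC]
  -- the moments of the active period
  have hone : ∀ i : Fin s.M, (1 : ℝ) = s.transMatrix i.succ 0 +
      ∑ j : Fin s.M, s.transMatrix i.succ j.succ * 1 := fun i => by
    have := s.sum_transMatrix i.succ
    rw [Fin.sum_univ_succ] at this
    simp only [mul_one]
    linarith
  have hclose : ∀ X : Fin s.M → ℝ≥0∞, (∀ j, X j ≠ ∞) →
      (∑ j, X j * s.P j.succ 0).toReal = ∑ j, (X j).toReal * s.transMatrix j.succ 0 := by
    intro X hX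
    rw [ENNReal.toReal_sum fun j _ => ENNReal.mul_ne_top (hX j) ((s.P _).apply_ne_top _)]
    exact Finset.sum_congr rfl fun i _ => ENNReal.toReal_mul
  have mC : (mean s.lengthLaw).toReal = ∑ j, n0 j := by
    have h := s.tsum_lengthLaw fun c => c
    simp only [Nat.cast_add, Nat.cast_one] at h
    rw [mean, h, hclose _ fC, pairing EC hone]
    simp
  have mL : (mean s.batchLaw).toReal =
      ∑ j : Fin s.M, (d1 0 j.succ / q + ∑ i, n0 i * d1 i.succ j.succ) := by
    have h := s.tsum_batchLaw 1
    simp only [Nat.descFactorial_one] at h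
    rw [mean, h, hclose _ f1, pairing EL hone]
    simp
  have mLL : (∑' m : ℕ, (m.descFactorial 2 : ℝ≥0∞) * s.batchLaw m).toReal =
      ∑ j : Fin s.M, (d2 0 j.succ / q + (2 * ∑ i, nL i * d1 i.succ j.succ +
      ∑ i, n0 i * d2 i.succ j.succ)) := by
    rw [s.tsum_batchLaw 2, hclose _ f2, pairing ELL hone]
    simp
  have mCL : s.meanLengthBatch.toReal = ∑ j : Fin s.M, (nL j + ∑ i, nC i * d1 i.succ j.succ) := by
    have h := s.tsum_activeLaw (fun c => c) 1
    simp only [Nat.cast_add, Nat.cast_one, Nat.descFactorial_one] at h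
    simp only [meanLengthBatch, mul_assoc]
    rw [h, hclose _ fCL, pairing ECL hone]
    simp
  have mCC : (∑' c : ℕ, (c.descFactorial 2 : ℝ≥0∞) * s.lengthLaw c).toReal +
      2 * (mean s.lengthLaw).toReal = 2 * ∑ j, nC j := by
    have h := s.tsum_lengthLaw fun c => c.descFactorial 2 + 2 * c
    have h' : ∀ c : ℕ, (((c + 1).descFactorial 2 : ℕ) + 2 * ((c + 1 : ℕ) : ℝ≥0∞) : ℝ≥0∞) =
        (c + 1) * (c + 2) := fun c => by
      simp only [Nat.descFactorial_succ, Nat.descFactorial_zero, Nat.add_sub_cancel, Nat.sub_zero]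
      push_cast
      ring
    simp only [h'] at h
    have hsplit : ∑' c : ℕ, ((c.descFactorial 2 : ℝ≥0∞) + 2 * c) * s.lengthLaw c =
        ∑' c : ℕ, (c.descFactorial 2 : ℝ≥0∞) * s.lengthLaw c + 2 * mean s.lengthLaw := by
      simp only [add_mul, mul_assoc]
      rw [ENNReal.tsum_add, ENNReal.tsum_mul_left, mean]
    rw [hsplit] at h
    have hne : ∑ j, s.total (fun c => (c + 1) * (c + 2)) 0 j * s.P j.succ 0 ≠ ∞ :=
      ENNReal.sum_ne_top.mpr fun j _ => ENNReal.mul_ne_top (fCC j) ((s.P _).apply_ne_top _)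
    have h3 := hclose _ fCC
    rw [pairing ECC hone] at h3
    rw [← h] at h3 hne
    rw [ENNReal.toReal_add (ENNReal.add_ne_top.mp hne).1 (ENNReal.add_ne_top.mp hne).2,
      ENNReal.toReal_mul, ENNReal.toReal_ofNat] at h3
    rw [h3, Finset.mul_sum]
    simp
  -- the differentiated eigenvalue equation
  set lam : ℝ := (s.rate π).toReal with hlamdef
  set X : ℝ := iteratedDeriv 2 x 1 with hX
  set u1 : Fin s.M → ℝ := fun i => deriv (fun w => u w i.succ) 1 with hu1d
  set u2 : Fin s.M → ℝ := fun i => iteratedDeriv 2 (fun w => u w i.succ) 1 with hu2d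
  have hu0fun : (fun w => u w 0) = fun _ => (1 : ℝ) := funext hu0
  have hu01 : deriv (fun w => u w 0) 1 = 0 := by rw [hu0fun]; simp
  have hu02 : iteratedDeriv 2 (fun w => u w 0) 1 = 0 := by
    rw [hu0fun, iteratedDeriv_const]; simp
  have hG1' : ∀ i j, deriv (fun w => G w i j) 1 = d1 i j := fun i j => by
    rw [← iteratedDeriv_one, hGd 1 (by norm_num)]
  have hG2' : ∀ i j, iteratedDeriv 2 (fun w => G w i j) 1 = d2 i j := fun i j => hGd 2 le_rfl i j
  have hd10 : ∀ i, d1 i 0 = 0 := fun i => by simp [hd1, s.arr_idle]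
  have hd20 : ∀ i, d2 i 0 = 0 := fun i => by simp [hd2, s.arr_idle]
  have D1 := eigen_curve_deriv (fun i j => (hG i j).of_le one_le_two) hG1
    (hx.of_le one_le_two) (fun i => (hu i).of_le one_le_two) hx1 hu1 hE
  have D2 := eigen_curve_deriv_two hG hG1 hx hu hx1 hu1 hE
  simp only [hlam, hG1', Fin.sum_univ_succ, hd10, hu01, mul_zero, add_zero, zero_add] at D1
  simp only [hlam, hG1', hG2', Fin.sum_univ_succ, hd10, hd20, hu01, hu02, mul_zero,
    add_zero, zero_add] at D2
  have D1z : lam = ∑ j, (d1 0 (Fin.succ j) + s.transMatrix 0 j.succ * u1 j) := by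
    have := D1 0
    rwa [hu01, add_zero] at this
  have D2z : X = ∑ j, (d2 0 (Fin.succ j) + 2 * d1 0 j.succ * u1 j +
      s.transMatrix 0 j.succ * u2 j) := by
    have := D2 0
    rwa [hu01, hu02, mul_zero, add_zero, add_zero] at this
  have D1s : ∀ i : Fin s.M, u1 i = (∑ j, d1 i.succ (Fin.succ j) - lam) +
      ∑ j, s.transMatrix i.succ j.succ * u1 j := fun i => by
    have : lam + u1 i = _ := D1 i.succ
    rw [Finset.sum_add_distrib] at this
    linarith
  have D2s : ∀ i : Fin s.M, u2 i = (∑ j, d2 i.succ (Fin.succ j) +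
      2 * ∑ j, d1 i.succ (Fin.succ j) * u1 j - X - 2 * lam * u1 i) +
      ∑ j, s.transMatrix i.succ j.succ * u2 j := fun i => by
    have : X + 2 * lam * u1 i + u2 i = _ := D2 i.succ
    simp only [Finset.sum_add_distrib, mul_assoc, ← Finset.mul_sum] at this
    linarith
  have p1 := pairing E0 D2s
  have p2 := pairing EL D1s
  have p3 := pairing EC D1s
  obtain ⟨h, hh⟩ := s.exists_resolvent fun _ => 1
  obtain ⟨g, hg⟩ := s.exists_resolvent fun i => ∑ j, d1 i.succ (Fin.succ j)
  -- the stationary distribution on the active states is proportional to the number of visits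
  have EP : ∀ j : Fin s.M, (π j.succ).toReal = (π 0).toReal * s.transMatrix 0 j.succ +
      ∑ i : Fin s.M, (π i.succ).toReal * s.transMatrix i.succ j.succ := fun j => by
    rw [← sum_stationary hπ j.succ, Fin.sum_univ_succ]
  have q1 := pairing E0 hh
  have q2 := pairing (S := fun j => (π (Fin.succ j)).toReal) EP hh
  have q3 := pairing E0 hg
  have q4 := pairing (S := fun j => (π (Fin.succ j)).toReal) EP hg
  have hon : (s.probOn π).toReal = ∑ j : Fin s.M, (π j.succ).toReal := by
    rw [probOn, ENNReal.toReal_sum fun j _ => π.apply_ne_top _]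
  have hlam2 : lam = (π 0).toReal * ∑ j, d1 0 (Fin.succ j) +
      ∑ i : Fin s.M, (π i.succ).toReal * ∑ j, d1 i.succ (Fin.succ j) := by
    rw [hlamdef, rate_toReal h1, Fin.sum_univ_succ]
    simp only [← Finset.mul_sum]
    simp only [Fin.sum_univ_succ (fun j => (s.arr 1 _ j).toReal), s.arr_idle one_ne_zero,
      ENNReal.toReal_zero, zero_add, hd1]
  have hswap : ∀ (Y : Fin s.M → ℝ) (D : Fin (s.M + 1) → Fin (s.M + 1) → ℝ),
      ∑ j : Fin s.M, ∑ i : Fin s.M, Y i * D i.succ j.succ =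
        ∑ i : Fin s.M, Y i * ∑ j : Fin s.M, D i.succ j.succ := fun Y D => by
    rw [Finset.sum_comm]
    simp only [Finset.mul_sum]
  have hW : ∑ j : Fin s.M, (∑ i : Fin s.M, n0 i * d1 i.succ j.succ) * u1 j =
      ∑ i : Fin s.M, n0 i * ∑ j : Fin s.M, d1 i.succ j.succ * u1 j := by
    simp only [Finset.sum_mul, Finset.mul_sum]
    rw [Finset.sum_comm]
    exact Finset.sum_congr rfl fun i _ => Finset.sum_congr rfl fun j _ => by ring
  have hdiv : ∀ Y Z : Fin s.M → ℝ, ∑ j, Y j / q * Z j = (∑ j, Y j * Z j) / q := fun Y Z => by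
    rw [Finset.sum_div]
    exact Finset.sum_congr rfl fun j _ => by ring
  have hcomm : ∀ (c : ℝ) (Y Z : Fin s.M → ℝ), ∑ j, Y j * (c * Z j) = c * ∑ j, Y j * Z j :=
    fun c Y Z => by
      rw [Finset.mul_sum]
      exact Finset.sum_congr rfl fun j _ => by ring
  simp only [mul_one, Finset.sum_add_distrib, Finset.sum_sub_distrib, mul_add, mul_sub, add_mul,
    mul_assoc, hW, hdiv, hcomm, hswap, ← Finset.sum_div, ← Finset.sum_mul,
    ← Finset.mul_sum] at mC mL mLL mCL mCC D1z D2z p1 p2 p3 q1 q2 q3 q4 hon hlam2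
  -- elimination of the auxiliary quantities
  set EL := (mean s.batchLaw).toReal
  set EC := (mean s.lengthLaw).toReal
  set EΛΛ := (∑' m : ℕ, (m.descFactorial 2 : ℝ≥0∞) * s.batchLaw m).toReal
  set ECΛ := s.meanLengthBatch.toReal
  set ECC' := (∑' c : ℕ, (c.descFactorial 2 : ℝ≥0∞) * s.lengthLaw c).toReal
  set p0 := (π 0).toReal
  have hon0 : (s.probOn π).toReal = 1 - p0 := probOn_toReal
  have hlam_pos : 0 < lam := by
    refine ENNReal.toReal_pos (rate_ne_zero hπ) fun htop => ?_
    rw [rate_eq] at htop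
    refine ENNReal.sum_ne_top.mpr (fun i _ => ENNReal.sum_ne_top.mpr fun j _ => ?_) htop
    exact ENNReal.mul_ne_top (π.apply_ne_top i) (h1 i j)
  have hlamEL : lam = p0 * q * EL := by
    rw [hlam2, q4, mL, q3]
    field_simp
  have honEC : (s.probOn π).toReal = p0 * q * EC := by
    rw [hon, q2, mC, q1]
    field_simp
  have hcycle : p0 * (1 + q * EC) = 1 := by linear_combination hon0 - honEC
  have hXeq : X * (1 + q * EC) = q * (EΛΛ - 2 * lam * ECΛ + lam ^ 2 * (ECC' + 2 * EC)) := by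
    rw [eq_div_iff hq0.ne'] at p1
    rw [div_add' _ _ _ hq0.ne', eq_div_iff hq0.ne'] at p2
    rw [div_add' _ _ _ hq0.ne', eq_div_iff hq0.ne'] at mLL
    rw [mCC, mCL, mC]
    linear_combination D2z - p1 - 2 * p2 - mLL + 2 * q * lam * p3
  have hEL : EL ≠ 0 := fun h0 => by rw [h0, mul_zero] at hlamEL; exact hlam_pos.ne' hlamEL
  have hEC : EC ≠ 0 := fun h0 => by
    rw [h0, mul_zero] at honEC; exact (probOn_pos hπ).ne' honEC
  have hXp : X = p0 * q * (EΛΛ - 2 * lam * ECΛ + lam ^ 2 * (ECC' + 2 * EC)) := by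
    linear_combination p0 * hXeq - X * hcycle
  have t1 : lam * (EΛΛ / 2 / EL) = p0 * q * EΛΛ / 2 := by
    rw [hlamEL]; field_simp
  have t2 : (s.probOn π).toReal * (ECΛ / EC) = p0 * q * ECΛ := by
    rw [honEC]; field_simp
  have t3 : (s.probOn π).toReal * (1 + ECC' / 2 / EC) = p0 * q * (EC + ECC' / 2) := by
    rw [honEC]; field_simp
  rw [delta2, equilibriumMean_toReal, equilibriumMean_toReal]
  linear_combination hXp - 2 * t1 + 2 * lam * t2 - 2 * lam ^ 2 * t3

end ArrivalStream

/-! ### Expectations over one slot -/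

lemma tsum_pi_prod {n : ℕ} {α : Fin n → Type*} (g : ∀ i, α i → ℝ≥0∞) :
    ∑' f : ∀ i, α i, ∏ i, g i (f i) = ∏ i, ∑' a, g i a := by
  induction n with
  | zero => simp
  | succ n ih =>
    rw [← (Fin.consEquiv α).tsum_eq, ENNReal.tsum_prod', Fin.prod_univ_succ, ← ih,
      ← ENNReal.tsum_mul_right]
    refine tsum_congr fun a => ?_
    rw [← ENNReal.tsum_mul_left]
    refine tsum_congr fun f => ?_
    simp [Fin.prod_univ_succ, Fin.consEquiv]

lemma prod_Icc_one {β : Type*} [CommMonoid β] (f : ℕ → β) (n : ℕ) :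
    ∏ l ∈ Finset.Icc 1 n, f l = ∏ l : Fin n, f (l + 1) := by
  induction n with
  | zero => simp
  | succ n ih => rw [Finset.prod_Icc_succ_top (by omega), Fin.prod_univ_castSucc, ih]; simp

/-- No measurable structure on the countable type is needed. -/
lemma lintegral_comp_countable {Ω β : Type*} [MeasurableSpace Ω] {μ : Measure Ω} [Countable β]
    {Y : Ω → β} (hY : ∀ y, MeasurableSet (Y ⁻¹' {y})) (f : β → ℝ≥0∞) :
    ∫⁻ ω, f (Y ω) ∂μ = ∑' y, f y * μ (Y ⁻¹' {y}) := by
  let _ : MeasurableSpace β := ⊤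
  have hYm : Measurable Y := measurable_to_countable' hY
  rw [← lintegral_map (f := f) measurable_from_top hYm, lintegral_countable']
  refine tsum_congr fun y => ?_
  rw [Measure.map_apply hYm trivial]

section Queue

variable {K : ℕ} {Ω : Type*} {stream : Fin K → ArrivalStream}

/-- The two outcomes agree in everything that has happened up to slot `n`. -/
def SameHistory (X₀ : Ω → ℕ) (S : (k : Fin K) → ℕ → Ω → Fin ((stream k).M + 1))
    (A : Fin K → ℕ → Ω → ℕ) (H : Fin K → ℕ → ℕ → Ω → ℕ) (n : ℕ) (ω ω' : Ω) : Prop :=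
  X₀ ω = X₀ ω' ∧ (∀ k, ∀ t ≤ n, S k t ω = S k t ω') ∧
    (∀ k, ∀ t ∈ Finset.Icc 1 n, A k t ω = A k t ω') ∧
    ∀ k, ∀ t ∈ Finset.Icc 1 n, ∀ l ∈ Finset.Icc 1 (A k t ω), H k t l ω = H k t l ω'

/-- The values up to slot `n` of the chains, of the numbers of arrivals and of the first `L` service
times in each slot. -/
def history (X₀ : Ω → ℕ) (S : (k : Fin K) → ℕ → Ω → Fin ((stream k).M + 1))
    (A : Fin K → ℕ → Ω → ℕ) (H : Fin K → ℕ → ℕ → Ω → ℕ) (n L : ℕ) (ω : Ω) :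
    ℕ × ((k : Fin K) → Fin (n + 1) → Fin ((stream k).M + 1)) × (Fin K → Fin n → ℕ) ×
      (Fin K → Fin n → Fin L → ℕ) :=
  (X₀ ω, fun k t => S k t ω, fun k t => A k (t + 1) ω, fun k t l => H k (t + 1) (l + 1) ω)

/-- The state, the number of arrivals and the first `L` service times of each class in slot `n`. -/
def slot (S : (k : Fin K) → ℕ → Ω → Fin ((stream k).M + 1))
    (A : Fin K → ℕ → Ω → ℕ) (H : Fin K → ℕ → ℕ → Ω → ℕ) (n L : ℕ) (ω : Ω) :
    (k : Fin K) → Fin ((stream k).M + 1) × ℕ × (Fin L → ℕ) :=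
  fun k => (S k n ω, A k n ω, fun l => H k n (l + 1) ω)

/-- The conditional mass function, given the state `i` of the chain in the preceding slot, of the
data of one class in a slot. -/
noncomputable def slotMass (s : ArrivalStream) (L : ℕ) (i : Fin (s.M + 1))
    (e : Fin (s.M + 1) × ℕ × (Fin L → ℕ)) : ℝ≥0∞ :=
  s.P i e.1 * s.a i e.1 e.2.1 * ∏ l, s.h (e.2.2 l)

variable {X₀ : Ω → ℕ} {S : (k : Fin K) → ℕ → Ω → Fin ((stream k).M + 1)}
  {A : Fin K → ℕ → Ω → ℕ} {H : Fin K → ℕ → ℕ → Ω → ℕ}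

lemma history_eq_iff {n L : ℕ} {ω ω' : Ω} :
    history X₀ S A H n L ω = history X₀ S A H n L ω' ↔
      X₀ ω = X₀ ω' ∧ (∀ k, ∀ t ∈ Finset.range (n + 1), S k t ω = S k t ω') ∧
      (∀ k, ∀ t ∈ Finset.Icc 1 n, A k t ω = A k t ω') ∧
      ∀ k, ∀ t ∈ Finset.Icc 1 n, ∀ l ∈ Finset.Icc 1 L, H k t l ω = H k t l ω' := by
  simp only [history, Prod.mk.injEq, funext_iff]
  refine and_congr_right fun _ => and_congr ?_ (and_congr ?_ ?_)
  · exact forall_congr' fun k => ⟨fun h t ht => h ⟨t, Finset.mem_range.mp ht⟩,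
      fun h t => h t (Finset.mem_range.mpr t.2)⟩
  · refine forall_congr' fun k => ⟨fun h t ht => ?_, fun h t => h _ (by simp)⟩
    obtain ⟨h1, h2⟩ := Finset.mem_Icc.mp ht
    have := h ⟨t - 1, by omega⟩
    rwa [Nat.sub_add_cancel h1] at this
  · refine forall_congr' fun k => ⟨fun h t ht l hl => ?_,
      fun h t l => h _ (by simp) _ (by simp)⟩
    obtain ⟨h1, h2⟩ := Finset.mem_Icc.mp ht
    obtain ⟨h3, h4⟩ := Finset.mem_Icc.mp hl
    have := h ⟨t - 1, by omega⟩ ⟨l - 1, by omega⟩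
    rwa [Nat.sub_add_cancel h1, Nat.sub_add_cancel h3] at this

variable [MeasurableSpace Ω] {μ : Measure Ω}

lemma IsQueue.measurableSet_history (hQ : IsQueue stream μ X₀ S A H) (n L : ℕ) (η) :
    MeasurableSet (history X₀ S A H n L ⁻¹' {η}) := by
  have h1 := hQ.measurable_X₀
  have h2 := hQ.measurable_S
  have h3 := hQ.measurable_A
  have h4 := hQ.measurable_H
  have : Measurable (history X₀ S A H n L) := by
    unfold history
    refine h1.prodMk (Measurable.prodMk ?_ (Measurable.prodMk ?_ ?_))
    · exact measurable_pi_lambda _ fun k => measurable_pi_lambda _ fun t => h2 k t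
    · exact measurable_pi_lambda _ fun k => measurable_pi_lambda _ fun t => h3 k _
    · exact measurable_pi_lambda _ fun k => measurable_pi_lambda _ fun t =>
        measurable_pi_lambda _ fun l => h4 k _ _
  exact this (measurableSet_singleton η)

lemma IsQueue.measurableSet_slot (hQ : IsQueue stream μ X₀ S A H) (n L : ℕ) (d) :
    MeasurableSet (slot S A H n L ⁻¹' {d}) := by
  have h2 := hQ.measurable_S
  have h3 := hQ.measurable_A
  have h4 := hQ.measurable_H
  have : Measurable (slot S A H n L) := by
    unfold slot
    refine measurable_pi_lambda _ fun k => (h2 k n).prodMk ((h3 k n).prodMk ?_)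
    exact measurable_pi_lambda _ fun l => h4 k _ _
  exact this (measurableSet_singleton d)

/-- The Markov property in terms of atoms: given the history, the classes develop independently
according to `slotMass`. -/
lemma IsQueue.measure_history_slot (hQ : IsQueue stream μ X₀ S A H) (n L : ℕ) (η) (d) :
    μ (history X₀ S A H n L ⁻¹' {η} ∩ slot S A H (n + 1) L ⁻¹' {d}) =
      μ (history X₀ S A H n L ⁻¹' {η}) *
        ∏ k, slotMass (stream k) L (η.2.1 k (Fin.last n)) (d k) := by
  rcases (history X₀ S A H n L ⁻¹' {η}).eq_empty_or_nonempty with hemp | ⟨ω₀, hω₀⟩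
  · simp [hemp]
  · obtain rfl : history X₀ S A H n L ω₀ = η := hω₀
    set s : (k : Fin K) → ℕ → Fin ((stream k).M + 1) :=
      fun k t => if t ≤ n then S k t ω₀ else (d k).1 with hs
    set a : Fin K → ℕ → ℕ := fun k t => if t ≤ n then A k t ω₀ else (d k).2.1 with ha
    set h : Fin K → ℕ → ℕ → ℕ := fun k t l => if t ≤ n then H k t l ω₀ else
      if hl : l - 1 < L then (d k).2.2 ⟨l - 1, hl⟩ else 0 with hh
    have hlt : ∀ t ∈ Finset.Icc 1 n, t ≤ n := fun t ht => (Finset.mem_Icc.mp ht).2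
    have e1 : history X₀ S A H n L ⁻¹' {history X₀ S A H n L ω₀} =
        {ω | X₀ ω = X₀ ω₀ ∧ (∀ k, ∀ t ∈ Finset.range (n + 1), S k t ω = s k t) ∧
          (∀ k, ∀ t ∈ Finset.Icc 1 n, A k t ω = a k t) ∧
          (∀ k, ∀ t ∈ Finset.Icc 1 n, ∀ l ∈ Finset.Icc 1 L, H k t l ω = h k t l)} := by
      ext ω
      simp only [Set.mem_preimage, Set.mem_singleton_iff, Set.mem_ofPred_eq, history_eq_iff]
      refine and_congr_right fun _ => and_congr ?_ (and_congr ?_ ?_)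
      · refine forall_congr' fun k => forall₂_congr fun t ht => ?_
        rw [hs]; simp only [if_pos (Nat.lt_succ_iff.mp (Finset.mem_range.mp ht))]
      · refine forall_congr' fun k => forall₂_congr fun t ht => ?_
        rw [ha]; simp only [if_pos (hlt t ht)]
      · refine forall_congr' fun k => forall₂_congr fun t ht => forall₂_congr fun l hl => ?_
        rw [hh]; simp only [if_pos (hlt t ht)]
    have e2 : history X₀ S A H n L ⁻¹' {history X₀ S A H n L ω₀} ∩
        slot S A H (n + 1) L ⁻¹' {d} =
        {ω | X₀ ω = X₀ ω₀ ∧ (∀ k, ∀ t ∈ Finset.range (n + 1 + 1), S k t ω = s k t) ∧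
          (∀ k, ∀ t ∈ Finset.Icc 1 (n + 1), A k t ω = a k t) ∧
          (∀ k, ∀ t ∈ Finset.Icc 1 (n + 1), ∀ l ∈ Finset.Icc 1 L, H k t l ω = h k t l)} := by
      have hIcc : Finset.Icc 1 (n + 1) = insert (n + 1) (Finset.Icc 1 n) :=
        (Finset.insert_Icc_right_eq_Icc_add_one (by omega)).symm
      have hsl : ∀ k, s k (n + 1) = (d k).1 := fun k => by simp [hs]
      have hal : ∀ k, a k (n + 1) = (d k).2.1 := fun k => by simp [ha]
      have hhl : ∀ ω, (∀ k, ∀ l ∈ Finset.Icc 1 L, H k (n + 1) l ω = h k (n + 1) l) ↔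
          ∀ k, (fun l : Fin L => H k (n + 1) (l + 1) ω) = (d k).2.2 := by
        intro ω
        refine forall_congr' fun k => ?_
        rw [funext_iff]
        constructor
        · intro h0 l
          have := h0 (l + 1) (by simp)
          simpa [hh] using this
        · intro h0 l hl
          obtain ⟨h3, h4⟩ := Finset.mem_Icc.mp hl
          have := h0 ⟨l - 1, by omega⟩
          simp only [Nat.sub_add_cancel h3] at this
          rw [this]
          simp only [hh, if_neg (show ¬ n + 1 ≤ n by omega), dif_pos (show l - 1 < L by omega)]
      ext ω
      rw [Set.mem_inter_iff, e1]
      simp only [Set.mem_preimage, Set.mem_singleton_iff, Set.mem_ofPred_eq, hIcc,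
        Finset.range_add_one (n := n + 1), Finset.forall_mem_insert, forall_and, hsl, hal, hhl]
      simp only [slot, funext_iff (f := fun k => _), Prod.ext_iff, forall_and]
      tauto
    rw [e2, e1, hQ.law, hQ.law, mul_assoc, ← Finset.prod_mul_distrib]
    congr 1
    refine Finset.prod_congr rfl fun k _ => ?_
    rw [Finset.prod_Icc_succ_top (by omega)]
    congr 1
    have h1 : s k (n + 1) = (d k).1 := by simp [hs]
    have h2 : a k (n + 1) = (d k).2.1 := by simp [ha]
    have h3 : s k (n + 1 - 1) = S k n ω₀ := by simp [hs]
    have h4 : ∏ l ∈ Finset.Icc 1 L, (stream k).h (h k (n + 1) l) =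
        ∏ l : Fin L, (stream k).h ((d k).2.2 l) := by
      rw [prod_Icc_one]
      exact Finset.prod_congr rfl fun l _ => by simp [hh]
    rw [h1, h2, h3, h4]
    rfl

/-- Conditionally on the past, the classes are independent in slot `n + 1`, with mass functions
`slotMass`. -/
lemma IsQueue.lintegral_history_slot (hQ : IsQueue stream μ X₀ S A H) {n L : ℕ} {G : Ω → ℝ≥0∞}
    (hG : ∀ ω ω', history X₀ S A H n L ω = history X₀ S A H n L ω' → G ω = G ω')
    (φ : (k : Fin K) → Fin ((stream k).M + 1) × ℕ × (Fin L → ℕ) → ℝ≥0∞) :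
    ∫⁻ ω, G ω * ∏ k, φ k (slot S A H (n + 1) L ω k) ∂μ =
      ∫⁻ ω, G ω * ∏ k, ∑' e, slotMass (stream k) L (S k n ω) e * φ k e ∂μ := by
  obtain ⟨g, rfl⟩ : ∃ g, G = g ∘ history X₀ S A H n L := by
    have : Function.FactorsThrough G (history X₀ S A H n L) := fun ω ω' h => hG ω ω' h
    exact ⟨Function.extend _ G 0, funext fun ω => (this.extend_apply 0 ω).symm⟩
  have h1 := lintegral_comp_countable (μ := μ)
    (Y := fun ω => (history X₀ S A H n L ω, slot S A H (n + 1) L ω)) (fun y => by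
      rw [show (fun ω => (history X₀ S A H n L ω, slot S A H (n + 1) L ω)) ⁻¹' {y} =
        history X₀ S A H n L ⁻¹' {y.1} ∩ slot S A H (n + 1) L ⁻¹' {y.2} by
          ext ω; simp [Prod.ext_iff]]
      exact (hQ.measurableSet_history n L _).inter (hQ.measurableSet_slot (n + 1) L _))
    (fun y => g y.1 * ∏ k, φ k (y.2 k))
  have h2 := lintegral_comp_countable (μ := μ) (hQ.measurableSet_history n L)
    (fun η => g η * ∏ k, ∑' e, slotMass (stream k) L (η.2.1 k (Fin.last n)) e * φ k e)
  have h3 : ∀ ω k, (history X₀ S A H n L ω).2.1 k (Fin.last n) = S k n ω := fun ω k => by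
    simp [history]
  simp only [h3] at h2
  simp only [Function.comp_apply]
  rw [h1, h2, ENNReal.tsum_prod']
  refine tsum_congr fun η => ?_
  rw [← tsum_pi_prod, mul_assoc, mul_comm _ (μ _), ← mul_assoc, ← ENNReal.tsum_mul_left]
  refine tsum_congr fun d => ?_
  rw [show (fun ω => (history X₀ S A H n L ω, slot S A H (n + 1) L ω)) ⁻¹' {(η, d)} =
    history X₀ S A H n L ⁻¹' {η} ∩ slot S A H (n + 1) L ⁻¹' {d} by ext ω; simp [Prod.ext_iff],
    hQ.measure_history_slot, Finset.prod_mul_distrib]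
  ring

lemma IsQueue.measurable_arrivingWork (hQ : IsQueue stream μ X₀ S A H) (n : ℕ) :
    Measurable (arrivingWork A H n) := by
  refine Finset.measurable_sum _ fun k _ => ?_
  have h : Measurable fun p : ℕ × Ω => ∑ l ∈ Finset.Icc 1 p.1, H k n l p.2 :=
    measurable_from_prod_countable_right fun a =>
      Finset.measurable_sum (Finset.Icc 1 a) fun l _ => hQ.measurable_H k n l
  exact h.comp ((hQ.measurable_A k n).prodMk measurable_id)

lemma IsQueue.measurable_workload (hQ : IsQueue stream μ X₀ S A H) (n : ℕ) :
    Measurable (workload X₀ A H n) := by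
  induction n with
  | zero => exact hQ.measurable_X₀
  | succ n ih =>
    exact ((measurable_of_countable fun x : ℕ => x - 1).comp ih).add
      (hQ.measurable_arrivingWork (n + 1))

/-- The conditional expectation of `u (S_{n+1}) w ^ A_{n+1}` on `A_{n+1} ≤ L`, computed from the
service times as `y ^ ∑ H`. -/
lemma tsum_slotMass (s : ArrivalStream) (L : ℕ) (i : Fin (s.M + 1)) (y : ℝ≥0∞)
    (u : Fin (s.M + 1) → ℝ≥0∞) :
    ∑' e, slotMass s L i e *
      (u e.1 * if e.2.1 ≤ L then ∏ l : Fin L, (if (l : ℕ) < e.2.1 then y ^ e.2.2 l else 1) else 0) =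
    ∑ j, s.P i j * u j * ∑ m ∈ Finset.range (L + 1), s.a i j m * (∑' b, s.h b * y ^ b) ^ m := by
  rw [ENNReal.tsum_prod', tsum_fintype]
  refine Finset.sum_congr rfl fun j _ => ?_
  rw [ENNReal.tsum_prod', Finset.mul_sum, tsum_eq_sum (s := Finset.range (L + 1)) fun m hm => by
    have : ¬ m ≤ L := fun h => hm (Finset.mem_range.mpr (Nat.lt_succ_of_le h))
    simp [this]]
  refine Finset.sum_congr rfl fun m hm => ?_
  have hmL : m ≤ L := Nat.lt_succ_iff.mp (Finset.mem_range.mp hm)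
  have hpow : (∑' b, s.h b * y ^ b) ^ m =
      ∏ l : Fin L, ∑' b, s.h b * (if (l : ℕ) < m then y ^ b else 1) := by
    have h1 : ∀ l : Fin L, ∑' b, s.h b * (if (l : ℕ) < m then y ^ b else 1) =
        if (l : ℕ) < m then ∑' b, s.h b * y ^ b else 1 := fun l => by
      split_ifs with h
      · rfl
      · simp [s.h.tsum_coe]
    simp only [h1]
    rw [Fin.prod_univ_eq_prod_range (fun l => if l < m then ∑' b, s.h b * y ^ b else 1) L,
      Finset.prod_ite, Finset.prod_const, Finset.prod_const_one, mul_one]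
    congr 1
    rw [show (Finset.range L).filter (· < m) = Finset.range m by
      ext l; simp only [Finset.mem_filter, Finset.mem_range]; omega, Finset.card_range]
  rw [hpow, ← tsum_pi_prod, ← mul_assoc, ← ENNReal.tsum_mul_left]
  refine tsum_congr fun h => ?_
  simp only [slotMass, if_pos hmL, Finset.prod_mul_distrib]
  ring

/-- One step of the exponential martingale: if the vectors `u k` are eigenvectors of the matrices
`A_k(H_k(y))`, then weighting an event of the past with `y ^ B_{n+1} ∏ u k (S_{k,n+1})` is the same
as weighting it with `∏ δ k u k (S_{k,n})`. -/
theorem IsQueue.lintegral_step (hQ : IsQueue stream μ X₀ S A H) {n : ℕ} {G : Ω → ℝ≥0∞}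
    (hGm : Measurable G) (hGfin : ∀ ω, G ω ≠ ∞)
    (hG : ∀ ω ω', SameHistory X₀ S A H n ω ω' → G ω = G ω') {y : ℝ≥0∞}
    {u : (k : Fin K) → Fin ((stream k).M + 1) → ℝ≥0∞} {δ : Fin K → ℝ≥0∞}
    (hu : ∀ k i, u k i ≠ ∞) (hδ : ∀ k, δ k ≠ ∞)
    (heig : ∀ k i, ∑ j, (stream k).P i j * u k j *
      ∑' m, (stream k).a i j m * (∑' b, (stream k).h b * y ^ b) ^ m = δ k * u k i) :
    ∫⁻ ω, G ω * (y ^ arrivingWork A H (n + 1) ω * ∏ k, u k (S k (n + 1) ω)) ∂μ =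
      (∏ k, δ k) * ∫⁻ ω, G ω * ∏ k, u k (S k n ω) ∂μ := by
  classical
  have hSm := hQ.measurable_S
  have hAm := hQ.measurable_A
  have hHm := hQ.measurable_H
  -- the number of arrivals in each slot is bounded by `L` first
  set E : ℕ → Set Ω := fun L => {ω | ∀ k, ∀ t ∈ Finset.Icc 1 n, A k t ω ≤ L} with hE
  have hEm : ∀ L, MeasurableSet (E L) := fun L => by
    simp only [hE, Set.ofPred_forall]
    exact MeasurableSet.iInter fun k => MeasurableSet.iInter fun t => MeasurableSet.iInter fun _ =>
      hAm k t measurableSet_Iic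
  set Gt : ℕ → Ω → ℝ≥0∞ := fun L => (E L).indicator G with hGt
  have hGtm : ∀ L, Measurable (Gt L) := fun L => hGm.indicator (hEm L)
  have hGtmono : ∀ ω, Monotone fun L => Gt L ω := fun ω L L' hLL' =>
    Set.indicator_le_indicator_of_subset
      (fun ω hω k t ht => (hω k t ht).trans hLL') (fun _ => zero_le) ω
  have hbound : ∀ ω, ∃ L₀, ∀ L ≥ L₀, (ω ∈ E L) ∧ ∀ k, A k (n + 1) ω ≤ L := by
    intro ω
    refine ⟨∑ k, ∑ t ∈ Finset.Icc 1 (n + 1), A k t ω, fun L hL => ?_⟩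
    have hle : ∀ k, ∀ t ∈ Finset.Icc 1 (n + 1), A k t ω ≤ L := fun k t ht =>
      ((Finset.single_le_sum (f := fun t => A k t ω) (fun _ _ => Nat.zero_le _) ht).trans
        (Finset.single_le_sum (f := fun k => ∑ t ∈ Finset.Icc 1 (n + 1), A k t ω)
          (fun _ _ => Nat.zero_le _) (Finset.mem_univ k))).trans hL
    refine ⟨fun k t ht => hle k t ?_, fun k => hle k _ (by simp)⟩
    rw [Finset.mem_Icc] at ht ⊢
    omega
  have hGtlim : ∀ ω, Tendsto (fun L => Gt L ω) atTop (𝓝 (G ω)) := fun ω => by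
    obtain ⟨L₀, hL₀⟩ := hbound ω
    refine tendsto_atTop_of_eventually_const (i₀ := L₀) fun L hL => ?_
    exact Set.indicator_of_mem (hL₀ L hL).1 G
  set V : Ω → ℝ≥0∞ := fun ω => y ^ arrivingWork A H (n + 1) ω * ∏ k, u k (S k (n + 1) ω) with hV
  set V' : ℕ → Ω → ℝ≥0∞ := fun L => {ω | ∀ k, A k (n + 1) ω ≤ L}.indicator V with hV'
  set φ : (L : ℕ) → (k : Fin K) → Fin ((stream k).M + 1) × ℕ × (Fin L → ℕ) → ℝ≥0∞ :=
    fun L k e => u k e.1 * if e.2.1 ≤ L then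
      ∏ l : Fin L, (if (l : ℕ) < e.2.1 then y ^ e.2.2 l else 1) else 0 with hφ
  set c : ℕ → (k : Fin K) → Fin ((stream k).M + 1) → ℝ≥0∞ := fun L k i =>
    ∑ j, (stream k).P i j * u k j *
      ∑ m ∈ Finset.range (L + 1), (stream k).a i j m * (∑' b, (stream k).h b * y ^ b) ^ m with hc
  have hV'φ : ∀ L ω, V' L ω = ∏ k, φ L k (slot S A H (n + 1) L ω k) := by
    intro L ω
    by_cases hω : ∀ k, A k (n + 1) ω ≤ L
    · rw [hV']
      beta_reduce
      rw [Set.indicator_of_mem (show ω ∈ {ω | ∀ k, A k (n + 1) ω ≤ L} from hω)]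
      simp only [hV, hφ, slot, if_pos (hω _), Finset.prod_mul_distrib, arrivingWork]
      rw [mul_comm]
      congr 1
      rw [← Finset.prod_pow_eq_pow_sum]
      refine Finset.prod_congr rfl fun k _ => ?_
      rw [← Finset.prod_pow_eq_pow_sum,
        Fin.prod_univ_eq_prod_range (fun l => if l < A k (n + 1) ω then
          y ^ H k (n + 1) (l + 1) ω else 1) L,
        Finset.prod_ite, Finset.prod_const_one, mul_one,
        show (Finset.range L).filter (· < A k (n + 1) ω) = Finset.range (A k (n + 1) ω) by
          ext l; simp only [Finset.mem_filter, Finset.mem_range]; have := hω k; omega,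
        prod_Icc_one, Fin.prod_univ_eq_prod_range (fun l => y ^ H k (n + 1) (l + 1) ω)]
    · rw [hV']
      beta_reduce
      rw [Set.indicator_of_notMem (show ω ∉ {ω | ∀ k, A k (n + 1) ω ≤ L} from hω)]
      push Not at hω
      obtain ⟨k, hk⟩ := hω
      refine (Finset.prod_eq_zero (Finset.mem_univ k) ?_).symm
      simp [hφ, slot, not_le.mpr hk]
  have hstep : ∀ L, ∫⁻ ω, Gt L ω * V' L ω ∂μ = ∫⁻ ω, Gt L ω * ∏ k, c L k (S k n ω) ∂μ := by
    intro L
    simp only [hV'φ]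
    rw [hQ.lintegral_history_slot (fun ω ω' h => ?_)]
    · simp only [hφ, tsum_slotMass, hc]
    · obtain ⟨h1, h2, h3, h4⟩ := history_eq_iff.mp h
      have hEE : ω ∈ E L ↔ ω' ∈ E L :=
        forall_congr' fun k => forall₂_congr fun t ht => by rw [h3 k t ht]
      by_cases hω : ω ∈ E L
      · rw [hGt]
        simp only [Set.indicator_of_mem hω, Set.indicator_of_mem (hEE.mp hω)]
        refine hG ω ω' ⟨h1, fun k t ht => h2 k t (Finset.mem_range.mpr (Nat.lt_succ_of_le ht)), h3,
          fun k t ht l hl => h4 k t ht l ?_⟩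
        have := hω k t ht
        rw [Finset.mem_Icc] at hl ⊢
        omega
      · rw [hGt]
        simp only [Set.indicator_of_notMem hω, Set.indicator_of_notMem (fun h => hω (hEE.mpr h))]
  have hVm : Measurable V :=
    ((measurable_of_countable fun b : ℕ => y ^ b).comp (hQ.measurable_arrivingWork _)).mul
      (Finset.measurable_prod _ fun k _ => (measurable_of_countable (u k)).comp (hSm k (n + 1)))
  have lim1 : Tendsto (fun L => ∫⁻ ω, Gt L ω * V' L ω ∂μ) atTop (𝓝 (∫⁻ ω, G ω * V ω ∂μ)) := by
    refine lintegral_tendsto_of_tendsto_of_monotone (fun L => ?_)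
      (Eventually.of_forall fun ω => ?_) (Eventually.of_forall fun ω => ?_)
    · refine ((hGtm L).mul (hVm.indicator ?_)).aemeasurable
      simp only [Set.ofPred_forall]
      exact MeasurableSet.iInter fun k => hAm k (n + 1) measurableSet_Iic
    · intro L L' hLL'
      refine mul_le_mul' (hGtmono ω hLL') (Set.indicator_le_indicator_of_subset
        (fun ω hω k => (hω k).trans hLL') (fun _ => zero_le) ω)
    · obtain ⟨L₀, hL₀⟩ := hbound ω
      refine tendsto_atTop_of_eventually_const (i₀ := L₀) fun L hL => ?_
      rw [hGt, hV']
      simp only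
      rw [Set.indicator_of_mem (hL₀ L hL).1, Set.indicator_of_mem
        (show ω ∈ {ω | ∀ k, A k (n + 1) ω ≤ L} from (hL₀ L hL).2)]
  have hcmono : ∀ k i, Monotone fun L => c L k i := fun k i L L' hLL' => by
    simp only [hc]
    gcongr
  have hclim : ∀ k i, Tendsto (fun L => c L k i) atTop (𝓝 (δ k * u k i)) := fun k i => by
    rw [← heig k i]
    refine tendsto_finsetSum _ fun j _ => ?_
    refine ENNReal.Tendsto.const_mul ((ENNReal.tendsto_nat_tsum _).comp (tendsto_add_atTop_nat 1))
      (Or.inr ?_)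
    exact ENNReal.mul_ne_top (((stream k).P i).apply_ne_top j) (hu k j)
  have lim2 : Tendsto (fun L => ∫⁻ ω, Gt L ω * ∏ k, c L k (S k n ω) ∂μ) atTop
      (𝓝 (∫⁻ ω, G ω * ∏ k, (δ k * u k (S k n ω)) ∂μ)) := by
    refine lintegral_tendsto_of_tendsto_of_monotone (fun L => ?_)
      (Eventually.of_forall fun ω => ?_) (Eventually.of_forall fun ω => ?_)
    · refine ((hGtm L).mul (Finset.measurable_prod _ fun k _ => ?_)).aemeasurable
      exact (measurable_of_countable (c L k)).comp (hSm k n)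
    · intro L L' hLL'
      exact mul_le_mul' (hGtmono ω hLL') (Finset.prod_le_prod' fun k _ => hcmono k _ hLL')
    · have hne : ∀ k, δ k * u k (S k n ω) ≠ ∞ := fun k => ENNReal.mul_ne_top (hδ k) (hu k _)
      exact ENNReal.Tendsto.mul (hGtlim ω)
        (Or.inr (ENNReal.prod_ne_top fun k _ => hne k))
        (ENNReal.tendsto_finsetProd_of_ne_top _ (fun k _ => hclim k _) fun k _ => hne k)
        (Or.inr (hGfin ω))
  simp only [hstep] at lim1
  rw [tendsto_nhds_unique lim1 lim2, ← lintegral_const_mul]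
  · refine lintegral_congr fun ω => ?_
    rw [Finset.prod_mul_distrib]
    ring
  · refine hGm.mul (Finset.measurable_prod _ fun k _ => ?_)
    exact (measurable_of_countable (u k)).comp (hSm k n)

end Queue

/-! ### The first passage time and optional stopping -/

section Passage

variable {Ω : Type*} {X : ℕ → Ω → ℕ}

lemma busyCycle_le_iff {ω : Ω} {m : ℕ} :
    busyCycle X ω ≤ m ↔ ∃ t ∈ Finset.Icc 1 m, X t ω = 0 := by
  rw [busyCycle, ← ENat.lt_add_one_iff (ENat.natCast_ne_top m)]
  simp only [iInf_lt_iff, Finset.mem_Icc, exists_prop]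
  refine exists_congr fun t => ?_
  rw [ENat.lt_add_one_iff (ENat.natCast_ne_top m), Nat.cast_le]
  tauto

lemma busyCycle_ne_zero (ω : Ω) : busyCycle X ω ≠ 0 := fun h => by
  obtain ⟨t, ht, -⟩ := busyCycle_le_iff.mp (show busyCycle X ω ≤ (0 : ℕ) by simp [h])
  simp at ht

lemma busyCycle_eq_succ_iff {ω : Ω} {n : ℕ} :
    busyCycle X ω = (n + 1 : ℕ) ↔ (∀ t ∈ Finset.Icc 1 n, X t ω ≠ 0) ∧ X (n + 1) ω = 0 := by
  have h : busyCycle X ω = (n + 1 : ℕ) ↔ busyCycle X ω ≤ (n + 1 : ℕ) ∧ ¬ busyCycle X ω ≤ n := by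
    rw [not_le, Nat.cast_succ, ← Order.add_one_le_iff_of_not_isMax (by simp)]
    exact le_antisymm_iff
  rw [h, busyCycle_le_iff, busyCycle_le_iff,
    ← Finset.insert_Icc_right_eq_Icc_add_one (show 1 ≤ n + 1 by omega)]
  simp only [Finset.exists_mem_insert, not_exists, not_and]
  constructor
  · rintro ⟨h1 | ⟨t, ht, h1⟩, h2⟩
    · exact ⟨h2, h1⟩
    · exact absurd h1 (h2 t ht)
  · rintro ⟨h1, h2⟩
    exact ⟨Or.inl h2, h1⟩

variable [MeasurableSpace Ω]

lemma measurableSet_busyCycle_eq (hX : ∀ n, Measurable (X n)) (y : ℕ∞) :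
    MeasurableSet (busyCycle X ⁻¹' {y}) := by
  have hle : ∀ m : ℕ, MeasurableSet {ω | busyCycle X ω ≤ m} := fun m => by
    have : {ω | busyCycle X ω ≤ m} = ⋃ t ∈ Finset.Icc 1 m, X t ⁻¹' {0} := by
      ext ω
      simp only [Set.mem_ofPred_eq, busyCycle_le_iff, Set.mem_iUnion, exists_prop,
        Set.mem_preimage, Set.mem_singleton_iff]
    rw [this]
    exact MeasurableSet.iUnion fun t => MeasurableSet.iUnion fun _ =>
      hX t (measurableSet_singleton 0)
  have hnat : ∀ m : ℕ, MeasurableSet (busyCycle X ⁻¹' {(m : ℕ∞)}) := fun m => by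
    cases m with
    | zero =>
      rw [show busyCycle X ⁻¹' {((0 : ℕ) : ℕ∞)} = ∅ by
        ext ω; simpa using busyCycle_ne_zero ω]
      exact MeasurableSet.empty
    | succ n =>
      rw [show busyCycle X ⁻¹' {((n + 1 : ℕ) : ℕ∞)} =
        {ω | busyCycle X ω ≤ (n + 1 : ℕ)} \ {ω | busyCycle X ω ≤ n} by
          ext ω
          simp only [Set.mem_preimage, Set.mem_singleton_iff, Set.mem_sdiff, Set.mem_ofPred_eq,
            not_le]
          rw [Nat.cast_succ, ← Order.add_one_le_iff_of_not_isMax (by simp)]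
          exact le_antisymm_iff]
      exact (hle _).diff (hle _)
  induction y using ENat.recTopCoe with
  | top =>
    rw [show busyCycle X ⁻¹' {(⊤ : ℕ∞)} = (⋃ m : ℕ, busyCycle X ⁻¹' {(m : ℕ∞)})ᶜ by
      ext ω
      simp only [Set.mem_preimage, Set.mem_singleton_iff, Set.mem_compl_iff, Set.mem_iUnion,
        not_exists]
      constructor
      · intro h m
        simp [h]
      · intro h
        by_contra h'
        obtain ⟨m, hm⟩ := ENat.ne_top_iff_exists.mp h'
        exact h m hm.symm]
    exact (MeasurableSet.iUnion hnat).compl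
  | coe m => exact hnat m

/-- The expectation of a function of the passage time that vanishes at infinity. -/
lemma lintegral_busyCycle (hX : ∀ n, Measurable (X n)) (ν : Measure Ω) {g : ℕ∞ → ℝ≥0∞}
    (hg : g ⊤ = 0 ∨ ν (busyCycle X ⁻¹' {⊤}) = 0) :
    ∫⁻ ω, g (busyCycle X ω) ∂ν = ∑' n : ℕ, g n * ν (busyCycle X ⁻¹' {(n : ℕ∞)}) := by
  rw [lintegral_comp_countable (measurableSet_busyCycle_eq hX)]
  refine (Function.Injective.tsum_eq Nat.cast_injective fun y hy => ?_).symm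
  by_contra h
  obtain rfl : y = ⊤ := by
    by_contra h'
    obtain ⟨m, hm⟩ := ENat.ne_top_iff_exists.mp h'
    exact h ⟨m, hm⟩
  rw [Function.mem_support] at hy
  rcases hg with h0 | h0 <;> simp [h0] at hy

lemma genFun_eq_genSeries (hX : ∀ n, Measurable (X n)) (ν : Measure Ω) [IsFiniteMeasure ν] {z : ℝ}
    (hz : 0 ≤ z) :
    genFun ν (busyCycle X) z =
      genSeries (fun n => (ν (busyCycle X ⁻¹' {(n : ℕ∞)})).toReal) z := by
  set g : ℕ∞ → ℝ := fun y => if y = ⊤ then 0 else z ^ y.toNat with hg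
  have hg0 : ∀ y, 0 ≤ g y := fun y => by
    simp only [hg]; split_ifs
    · exact le_rfl
    · exact pow_nonneg hz _
  have hm : Measurable fun ω => g (busyCycle X ω) := by
    let _ : MeasurableSpace ℕ∞ := ⊤
    exact (measurable_from_top (f := g)).comp
      (measurable_to_countable' (measurableSet_busyCycle_eq hX))
  have h1 : genFun ν (busyCycle X) z = ∫ ω, g (busyCycle X ω) ∂ν := rfl
  rw [h1, integral_eq_lintegral_of_nonneg_ae (Eventually.of_forall fun ω => hg0 _)
    hm.aestronglyMeasurable, lintegral_busyCycle hX ν (g := fun y => ENNReal.ofReal (g y))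
      (Or.inl (by simp [hg])), ENNReal.tsum_toReal_eq]
  · refine tsum_congr fun n => ?_
    simp only [hg, ENNReal.toReal_mul, ENat.natCast_ne_top, if_false, ENat.toNat_natCast]
    rw [ENNReal.toReal_ofReal (pow_nonneg hz _), mul_comm]
  · intro n
    exact ENNReal.mul_ne_top ENNReal.ofReal_ne_top (measure_ne_top _ _)

end Passage

section Queue

variable {K : ℕ} {Ω : Type*} {stream : Fin K → ArrivalStream}
  {X₀ : Ω → ℕ} {S : (k : Fin K) → ℕ → Ω → Fin ((stream k).M + 1)}
  {A : Fin K → ℕ → Ω → ℕ} {H : Fin K → ℕ → ℕ → Ω → ℕ}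

lemma SameHistory.workload_eq {n : ℕ} {ω ω' : Ω} (h : SameHistory X₀ S A H n ω ω') {t : ℕ}
    (ht : t ≤ n) : workload X₀ A H t ω = workload X₀ A H t ω' := by
  obtain ⟨h1, -, h3, h4⟩ := h
  induction t with
  | zero => exact h1
  | succ t ih =>
    have hmem : t + 1 ∈ Finset.Icc 1 n := Finset.mem_Icc.mpr ⟨by omega, ht⟩
    rw [workload, workload, ih (by omega)]
    congr 1
    refine Finset.sum_congr rfl fun k _ => ?_
    rw [← h3 k _ hmem]
    exact Finset.sum_congr rfl fun l hl => h4 k _ hmem l hl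

variable [MeasurableSpace Ω] {μ : Measure Ω}

lemma IsQueue.measurable_slot (hQ : IsQueue stream μ X₀ S A H) (n L : ℕ) (k : Fin K) :
    Measurable fun ω => slot S A H n L ω k :=
  (hQ.measurable_S k n).prodMk
    ((hQ.measurable_A k n).prodMk (measurable_pi_lambda _ fun l => hQ.measurable_H k n (l + 1)))

/-- Data of one class to which no state of the chain gives positive mass almost surely do not
occur. -/
lemma IsQueue.ae_slot (hQ : IsQueue stream μ X₀ S A H) (n L : ℕ) (k : Fin K)
    {Q : Fin ((stream k).M + 1) × ℕ × (Fin L → ℕ) → Prop}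
    (h : ∀ i e, Q e → slotMass (stream k) L i e = 0) :
    ∀ᵐ ω ∂μ, ¬ Q (slot S A H (n + 1) L ω k) := by
  classical
  set ψ : (k' : Fin K) → Fin ((stream k').M + 1) × ℕ × (Fin L → ℕ) → ℝ≥0∞ :=
    Function.update (fun _ _ => 1) k fun e => if Q e then 1 else 0 with hψ
  have hψk : ψ k = fun e => if Q e then 1 else 0 := by simp [hψ]
  have h1 := hQ.lintegral_history_slot (n := n) (L := L) (G := fun _ => 1) (fun _ _ _ => rfl) ψ
  have h2 : ∀ ω, ∏ k', ∑' e, slotMass (stream k') L (S k' n ω) e * ψ k' e = 0 := fun ω => by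
    refine Finset.prod_eq_zero (Finset.mem_univ k) (ENNReal.tsum_eq_zero.mpr fun e => ?_)
    rw [hψk]
    by_cases he : Q e
    · simp [h _ e he]
    · simp [he]
  simp only [h2, mul_zero, lintegral_zero, one_mul] at h1
  have hm : Measurable fun ω => ∏ k', ψ k' (slot S A H (n + 1) L ω k') :=
    Finset.measurable_prod _ fun k' _ =>
      (measurable_of_countable (ψ k')).comp (hQ.measurable_slot (n + 1) L k')
  rw [lintegral_eq_zero_iff hm] at h1
  filter_upwards [h1] with ω hω hq
  refine absurd hω (Finset.prod_ne_zero_iff.mpr fun k' _ => ?_)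
  by_cases hk : k' = k
  · subst hk
    simp [hψk, hq]
  · simp [hψ, Function.update_of_ne hk]

/-- When the work vanishes at the end of a slot, no customers have arrived in it, and all chains are
idle. -/
lemma IsQueue.ae_idle (hQ : IsQueue stream μ X₀ S A H) :
    ∀ᵐ ω ∂μ, ∀ n, workload X₀ A H (n + 1) ω = 0 → ∀ k, S k (n + 1) ω = 0 := by
  have h1 : ∀ᵐ ω ∂μ, ∀ n k, A k (n + 1) ω = 0 → S k (n + 1) ω = 0 := by
    refine ae_all_iff.mpr fun n => ae_all_iff.mpr fun k => ?_
    filter_upwards [hQ.ae_slot n 0 k (Q := fun e => e.2.1 = 0 ∧ e.1 ≠ 0) fun i e he => by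
      simp [slotMass, he.1, (stream k).a_active i e.1 he.2]] with ω hω hA
    by_contra hS
    exact hω ⟨hA, hS⟩
  have h2 : ∀ᵐ ω ∂μ, ∀ n k l, H k (n + 1) (l + 1) ω ≠ 0 := by
    refine ae_all_iff.mpr fun n => ae_all_iff.mpr fun k => ae_all_iff.mpr fun l => ?_
    filter_upwards [hQ.ae_slot n (l + 1) k (Q := fun e => e.2.2 (Fin.last l) = 0) fun i e he => by
      rw [slotMass, Finset.prod_eq_zero (Finset.mem_univ (Fin.last l)) (by
        rw [he, (stream k).h_pos]), mul_zero]] with ω hω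
    simpa [slot] using hω
  filter_upwards [h1, h2] with ω hA hH n hn k
  refine hA n k (by_contra fun h0 => ?_)
  rw [workload, Nat.add_eq_zero_iff, arrivingWork, Finset.sum_eq_zero_iff] at hn
  have := Finset.sum_eq_zero_iff.mp (hn.2 k (Finset.mem_univ k)) 1
    (Finset.mem_Icc.mpr ⟨le_rfl, Nat.one_le_iff_ne_zero.mpr h0⟩)
  exact hH n k 0 this

lemma IsQueue.measurable_vec (hQ : IsQueue stream μ X₀ S A H) (n : ℕ)
    (u : (k : Fin K) → Fin ((stream k).M + 1) → ℝ≥0∞) :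
    Measurable fun ω => ∏ k, u k (S k n ω) :=
  Finset.measurable_prod _ fun k _ => (measurable_of_countable (u k)).comp (hQ.measurable_S k n)

lemma IsQueue.measurableSet_cycleStart (hQ : IsQueue stream μ X₀ S A H) :
    MeasurableSet (cycleStart (workload X₀ A H) S) := by
  have : cycleStart (workload X₀ A H) S =
      (X₀ ⁻¹' {0}) ∩ ⋂ k, S k 0 ⁻¹' {0} := by
    ext ω; simp [cycleStart, workload]
  rw [this]
  exact (hQ.measurable_X₀ (measurableSet_singleton 0)).inter
    (MeasurableSet.iInter fun k => hQ.measurable_S k 0 (measurableSet_singleton 0))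

/-- Optional stopping at the passage time: with `Δ = ∏ δ k` and `θ = y / Δ < 1`, the process
`θ ^ n y ^ X_n ∏ u k (S_{k,n})`, corrected at the slots where the server is idle, is a martingale
up to the passage time, where it equals `θ ^ F`. -/
theorem IsQueue.tsum_passage [IsProbabilityMeasure μ] (hQ : IsQueue stream μ X₀ S A H) {y : ℝ≥0∞}
    {u : (k : Fin K) → Fin ((stream k).M + 1) → ℝ≥0∞} {δ : Fin K → ℝ≥0∞}
    (hu : ∀ k i, u k i ≠ ∞) (hu0 : ∀ k, u k 0 = 1) (hδ : ∀ k, δ k ≠ ∞)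
    (heig : ∀ k i, ∑ j, (stream k).P i j * u k j *
      ∑' m, (stream k).a i j m * (∑' b, (stream k).h b * y ^ b) ^ m = δ k * u k i)
    (hy : y ≤ 1) (hyδ : y < ∏ k, δ k) :
    ∑' n : ℕ, μ (cycleStart (workload X₀ A H) S ∩
        busyCycle (workload X₀ A H) ⁻¹' {(n : ℕ∞)}) * (y / ∏ k, δ k) ^ n =
      y * μ (cycleStart (workload X₀ A H) S) := by
  set X := workload X₀ A H with hX
  set I := cycleStart X S with hI
  set Δ := ∏ k, δ k with hΔ
  have hΔ0 : Δ ≠ 0 := (zero_le.trans_lt hyδ).ne'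
  have hΔt : Δ ≠ ∞ := ENNReal.prod_ne_top fun k _ => hδ k
  set θ := y / Δ with hθ
  have hθ1 : θ < 1 := (ENNReal.div_lt_iff (Or.inl hΔ0) (Or.inl hΔt)).mpr (by simpa using hyδ)
  have hΔθ : Δ * θ = y := ENNReal.mul_div_cancel hΔ0 hΔt
  have hXm : ∀ n, Measurable (X n) := hQ.measurable_workload
  have hIm : MeasurableSet I := hQ.measurableSet_cycleStart
  -- the cycle has started and is still running after slot `n`
  set D : ℕ → Set Ω := fun n => {ω | ω ∈ I ∧ ∀ t ∈ Finset.Icc 1 n, X t ω ≠ 0} with hD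
  have hDm : ∀ n, MeasurableSet (D n) := fun n => by
    have : D n = I ∩ ⋂ t ∈ Finset.Icc 1 n, (X t ⁻¹' {0})ᶜ := by
      ext ω; simp [hD]
    rw [this]
    exact hIm.inter (MeasurableSet.iInter fun t => MeasurableSet.iInter fun _ =>
      (hXm t (measurableSet_singleton 0)).compl)
  set G : ℕ → Ω → ℝ≥0∞ := fun n => (D n).indicator fun ω => y ^ (X n ω - 1) with hG
  have hGm : ∀ n, Measurable (G n) := fun n =>
    ((measurable_of_countable fun x : ℕ => y ^ (x - 1)).comp (hXm n)).indicator (hDm n)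
  have hG1 : ∀ n ω, G n ω ≤ 1 := fun n ω =>
    Set.indicator_apply_le' (fun _ => pow_le_one₀ zero_le hy) fun _ => zero_le
  set e : ℕ → ℝ≥0∞ := fun n => ∫⁻ ω, G n ω * ∏ k, u k (S k n ω) ∂μ with he
  set q : ℕ → ℝ≥0∞ := fun n => μ (I ∩ busyCycle X ⁻¹' {(n : ℕ∞)}) with hq
  have hq0 : q 0 = 0 := by
    have : busyCycle X ⁻¹' {((0 : ℕ) : ℕ∞)} = ∅ := by ext ω; simpa using busyCycle_ne_zero ω
    simp only [hq, this, Set.inter_empty, measure_empty]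
  have hqs : ∀ n, q (n + 1) = μ (D n ∩ X (n + 1) ⁻¹' {0}) := fun n => by
    simp only [hq]
    congr 1
    ext ω
    simp only [Set.mem_inter_iff, Set.mem_preimage, Set.mem_singleton_iff, busyCycle_eq_succ_iff,
      hD, Set.mem_ofPred_eq]
    tauto
  have he0 : e 0 = μ I := by
    rw [he, ← lintegral_indicator_one hIm]
    refine lintegral_congr fun ω => ?_
    by_cases hω : ω ∈ I
    · have h1 : ω ∈ D 0 := ⟨hω, by simp⟩
      have h2 : X 0 ω = 0 := hω.1
      simp [hG, Set.indicator_of_mem h1, Set.indicator_of_mem hω, h2, hω.2, hu0]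
    · have h1 : ω ∉ D 0 := fun h => hω h.1
      simp [hG, Set.indicator_of_notMem h1, Set.indicator_of_notMem hω]
  have hGv : ∀ n, Measurable fun ω => G n ω * ∏ k, u k (S k n ω) := fun n =>
    (hGm n).mul (hQ.measurable_vec n u)
  -- one step of the martingale, split according to whether the passage occurs in slot `n + 1`
  have hrec : ∀ n, q (n + 1) + y * e (n + 1) = Δ * e n := fun n => by
    simp only [he]
    rw [← hQ.lintegral_step (hGm n) (fun ω => ((hG1 n ω).trans_lt ENNReal.one_lt_top).ne)
      (fun ω ω' h => ?_) hu hδ heig, hqs,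
      ← lintegral_indicator_one ((hDm n).inter (hXm (n + 1) (measurableSet_singleton 0))),
      ← lintegral_const_mul _ (hGv (n + 1)),
      ← lintegral_add_left (measurable_one.indicator
        ((hDm n).inter (hXm (n + 1) (measurableSet_singleton 0))))]
    · refine lintegral_congr_ae ?_
      filter_upwards [hQ.ae_idle] with ω hω
      have hXs : X (n + 1) ω = X n ω - 1 + arrivingWork A H (n + 1) ω := rfl
      have hDs : ω ∈ D (n + 1) ↔ ω ∈ D n ∧ X (n + 1) ω ≠ 0 := by
        simp only [hD, Set.mem_ofPred_eq, and_assoc]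
        rw [← Finset.insert_Icc_right_eq_Icc_add_one (show 1 ≤ n + 1 by omega)]
        simp only [Finset.forall_mem_insert]
        tauto
      by_cases hd : ω ∈ D n
      · have hGn : G n ω = y ^ (X n ω - 1) := Set.indicator_of_mem hd _
        rw [hGn, ← mul_assoc (y ^ _), ← pow_add, ← hXs]
        by_cases h0 : X (n + 1) ω = 0
        · have h1 : ω ∉ D (n + 1) := fun h => (hDs.mp h).2 h0
          rw [Set.indicator_of_mem (show ω ∈ D n ∩ X (n + 1) ⁻¹' {0} from ⟨hd, h0⟩)]
          simp [hG, Set.indicator_of_notMem h1, h0, hω n h0, hu0]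
        · have h1 : ω ∈ D (n + 1) := hDs.mpr ⟨hd, h0⟩
          rw [Set.indicator_of_notMem (show ω ∉ D n ∩ X (n + 1) ⁻¹' {0} from fun h => h0 h.2)]
          simp only [hG, Set.indicator_of_mem h1, zero_add, ← mul_assoc]
          rw [← pow_succ', Nat.sub_add_cancel (Nat.one_le_iff_ne_zero.mpr h0)]
      · have h1 : ω ∉ D (n + 1) := fun h => hd (hDs.mp h).1
        rw [Set.indicator_of_notMem (show ω ∉ D n ∩ X (n + 1) ⁻¹' {0} from fun h => hd h.1)]
        simp [hG, Set.indicator_of_notMem h1, Set.indicator_of_notMem hd]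
    · have hXX : ∀ t ≤ n, X t ω = X t ω' := fun t ht => h.workload_eq ht
      have hDD : ω ∈ D n ↔ ω' ∈ D n := by
        refine and_congr (and_congr ?_ ?_) ?_
        · rw [hXX 0 (Nat.zero_le n)]
        · exact forall_congr' fun k => by rw [h.2.1 k 0 (Nat.zero_le n)]
        · exact forall₂_congr fun t ht => by rw [hXX t (Finset.mem_Icc.mp ht).2]
      by_cases hd : ω ∈ D n
      · simp only [hG, Set.indicator_of_mem hd, Set.indicator_of_mem (hDD.mp hd)]
        rw [hXX n le_rfl]
      · simp only [hG, Set.indicator_of_notMem hd,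
          Set.indicator_of_notMem (fun h' => hd (hDD.mpr h'))]
  have hpart : ∀ N, ∑ n ∈ Finset.range (N + 1), q n * θ ^ n + y * (θ ^ N * e N) = y * μ I :=
    fun N => by
      induction N with
      | zero => simp [hq0, he0]
      | succ N ih =>
        rw [← ih, Finset.sum_range_succ _ (N + 1), add_assoc]
        congr 1
        calc q (N + 1) * θ ^ (N + 1) + y * (θ ^ (N + 1) * e (N + 1))
            = θ ^ (N + 1) * (q (N + 1) + y * e (N + 1)) := by ring
          _ = (Δ * θ) * (θ ^ N * e N) := by rw [hrec]; ring
          _ = y * (θ ^ N * e N) := by rw [hΔθ]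
  set U : ℝ≥0∞ := ∏ k, ∑ i, u k i with hU
  have hUt : U ≠ ∞ := ENNReal.prod_ne_top fun k _ => ENNReal.sum_ne_top.mpr fun i _ => hu k i
  have heU : ∀ n, e n ≤ U := fun n => by
    refine (lintegral_mono (g := fun _ => U) fun ω => ?_).trans (by simp)
    refine (mul_le_mul' (hG1 n ω) (Finset.prod_le_prod' fun k _ =>
      Finset.single_le_sum (f := u k) (fun _ _ => zero_le) (Finset.mem_univ (S k n ω)))).trans ?_
    rw [one_mul]
  have hyt : y ≠ ∞ := (hy.trans_lt ENNReal.one_lt_top).ne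
  have hrem : Tendsto (fun N => y * (θ ^ N * e N)) atTop (𝓝 0) := by
    have h1 : Tendsto (fun N => y * (θ ^ N * U)) atTop (𝓝 (y * (0 * U))) :=
      ENNReal.Tendsto.const_mul (ENNReal.Tendsto.mul_const
        (ENNReal.tendsto_pow_atTop_nhds_zero_of_lt_one hθ1) (Or.inr hUt)) (Or.inr hyt)
    rw [zero_mul, mul_zero] at h1
    exact tendsto_of_tendsto_of_tendsto_of_le_of_le tendsto_const_nhds h1 (fun _ => zero_le)
      fun N => mul_le_mul' le_rfl (mul_le_mul' le_rfl (heU N))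
  have hsum : Tendsto (fun N => ∑ n ∈ Finset.range (N + 1), q n * θ ^ n) atTop
      (𝓝 (∑' n, q n * θ ^ n)) :=
    (ENNReal.tendsto_nat_tsum _).comp (tendsto_add_atTop_nat 1)
  have h1 := hsum.add hrem
  simp only [hpart, add_zero] at h1
  exact tendsto_nhds_unique h1 tendsto_const_nhds

/-- A stable system in steady state is empty with positive probability.  Otherwise the server would
never idle, and `y ^ X_n ∏ u k (S_{k,n})` would be multiplied on average by `Δ / y > 1` in every
slot. -/
theorem IsQueue.measure_cycleStart_ne_zero [IsProbabilityMeasure μ]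
    (hQ : IsQueue stream μ X₀ S A H) (hs : IsSteady μ (workload X₀ A H) S) {y : ℝ≥0∞}
    {u : (k : Fin K) → Fin ((stream k).M + 1) → ℝ≥0∞} {δ : Fin K → ℝ≥0∞}
    (hu : ∀ k i, u k i ≠ ∞) (hu0 : ∀ k i, u k i ≠ 0) (hδ : ∀ k, δ k ≠ ∞)
    (heig : ∀ k i, ∑ j, (stream k).P i j * u k j *
      ∑' m, (stream k).a i j m * (∑' b, (stream k).h b * y ^ b) ^ m = δ k * u k i)
    (hy0 : y ≠ 0) (hy : y ≤ 1) (hyδ : y < ∏ k, δ k) :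
    μ (cycleStart (workload X₀ A H) S) ≠ 0 := by
  intro h0
  set X := workload X₀ A H with hX
  have hXm : ∀ n, Measurable (X n) := hQ.measurable_workload
  have hpm : ∀ n, Measurable fun ω => (X n ω, fun k => S k n ω) := fun n =>
    (hXm n).prodMk (measurable_pi_lambda _ fun k => hQ.measurable_S k n)
  have hst : ∀ f : ℕ × ((k : Fin K) → Fin ((stream k).M + 1)) → ℝ≥0∞,
      ∫⁻ ω, f (X 1 ω, fun k => S k 1 ω) ∂μ = ∫⁻ ω, f (X 0 ω, fun k => S k 0 ω) ∂μ := fun f => by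
    rw [← lintegral_map (measurable_of_countable f) (hpm 1), hs 1,
      lintegral_map (measurable_of_countable f) (hpm 0)]
  have hst' : ∀ T : Set (ℕ × ((k : Fin K) → Fin ((stream k).M + 1))),
      μ {ω | (X 1 ω, fun k => S k 1 ω) ∈ T} = μ {ω | (X 0 ω, fun k => S k 0 ω) ∈ T} := fun T => by
    have := congrArg (fun m => m T) (hs 1)
    simp only [Measure.map_apply (hpm _) (T.to_countable.measurableSet)] at this
    exact this
  have h1 : μ {ω | X 1 ω = 0 ∧ ∀ k, S k 1 ω = 0} = 0 := by
    have := hst' {p | p.1 = 0 ∧ ∀ k, p.2 k = 0}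
    simp only [Set.mem_ofPred_eq] at this
    rw [this]
    exact h0
  have h2 : μ {ω | X 1 ω = 0} = 0 := by
    rw [← h1]
    refine measure_congr ?_
    filter_upwards [hQ.ae_idle] with ω hω
    exact propext ⟨fun h => ⟨h, hω 0 h⟩, fun h => h.1⟩
  have h3 : ∀ᵐ ω ∂μ, X 0 ω ≠ 0 := by
    have := hst' {p | p.1 = 0}
    simp only [Set.mem_ofPred_eq] at this
    rw [ae_iff]
    simpa [← this] using h2
  have hstep := hQ.lintegral_step (n := 0) (G := fun ω => y ^ (X 0 ω - 1))
    ((measurable_of_countable fun x : ℕ => y ^ (x - 1)).comp (hXm 0))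
    (fun ω => ((pow_le_one₀ zero_le hy).trans_lt ENNReal.one_lt_top).ne)
    (fun ω ω' h => by simp only [hX, h.workload_eq le_rfl]) hu hδ heig
  set Z := ∫⁻ ω, y ^ X 0 ω * ∏ k, u k (S k 0 ω) ∂μ with hZ
  -- by stationarity the expectation is the same after slot `1` as initially
  have hL : ∫⁻ ω, y ^ (X 0 ω - 1) * (y ^ arrivingWork A H (0 + 1) ω * ∏ k, u k (S k (0 + 1) ω)) ∂μ
      = Z := by
    rw [hZ, ← hst fun p => y ^ p.1 * ∏ k, u k (p.2 k)]
    refine lintegral_congr fun ω => ?_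
    rw [← mul_assoc, ← pow_add]
    rfl
  have hR : y * ∫⁻ ω, y ^ (X 0 ω - 1) * ∏ k, u k (S k 0 ω) ∂μ = Z := by
    have hm : Measurable fun ω => y ^ (X 0 ω - 1) * ∏ k, u k (S k 0 ω) :=
      ((measurable_of_countable fun x : ℕ => y ^ (x - 1)).comp (hXm 0)).mul (hQ.measurable_vec 0 u)
    rw [← lintegral_const_mul _ hm]
    refine lintegral_congr_ae ?_
    filter_upwards [h3] with ω hω
    rw [← mul_assoc, ← pow_succ', Nat.sub_add_cancel (Nat.one_le_iff_ne_zero.mpr hω)]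
  have hyZ : y * Z = (∏ k, δ k) * Z := by
    nth_rw 1 [← hL]
    rw [hstep, mul_left_comm, hR]
  have hZ0 : Z ≠ 0 := by
    intro hz
    have hm : Measurable fun ω => y ^ X 0 ω * ∏ k, u k (S k 0 ω) :=
      ((measurable_of_countable fun x : ℕ => y ^ x).comp (hXm 0)).mul (hQ.measurable_vec 0 u)
    rw [hZ, lintegral_eq_zero_iff hm] at hz
    obtain ⟨ω, hω⟩ := hz.exists
    exact mul_ne_zero (pow_ne_zero _ hy0) (Finset.prod_ne_zero_iff.mpr fun k _ => hu0 k _) hω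
  have hZt : Z ≠ ∞ := by
    refine ((lintegral_mono (g := fun _ => ∏ k, ∑ i, u k i) fun ω => ?_).trans_lt ?_).ne
    · refine (mul_le_mul' (pow_le_one₀ zero_le hy) (Finset.prod_le_prod' fun k _ =>
        Finset.single_le_sum (f := u k) (fun _ _ => zero_le) (Finset.mem_univ (S k 0 ω)))).trans ?_
      rw [one_mul]
    · simpa using (ENNReal.prod_ne_top fun k _ => ENNReal.sum_ne_top.mpr fun i _ => hu k i).lt_top
  exact hyδ.ne ((ENNReal.mul_left_inj hZ0 hZt).mp hyZ)

end Queue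

/-! ### Inversion of the change of variable -/

lemma eventually_neg_left_of_deriv_pos {g : ℝ → ℝ} (hd : 0 < deriv g 1) (h0 : g 1 = 0) :
    ∀ᶠ z in 𝓝[<] (1 : ℝ), g z < 0 := by
  filter_upwards [(eventually_nhdsWithin_sign_eq_of_deriv_pos hd h0).filter_mono
    nhdsWithin_le_nhds, self_mem_nhdsWithin] with z hz hz1
  rw [sign_neg (sub_neg.mpr hz1)] at hz
  exact sign_eq_neg_one_iff.mp hz

/-- The change of variable `y / Δ y` is less than `1` to the left of `1`; this is where stability
enters. -/
lemma eventually_lt_of_deriv_lt_one {Δ : ℝ → ℝ} (hΔ : DifferentiableAt ℝ Δ 1) (h1 : Δ 1 = 1)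
    (hρ : deriv Δ 1 < 1) : ∀ᶠ y in 𝓝[<] (1 : ℝ), y < Δ y := by
  have hd : HasDerivAt (fun y => y - Δ y) (1 - deriv Δ 1) 1 := (hasDerivAt_id 1).sub hΔ.hasDerivAt
  filter_upwards [eventually_neg_left_of_deriv_pos (g := fun y => y - Δ y)
    (by rw [hd.deriv]; linarith) (by simp [h1])] with y hy
  linarith

/-- The inverse function `f` of `y ↦ y / Δ y` near `1`, and its first two derivatives at `1`, which
result from `f z = z Δ (f z)`. -/
lemma exists_inverse_curve {Δ : ℝ → ℝ} {r : ℕ} (hr : r ≠ 0) (hΔ : ContDiffAt ℝ r Δ 1)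
    (h1 : Δ 1 = 1) (hρ : deriv Δ 1 < 1) :
    ∃ f : ℝ → ℝ, ContDiffAt ℝ r f 1 ∧ f 1 = 1 ∧ Tendsto f (𝓝[<] 1) (𝓝[<] 1) ∧
      (∀ᶠ z in 𝓝 1, f z / Δ (f z) = z) ∧ deriv f 1 = 1 / (1 - deriv Δ 1) ∧
      (2 ≤ r → iteratedDeriv 2 f 1 =
        2 * deriv Δ 1 / (1 - deriv Δ 1) ^ 2 + 1 / (1 - deriv Δ 1) ^ 3 * iteratedDeriv 2 Δ 1) := by
  have hr1 : (1 : WithTop ℕ∞) ≤ r := by exact_mod_cast Nat.one_le_iff_ne_zero.mpr hr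
  have hr0 : (r : WithTop ℕ∞) ≠ 0 := by exact_mod_cast hr
  set ρ := deriv Δ 1 with hρdef
  have hρ0 : 1 - ρ ≠ 0 := by linarith
  have hΔd : HasDerivAt Δ ρ 1 := ((hΔ.of_le hr1).differentiableAt (by simp)).hasDerivAt
  set θ : ℝ → ℝ := fun y => y / Δ y with hθ
  have hθc : ContDiffAt ℝ r θ 1 := contDiffAt_id.div hΔ (by simp [h1])
  have hθd : HasDerivAt θ (1 - ρ) 1 := by
    exact ((hasDerivAt_id' (1 : ℝ)).fun_div hΔd (by simp [h1])).congr_deriv (by simp [h1])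
  have hθ1 : θ 1 = 1 := by simp [hθ, h1]
  have hequiv := hθd.hasFDerivAt_equiv hρ0
  set f := hθc.localInverse hequiv hr0 with hf
  have hfc : ContDiffAt ℝ r f 1 := by
    have := hθc.to_localInverse hequiv hr0
    rwa [hθ1] at this
  have hf1 : f 1 = 1 := by
    have := hθc.localInverse_apply_image hequiv hr0
    rwa [hθ1] at this
  have hinv : ∀ᶠ z in 𝓝 1, f z / Δ (f z) = z := by
    have := (hθc.hasStrictFDerivAt' hequiv hr0).eventually_right_inverse
    rwa [hθ1] at this
  have hΔf : ContDiffAt ℝ r (Δ ∘ f) 1 := by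
    refine ContDiffAt.comp 1 ?_ hfc
    rwa [hf1]
  have hfix : f =ᶠ[𝓝 1] fun z => z * (Δ ∘ f) z := by
    filter_upwards [hinv, hΔf.continuousAt.eventually_ne
      (show (Δ ∘ f) 1 ≠ 0 by simp [hf1, h1])] with z hz hz0
    rw [Function.comp_apply] at hz0 ⊢
    exact (div_eq_iff hz0).mp hz
  have hfd : HasDerivAt f (deriv f 1) 1 := ((hfc.of_le hr1).differentiableAt (by simp)).hasDerivAt
  have hΔfd : HasDerivAt (Δ ∘ f) (ρ * deriv f 1) 1 :=
    HasDerivAt.comp 1 (by rwa [hf1]) hfd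
  have hd1 : deriv f 1 = 1 / (1 - ρ) := by
    have h3 : deriv f 1 = 1 + ρ * deriv f 1 := by
      nth_rw 1 [hfix.deriv_eq]
      rw [((hasDerivAt_id' (1 : ℝ)).fun_mul hΔfd).deriv]
      simp [hf1, h1]
    rw [eq_div_iff hρ0]
    linarith
  refine ⟨f, hfc, hf1, ?_, hinv, hd1, fun h2r => ?_⟩
  · refine tendsto_nhdsWithin_iff.mpr ⟨?_, ?_⟩
    · have := hfc.continuousAt.tendsto.mono_left (nhdsWithin_le_nhds (s := Set.Iio 1))
      rwa [hf1] at this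
    · have hd : HasDerivAt (fun z => f z - 1) (deriv f 1) 1 := hfd.sub_const 1
      filter_upwards [eventually_neg_left_of_deriv_pos (g := fun z => f z - 1)
        (by rw [hd.deriv, hd1]; exact one_div_pos.mpr (by linarith)) (by simp [hf1])] with z hz
      exact sub_neg.mp hz
  · have hr2 : (2 : WithTop ℕ∞) ≤ r := by exact_mod_cast h2r
    have hc2 : iteratedDeriv 2 (Δ ∘ f) 1 =
        iteratedDeriv 2 Δ 1 * deriv f 1 ^ 2 + ρ * iteratedDeriv 2 f 1 := by
      have := iteratedDeriv_comp_two (x := (1 : ℝ)) (g := Δ) (f := f)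
        (by rw [hf1]; exact hΔ.of_le hr2) (hfc.of_le hr2)
      rwa [hf1] at this
    have h3 : iteratedDeriv 2 f 1 = 2 * (ρ * deriv f 1) + iteratedDeriv 2 (Δ ∘ f) 1 := by
      rw [hfix.iteratedDeriv_eq 2, iteratedDeriv_fun_mul (f := fun z : ℝ => z) (n := 2)
        (contDiffAt_id) (hΔf.of_le hr2)]
      simp only [Finset.sum_range_succ, Finset.sum_range_zero, iteratedDeriv_one,
        iteratedDeriv_zero]
      have : iteratedDeriv 2 (fun z : ℝ => z) 1 = 0 := by
        rw [iteratedDeriv_succ, iteratedDeriv_one]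
        simp
      simp [this, hΔfd.deriv]
      ring
    rw [hc2, hd1] at h3
    field_simp at h3 ⊢
    linarith

/-- For functions with value `1` at `1`, the mixed terms of the second derivative of the product are
the products of the first derivatives of two different factors. -/
lemma iteratedDeriv_two_prod {ι : Type*} (s : Finset ι) {D : ι → ℝ → ℝ}
    (hD : ∀ i, ContDiffAt ℝ 2 (D i) 1)
    (h1 : ∀ i, D i 1 = 1) :
    iteratedDeriv 2 (fun y => ∏ i ∈ s, D i y) 1 = ∑ i ∈ s, iteratedDeriv 2 (D i) 1 +
      ((∑ i ∈ s, deriv (D i) 1) ^ 2 - ∑ i ∈ s, deriv (D i) 1 ^ 2) := by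
  classical
  induction s using Finset.induction_on with
  | empty => simp [iteratedDeriv_succ]
  | insert a s ha ih =>
    have hP : ContDiffAt ℝ 2 (fun y => ∏ i ∈ s, D i y) 1 := contDiffAt_prod fun i _ => hD i
    have hPd : deriv (fun y => ∏ i ∈ s, D i y) 1 = ∑ i ∈ s, deriv (D i) 1 := by
      have := (HasDerivAt.fun_finsetProd (u := s) (f := D) (x := 1) fun i _ =>
        ((hD i).differentiableAt (by simp)).hasDerivAt).deriv
      rw [this]
      simp [h1]
    simp only [Finset.prod_insert ha, Finset.sum_insert ha]
    rw [iteratedDeriv_fun_mul (n := 2) (hD a) hP]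
    simp only [Finset.sum_range_succ, Finset.sum_range_zero, iteratedDeriv_one,
      iteratedDeriv_zero]
    simp [h1, ih, hPd]
    ring

/-! ### The eigenvalue of one class as a function of the service work -/

lemma summable_toReal_pmf (p : PMF ℕ) : Summable fun n => (p n).toReal :=
  ENNReal.summable_toReal p.tsum_coe_ne_top

lemma tsum_pmf_pow (p : PMF ℕ) {y : ℝ} (hy : y ∈ Set.Icc (0 : ℝ) 1) :
    ∑' b, p b * ENNReal.ofReal y ^ b = ENNReal.ofReal (genSeries (fun n => (p n).toReal) y) := by
  have h0 : ∀ n, 0 ≤ (p n).toReal * y ^ n := fun n =>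
    mul_nonneg ENNReal.toReal_nonneg (pow_nonneg hy.1 n)
  rw [genSeries, ENNReal.ofReal_tsum_of_nonneg h0
    ((summable_toReal_pmf p).of_nonneg_of_le h0 fun n =>
      mul_le_of_le_one_right ENNReal.toReal_nonneg (pow_le_one₀ hy.1 hy.2))]
  refine tsum_congr fun n => ?_
  rw [ENNReal.ofReal_mul ENNReal.toReal_nonneg, ENNReal.ofReal_toReal (p.apply_ne_top n),
    ENNReal.ofReal_pow hy.1]

lemma genSeries_pmf_mem_Icc (p : PMF ℕ) {y : ℝ} (hy : y ∈ Set.Icc (0 : ℝ) 1) :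
    genSeries (fun n => (p n).toReal) y ∈ Set.Icc (0 : ℝ) 1 := by
  refine ⟨tsum_nonneg fun n => mul_nonneg ENNReal.toReal_nonneg (pow_nonneg hy.1 n), ?_⟩
  rw [← ENNReal.ofReal_le_one, ← tsum_pmf_pow p hy, ← p.tsum_coe]
  exact ENNReal.tsum_le_tsum fun n =>
    mul_le_of_le_one_right zero_le (pow_le_one₀ zero_le (ENNReal.ofReal_le_one.mpr hy.2))

lemma tsum_toReal_descFactorial (p : PMF ℕ) (i : ℕ) :
    ∑' n : ℕ, (n.descFactorial i : ℝ) * (p n).toReal =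
      (∑' n : ℕ, (n.descFactorial i : ℝ≥0∞) * p n).toReal := by
  rw [ENNReal.tsum_toReal_eq fun n => ENNReal.mul_ne_top (ENNReal.natCast_ne_top _)
    (p.apply_ne_top n)]
  simp

lemma tsum_descFactorial_le_secondMoment (p : ℕ → ℝ≥0∞) :
    ∑' n : ℕ, (n.descFactorial 2 : ℝ≥0∞) * p n ≤ secondMoment p := by
  refine ENNReal.tsum_le_tsum fun n => mul_le_mul' ?_ le_rfl
  exact_mod_cast Nat.descFactorial_le_pow n 2

namespace ArrivalStream

variable {s : ArrivalStream} {π : PMF (Fin (s.M + 1))}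

lemma FiniteSecondMoments.arr_two_ne_top (h : s.FiniteSecondMoments) (i j) : s.arr 2 i j ≠ ∞ := by
  by_cases hP : s.P i j = 0
  · simp [arr, hP]
  · have h1 : s.arr 2 i j = s.P i j * ∑' n : ℕ, (n.descFactorial 2 : ℝ≥0∞) * s.a i j n := by
      rw [arr, ← ENNReal.tsum_mul_left]
      exact tsum_congr fun n => by ring
    rw [h1]
    exact ENNReal.mul_ne_top ((s.P i).apply_ne_top j)
      (((tsum_descFactorial_le_secondMoment _).trans_lt (h.2 i j hP).lt_top).ne)

lemma rate_ne_top (hload : s.load π ≠ ∞) : s.rate π ≠ ∞ := fun h => by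
  refine hload ?_
  rw [load, h, ENNReal.top_mul]
  exact (zero_lt_one.trans_le (one_le_mean s.h_pos)).ne'

lemma mean_h_ne_top (hπ : π.bind s.P = π) (hload : s.load π ≠ ∞) : mean s.h ≠ ∞ := fun h => by
  refine hload ?_
  rw [load, h, ENNReal.mul_top (rate_ne_zero hπ)]

/-- The curve of eigenvalues of `A_k(w)` through `1`, together with its first two derivatives. -/
lemma exists_delta_curve_deriv (hπ : π.bind s.P = π) (hrate : s.rate π ≠ ∞) {r : ℕ} (hr : r ≠ 0)
    (hmom : ∀ i j, s.arr r i j ≠ ∞) :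
    ∃ (x : ℝ → ℝ) (u : ℝ → Fin (s.M + 1) → ℝ), ContDiffAt ℝ r x 1 ∧ x 1 = 1 ∧
      (∀ w, u w 0 = 1) ∧ deriv x 1 = (s.rate π).toReal ∧
      (r = 2 → iteratedDeriv 2 x 1 = s.delta2 π) ∧
      (∀ᶠ w in 𝓝 (1 : ℝ), 0 < x w ∧ ∀ i, 0 < u w i) ∧
      (∀ᶠ w in 𝓝 (1 : ℝ), w ∈ Set.Icc (0 : ℝ) 1 →
        s.delta w = x w ∧ ∀ i, ∑ j, s.genMatrix w i j * u w j = x w * u w i) := by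
  have h1 := arr_one_ne_top hπ hrate
  obtain ⟨x, u, G, hx, hu, hx1, hu1, hu0, hG, hG1, hE, hGd, hpos, hdelta⟩ :=
    exists_delta_curve hπ hr hmom
  have hr1 : (1 : WithTop ℕ∞) ≤ r := by exact_mod_cast Nat.one_le_iff_ne_zero.mpr hr
  have hd : deriv x 1 = (s.rate π).toReal := by
    rw [eigen_curve_deriv_eq (sum_stationary hπ) (sum_toReal_eq_one π)
      (fun i j => (hG i j).of_le hr1) hG1 (hx.of_le hr1) (fun i => (hu i).of_le hr1) hx1 hu1 hE,
      rate_toReal h1]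
    refine Finset.sum_congr rfl fun i _ => Finset.sum_congr rfl fun j _ => ?_
    rw [← hGd 1 (Nat.one_le_iff_ne_zero.mpr hr), iteratedDeriv_one]
  refine ⟨x, u, hx, hx1, hu0, hd, ?_, hpos, hdelta⟩
  rintro rfl
  exact iteratedDeriv_two_eq_delta2 hπ h1 hmom hx hu hx1 hu1 hu0 hG hG1 hE hGd hd

theorem hasLeftDerivAtOne_delta (hπ : π.bind s.P = π) (hrate : s.rate π ≠ ∞)
    (hmom : ∀ i j, s.arr 2 i j ≠ ∞) : HasLeftDerivAtOne 2 s.delta (s.delta2 π) := by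
  obtain ⟨x, u, hx, -, -, -, h2, -, hdelta⟩ :=
    exists_delta_curve_deriv hπ hrate two_ne_zero hmom
  rw [← h2 rfl]
  refine hasLeftDerivAtOne_of_eq_left hx ?_
  filter_upwards [hdelta.filter_mono nhdsWithin_le_nhds, eventually_left_mem_Ioo] with w hw hw1
  exact (hw ⟨hw1.1.le, hw1.2.le⟩).1

/-- The eigenvalue `D y = δ_k(H_k(y))` near `1`, where `H_k` is the generating function of the
service time. -/
theorem exists_work_curve (hπ : π.bind s.P = π) (hload : s.load π ≠ ∞) {r : ℕ} (hr : r ≠ 0)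
    (hmom : ∀ i j, s.arr r i j ≠ ∞) (hh : ∑' n : ℕ, (n.descFactorial r : ℝ≥0∞) * s.h n ≠ ∞) :
    ∃ D : ℝ → ℝ, ContDiffAt ℝ r D 1 ∧ D 1 = 1 ∧ deriv D 1 = (s.load π).toReal ∧
      (r = 2 → iteratedDeriv 2 D 1 = 2 * (s.load π).toReal * (equilibriumMean s.h).toReal +
        (mean s.h).toReal ^ 2 * s.delta2 π) ∧
      ∀ᶠ y in 𝓝[<] (1 : ℝ), 0 < D y ∧ ∃ u : Fin (s.M + 1) → ℝ≥0∞,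
        (∀ i, u i ≠ ∞) ∧ (∀ i, u i ≠ 0) ∧ u 0 = 1 ∧
        ∀ i, ∑ j, s.P i j * u j * ∑' m, s.a i j m * (∑' b, s.h b * ENNReal.ofReal y ^ b) ^ m =
          ENNReal.ofReal (D y) * u i := by
  have hr1 : (1 : WithTop ℕ∞) ≤ r := by exact_mod_cast Nat.one_le_iff_ne_zero.mpr hr
  obtain ⟨x, u, hx, hx1, hu0, hxd, hx2, hpos, hdelta⟩ :=
    exists_delta_curve_deriv hπ (rate_ne_top hload) hr hmom
  have hp : ∀ n, 0 ≤ (s.h n).toReal := fun n => ENNReal.toReal_nonneg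
  have hsd : Summable fun n : ℕ => (n.descFactorial r : ℝ) * (s.h n).toReal := by
    simpa using ENNReal.summable_toReal hh
  obtain ⟨f, hf, hfs, hfd⟩ := exists_contDiff_extension r _ hp (summable_toReal_pmf s.h)
    (summable_pow_mul_of_descFactorial hp (summable_toReal_pmf s.h) hsd)
  simp only [tsum_toReal_descFactorial] at hfd
  have hf1 : f 1 = 1 := by
    have := hfd 0 (Nat.zero_le r)
    simpa [s.h.tsum_coe] using this
  have hfd1 : deriv f 1 = (mean s.h).toReal := by
    have := hfd 1 (Nat.one_le_iff_ne_zero.mpr hr)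
    simpa [mean, iteratedDeriv_one] using this
  have hf' : ContDiffAt ℝ r f 1 := hf.contDiffAt
  have hx' : ContDiffAt ℝ r x (f 1) := by rwa [hf1]
  have hD : HasDerivAt (x ∘ f) ((s.rate π).toReal * (mean s.h).toReal) 1 := by
    rw [← hxd, ← hfd1]
    refine HasDerivAt.comp 1 ?_ ((hf'.of_le hr1).differentiableAt (by simp)).hasDerivAt
    rw [hf1]
    exact ((hx.of_le hr1).differentiableAt (by simp)).hasDerivAt
  refine ⟨x ∘ f, hx'.comp 1 hf', by simp [hf1, hx1], ?_, ?_, ?_⟩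
  · rw [hD.deriv, load, ENNReal.toReal_mul]
  · rintro rfl
    have hm : (mean s.h).toReal ≠ 0 :=
      (ENNReal.toReal_pos (zero_lt_one.trans_le (one_le_mean s.h_pos)).ne'
        (mean_h_ne_top hπ hload)).ne'
    rw [iteratedDeriv_comp_two hx' hf', hf1, hx2 rfl, hxd, hfd1, hfd 2 le_rfl, load,
      ENNReal.toReal_mul, equilibriumMean_toReal]
    field_simp
    ring
  · have hft : Tendsto f (𝓝[<] 1) (𝓝 1) := by
      have := hf'.continuousAt.tendsto.mono_left (nhdsWithin_le_nhds (s := Set.Iio 1))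
      rwa [hf1] at this
    filter_upwards [hft.eventually hpos, hft.eventually hdelta, eventually_left_mem_Ioo]
      with y hy1 hy2 hy
    have hyI : y ∈ Set.Icc (0 : ℝ) 1 := ⟨hy.1.le, hy.2.le⟩
    have hfI : f y ∈ Set.Icc (0 : ℝ) 1 := by
      rw [hfs y hyI]
      exact genSeries_pmf_mem_Icc s.h hyI
    refine ⟨hy1.1, fun i => ENNReal.ofReal (u (f y) i), fun i => ENNReal.ofReal_ne_top,
      fun i => (ENNReal.ofReal_pos.mpr (hy1.2 i)).ne', by simp [hu0], fun i => ?_⟩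
    have hgm : ∀ j, s.genMatrix (f y) i j =
        (s.P i j).toReal * genSeries (fun m => (s.a i j m).toReal) (f y) := fun _ => rfl
    have hg0 : ∀ j, 0 ≤ s.genMatrix (f y) i j := fun j => by
      rw [hgm]
      exact mul_nonneg ENNReal.toReal_nonneg (genSeries_pmf_mem_Icc (s.a i j) hfI).1
    rw [Function.comp_apply, ← ENNReal.ofReal_mul hy1.1.le, ← (hy2 hfI).2 i,
      ENNReal.ofReal_sum_of_nonneg fun j _ => mul_nonneg (hg0 j) (hy1.2 j).le]
    refine Finset.sum_congr rfl fun j _ => ?_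
    rw [tsum_pmf_pow s.h hyI, ← hfs y hyI, tsum_pmf_pow _ hfI, ENNReal.ofReal_mul (hg0 j), hgm,
      ENNReal.ofReal_mul ENNReal.toReal_nonneg, ENNReal.ofReal_toReal ((s.P i).apply_ne_top j)]
    ring

end ArrivalStream

/-! ### The moments of the busy cycle -/

section Queue

variable {K : ℕ} {Ω : Type*} {stream : Fin K → ArrivalStream}
  {X₀ : Ω → ℕ} {S : (k : Fin K) → ℕ → Ω → Fin ((stream k).M + 1)}
  {A : Fin K → ℕ → Ω → ℕ} {H : Fin K → ℕ → ℕ → Ω → ℕ} [MeasurableSpace Ω] {μ : Measure Ω}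

lemma prod_range_natCast_sub (n r : ℕ) :
    ∏ i ∈ Finset.range r, ((n : ℝ≥0∞) - (i : ℝ≥0∞)) = n.descFactorial r := by
  rw [Nat.descFactorial_eq_prod_range, Nat.cast_prod]
  exact Finset.prod_congr rfl fun i _ => (ENNReal.natCast_sub n i).symm

/-- If the generating function of the passage time agrees to the left of `1` with a function that is
`C ^ r` at `1`, then its limiting derivative and the factorial moment are the derivative of that
function. -/
lemma moments_of_eq_left {X : ℕ → Ω → ℕ} (hX : ∀ n, Measurable (X n)) (ν : Measure Ω)
    [IsProbabilityMeasure ν] {r : ℕ} {f : ℝ → ℝ} (hf : ContDiffAt ℝ r f 1) (hf1 : f 1 = 1)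
    (h : genSeries (fun n => (ν (busyCycle X ⁻¹' {(n : ℕ∞)})).toReal) =ᶠ[𝓝[<] 1] f) :
    HasLeftDerivAtOne r (genFun ν (busyCycle X)) (iteratedDeriv r f 1) ∧
      factorialMoment ν (busyCycle X) r ≠ ∞ ∧
      (factorialMoment ν (busyCycle X) r).toReal = iteratedDeriv r f 1 := by
  set p : ℕ → ℝ≥0∞ := fun n => ν (busyCycle X ⁻¹' {(n : ℕ∞)}) with hp
  have hp0 : ∀ n, 0 ≤ (p n).toReal := fun n => ENNReal.toReal_nonneg
  have hpt : ∀ n, p n ≠ ∞ := fun n => measure_ne_top _ _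
  -- the total mass of the finite values of the passage time
  have hmass : ν (busyCycle X ⁻¹' {⊤})ᶜ = ∑' n, p n := by
    rw [← lintegral_indicator_one (measurableSet_busyCycle_eq hX ⊤).compl]
    have := lintegral_busyCycle hX ν (g := fun y => if y = ⊤ then 0 else 1) (Or.inl (by simp))
    simp only [ENat.natCast_ne_top, if_false, one_mul] at this
    rw [← this]
    refine lintegral_congr fun ω => ?_
    by_cases hω : busyCycle X ω = ⊤ <;> simp [Set.indicator, hω]
  have hsum : ∑' n, p n ≠ ∞ := by rw [← hmass]; exact measure_ne_top _ _
  have hs : Summable fun n => (p n).toReal := ENNReal.summable_toReal hsum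
  have h0 : HasSum (fun n => (p n).toReal) 1 := by
    have := hasSum_descFactorial_of_eq_left (r := 0) hp0 hs (hf.of_le (by simp)) h
    simpa [hf1] using this
  have htop : ν (busyCycle X ⁻¹' {⊤}) = 0 := by
    have h1 : ∑' n, p n = 1 := by
      rw [← ENNReal.toReal_eq_one_iff, ENNReal.tsum_toReal_eq hpt, h0.tsum_eq]
    rw [h1] at hmass
    simpa using (prob_compl_eq_zero_iff (measurableSet_busyCycle_eq hX ⊤).compl).mpr hmass
  have hr := hasSum_descFactorial_of_eq_left hp0 hs hf h
  have hfac : factorialMoment ν (busyCycle X) r = ENNReal.ofReal (iteratedDeriv r f 1) := by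
    have h1 : factorialMoment ν (busyCycle X) r = ∑' n : ℕ, (n.descFactorial r : ℝ≥0∞) * p n := by
      have := lintegral_busyCycle hX ν
        (g := fun y => ∏ i ∈ Finset.range r, ((y : ℝ≥0∞) - (i : ℝ≥0∞))) (Or.inr htop)
      simp only [ENat.toENNReal_coe, prod_range_natCast_sub] at this
      exact this
    rw [h1, ← hr.tsum_eq, ENNReal.ofReal_tsum_of_nonneg
      (fun n => mul_nonneg (Nat.cast_nonneg _) (hp0 n)) hr.summable]
    refine tsum_congr fun n => ?_
    rw [ENNReal.ofReal_mul (Nat.cast_nonneg _), ENNReal.ofReal_natCast,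
      ENNReal.ofReal_toReal (hpt n)]
  refine ⟨hasLeftDerivAtOne_of_eq_left hf ?_, by rw [hfac]; exact ENNReal.ofReal_ne_top, ?_⟩
  · filter_upwards [h, eventually_left_mem_Ioo] with z hz hz1
    rw [genFun_eq_genSeries hX ν hz1.1.le, hz]
  · rw [hfac, ENNReal.toReal_ofReal]
    rw [← hr.tsum_eq]
    exact tsum_nonneg fun n => mul_nonneg (Nat.cast_nonneg _) (hp0 n)

/-- The generating function of the busy cycle is the inverse function of `y ↦ y / ∏ δ_k(H_k(y))`
near `1`, hence as smooth at `1` as the given moments are finite. -/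
theorem IsQueue.busyCycle_moments [IsProbabilityMeasure μ] (hQ : IsQueue stream μ X₀ S A H)
    {π : (k : Fin K) → PMF (Fin ((stream k).M + 1))} (hπ : ∀ k, (π k).bind (stream k).P = π k)
    (hρ : ∑ k, (stream k).load (π k) < 1)
    (hstart : IsSteady μ (workload X₀ A H) S ∨ μ (cycleStart (workload X₀ A H) S) ≠ 0)
    {r : ℕ} (hr : r ≠ 0) (hmom : ∀ k i j, (stream k).arr r i j ≠ ∞)
    (hh : ∀ k, ∑' n : ℕ, (n.descFactorial r : ℝ≥0∞) * (stream k).h n ≠ ∞) :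
    ∃ L : ℝ, (r = 1 → L = 1 / (1 - ∑ k, ((stream k).load (π k)).toReal)) ∧
      (r = 2 → L = 2 * (∑ k, ((stream k).load (π k)).toReal) /
          (1 - ∑ k, ((stream k).load (π k)).toReal) ^ 2 +
        1 / (1 - ∑ k, ((stream k).load (π k)).toReal) ^ 3 *
        ∑ k, (2 * ((stream k).load (π k)).toReal * (equilibriumMean (stream k).h).toReal +
          ((stream k).load (π k)).toReal *
            ((∑ k, ((stream k).load (π k)).toReal) - ((stream k).load (π k)).toReal) +
          (mean (stream k).h).toReal ^ 2 * (stream k).delta2 (π k))) ∧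
      HasLeftDerivAtOne r
        (genFun (cond μ (cycleStart (workload X₀ A H) S)) (busyCycle (workload X₀ A H))) L ∧
      factorialMoment (cond μ (cycleStart (workload X₀ A H) S))
        (busyCycle (workload X₀ A H)) r ≠ ∞ ∧
      (factorialMoment (cond μ (cycleStart (workload X₀ A H) S))
        (busyCycle (workload X₀ A H)) r).toReal = L := by
  have hr1 : (1 : WithTop ℕ∞) ≤ r := by exact_mod_cast Nat.one_le_iff_ne_zero.mpr hr
  have hload : ∀ k, (stream k).load (π k) ≠ ∞ := fun k =>
    ENNReal.sum_ne_top.mp (hρ.trans ENNReal.one_lt_top).ne k (Finset.mem_univ k)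
  set ρ' : Fin K → ℝ := fun k => ((stream k).load (π k)).toReal with hρ'
  set ρ := ∑ k, ρ' k with hρdef
  have hρ1 : ρ < 1 := by
    rw [hρdef, ← ENNReal.toReal_sum fun k _ => hload k, ← ENNReal.toReal_one]
    exact (ENNReal.toReal_lt_toReal (hρ.trans ENNReal.one_lt_top).ne ENNReal.one_ne_top).mpr hρ
  choose D hDc hD1 hDd hD2 hDe using fun k =>
    ArrivalStream.exists_work_curve (hπ k) (hload k) hr (hmom k) (hh k)
  set Δ : ℝ → ℝ := fun y => ∏ k, D k y with hΔ
  have hΔc : ContDiffAt ℝ r Δ 1 := contDiffAt_prod fun k _ => hDc k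
  have hΔ1 : Δ 1 = 1 := by simp [hΔ, hD1]
  have hΔd : deriv Δ 1 = ρ := by
    have := (HasDerivAt.fun_finsetProd (u := Finset.univ) (f := D) (x := 1) fun k _ =>
      (((hDc k).of_le hr1).differentiableAt (by simp)).hasDerivAt).deriv
    rw [hΔ, this]
    simp [hD1, hDd, hρdef, hρ']
  obtain ⟨f, hfc, hf1, hft, hfinv, hfd, hf2⟩ :=
    exists_inverse_curve hr hΔc hΔ1 (by rw [hΔd]; exact hρ1)
  have hlt : ∀ᶠ y in 𝓝[<] (1 : ℝ), y < Δ y :=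
    eventually_lt_of_deriv_lt_one ((hΔc.of_le hr1).differentiableAt (by simp)) hΔ1
      (by rw [hΔd]; exact hρ1)
  -- the same data with values in the extended nonnegative reals
  have hev : ∀ᶠ y in 𝓝[<] (1 : ℝ), y ∈ Set.Ioo (0 : ℝ) 1 ∧ 0 < Δ y ∧
      ∃ (u : (k : Fin K) → Fin ((stream k).M + 1) → ℝ≥0∞) (δ : Fin K → ℝ≥0∞),
        (∀ k i, u k i ≠ ∞) ∧ (∀ k i, u k i ≠ 0) ∧ (∀ k, u k 0 = 1) ∧ (∀ k, δ k ≠ ∞) ∧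
        (∀ k i, ∑ j, (stream k).P i j * u k j * ∑' m, (stream k).a i j m *
          (∑' b, (stream k).h b * ENNReal.ofReal y ^ b) ^ m = δ k * u k i) ∧
        ∏ k, δ k = ENNReal.ofReal (Δ y) ∧ ENNReal.ofReal y < ∏ k, δ k := by
    filter_upwards [hlt, eventually_all.mpr hDe, eventually_left_mem_Ioo] with y hy1 hy2 hy
    choose hpos u hut hu0 hu1 heig using hy2
    have hprod : ∏ k, ENNReal.ofReal (D k y) = ENNReal.ofReal (Δ y) :=
      (ENNReal.ofReal_prod_of_nonneg fun k _ => (hpos k).le).symm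
    refine ⟨hy, hy.1.trans hy1, u, fun k => ENNReal.ofReal (D k y), hut, hu0, hu1,
      fun k => ENNReal.ofReal_ne_top, heig, hprod, ?_⟩
    rw [hprod]
    exact (ENNReal.ofReal_lt_ofReal_iff (hy.1.trans hy1)).mpr hy1
  have hI0 : μ (cycleStart (workload X₀ A H) S) ≠ 0 := by
    rcases hstart with hs | h0
    · obtain ⟨y, hy, -, u, δ, hut, hu0, -, hδ, heig, -, hyδ⟩ := hev.exists
      exact hQ.measure_cycleStart_ne_zero hs hut hu0 hδ heig (ENNReal.ofReal_pos.mpr hy.1).ne'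
        (ENNReal.ofReal_le_one.mpr hy.2.le) hyδ
    · exact h0
  set X := workload X₀ A H with hX
  set I := cycleStart X S with hI
  have hXm : ∀ n, Measurable (X n) := hQ.measurable_workload
  have hIm : MeasurableSet I := hQ.measurableSet_cycleStart
  have := cond_isProbabilityMeasure hI0
  have hgen : genSeries (fun n => (cond μ I (busyCycle X ⁻¹' {(n : ℕ∞)})).toReal)
      =ᶠ[𝓝[<] 1] f := by
    filter_upwards [hft.eventually hev, hfinv.filter_mono nhdsWithin_le_nhds,
      eventually_left_mem_Ioo] with z hz hzf hz1
    obtain ⟨hy, hΔpos, u, δ, hut, -, hu1, hδ, heig, hprod, hyδ⟩ := hz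
    have h1 := hQ.tsum_passage hut hu1 hδ heig (ENNReal.ofReal_le_one.mpr hy.2.le) hyδ
    rw [hprod, ← ENNReal.ofReal_div_of_pos hΔpos, hzf] at h1
    have h2 : ∑' n : ℕ, cond μ I (busyCycle X ⁻¹' {(n : ℕ∞)}) * ENNReal.ofReal z ^ n =
        ENNReal.ofReal (f z) := by
      simp only [cond_apply hIm, mul_assoc]
      rw [ENNReal.tsum_mul_left, h1, mul_left_comm,
        ENNReal.inv_mul_cancel hI0 (measure_ne_top _ _), mul_one]
    have h3 := congrArg ENNReal.toReal h2
    rw [ENNReal.tsum_toReal_eq fun n => ENNReal.mul_ne_top (measure_ne_top _ _)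
      (ENNReal.pow_ne_top ENNReal.ofReal_ne_top), ENNReal.toReal_ofReal hy.1.le] at h3
    rw [← h3, genSeries]
    refine tsum_congr fun n => ?_
    rw [ENNReal.toReal_mul, ENNReal.toReal_pow, ENNReal.toReal_ofReal hz1.1.le]
  refine ⟨iteratedDeriv r f 1, ?_, ?_, moments_of_eq_left hXm (cond μ I) hfc hf1 hgen⟩
  · rintro rfl
    rw [iteratedDeriv_one, hfd, hΔd]
  · rintro rfl
    rw [hf2 le_rfl, hΔd, hΔ, iteratedDeriv_two_prod Finset.univ hDc hD1]
    simp only [hDd, fun k => hD2 k rfl]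
    change 2 * ρ / (1 - ρ) ^ 2 + 1 / (1 - ρ) ^ 3 * (∑ k, (2 * ρ' k * (equilibriumMean
      (stream k).h).toReal + (mean (stream k).h).toReal ^ 2 * (stream k).delta2 (π k)) +
        (ρ ^ 2 - ∑ k, ρ' k ^ 2)) = _
    congr 2
    simp only [Finset.sum_add_distrib, mul_sub, Finset.sum_sub_distrib, ← Finset.sum_mul]
    simp only [← pow_two]
    ring

end Queue

end BusyCycle

theorem mainTheorem4 {K : ℕ} (stream : Fin K → BusyCycle.ArrivalStream)
    {Ω : Type*} [MeasurableSpace Ω] (μ : Measure Ω) [IsProbabilityMeasure μ]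
    (X₀ : Ω → ℕ) (S : (k : Fin K) → ℕ → Ω → Fin ((stream k).M + 1))
    (A : Fin K → ℕ → Ω → ℕ) (H : Fin K → ℕ → ℕ → Ω → ℕ)
    (hQ : BusyCycle.IsQueue stream μ X₀ S A H)
    -- the stationary distributions of the underlying chains
    (π : (k : Fin K) → PMF (Fin ((stream k).M + 1)))
    (hπ : ∀ k, (π k).bind (stream k).P = π k)
    -- stability
    (hρ : ∑ k, (stream k).load (π k) < 1)
    -- steady state, or any other initial law that charges `(X_0, S_0) = (0, 0)`
    (hstart : BusyCycle.IsSteady μ (BusyCycle.workload X₀ A H) S ∨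
      μ (BusyCycle.cycleStart (BusyCycle.workload X₀ A H) S) ≠ 0) :
    let X : ℕ → Ω → ℕ := BusyCycle.workload X₀ A H
    let F : Ω → ℕ∞ := BusyCycle.busyCycle X
    let ν : Measure Ω := ProbabilityTheory.cond μ (BusyCycle.cycleStart X S)
    let f₀ : ℝ → ℝ := BusyCycle.genFun ν F
    let ρ' : Fin K → ℝ := fun k => ((stream k).load (π k)).toReal
    let ρ : ℝ := ∑ k, ρ' k
    let EH : Fin K → ℝ := fun k => (BusyCycle.mean (stream k).h).toReal
    let EHtilde : Fin K → ℝ := fun k => (BusyCycle.equilibriumMean (stream k).h).toReal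
    let m₁ : ℝ := 1 / (1 - ρ)
    let m₂ : ℝ := 2 * ρ / (1 - ρ) ^ 2 + 1 / (1 - ρ) ^ 3 *
      ∑ k, (2 * ρ' k * EHtilde k + ρ' k * (ρ - ρ' k) + EH k ^ 2 * (stream k).delta2 (π k))
    -- first factorial moment
    (BusyCycle.HasLeftDerivAtOne 1 f₀ m₁ ∧
      BusyCycle.factorialMoment ν F 1 ≠ ∞ ∧ (BusyCycle.factorialMoment ν F 1).toReal = m₁) ∧
    -- second factorial moment
    ((∀ k, (stream k).FiniteSecondMoments) →
      (∀ k, BusyCycle.HasLeftDerivAtOne 2 (stream k).delta ((stream k).delta2 (π k))) ∧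
      BusyCycle.HasLeftDerivAtOne 2 f₀ m₂ ∧
      BusyCycle.factorialMoment ν F 2 ≠ ∞ ∧
      (BusyCycle.factorialMoment ν F 2).toReal = m₂) := by
  intro X F ν f₀ ρ' ρ EH EHtilde m₁ m₂
  have hload : ∀ k, (stream k).load (π k) ≠ ∞ := fun k =>
    ENNReal.sum_ne_top.mp (hρ.trans ENNReal.one_lt_top).ne k (Finset.mem_univ k)
  have hrate := fun k => BusyCycle.ArrivalStream.rate_ne_top (hload k)
  refine ⟨?_, fun h2 => ⟨fun k => ?_, ?_⟩⟩
  · obtain ⟨L, hL, -, h⟩ := hQ.busyCycle_moments hπ hρ hstart Nat.one_ne_zero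
      (fun k => BusyCycle.ArrivalStream.arr_one_ne_top (hπ k) (hrate k)) fun k => by
        simpa [BusyCycle.mean] using BusyCycle.ArrivalStream.mean_h_ne_top (hπ k) (hload k)
    rw [hL rfl] at h
    exact h
  · exact BusyCycle.ArrivalStream.hasLeftDerivAtOne_delta (hπ k) (hrate k) (h2 k).arr_two_ne_top
  · obtain ⟨L, -, hL, h⟩ := hQ.busyCycle_moments hπ hρ hstart two_ne_zero
      (fun k => (h2 k).arr_two_ne_top) fun k =>
        ((BusyCycle.tsum_descFactorial_le_secondMoment _).trans_lt (h2 k).1.lt_top).ne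
    rw [hL rfl] at h
    exact h
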